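/- **Setting.** Let $J\ge 2$, $L,\hat L>0$, $\eta,\varepsilon\ge 0$. Consider the optimized Schwarz method with Robin transmission conditions for $\Delta u-(\eta-i\varepsilon)u=f$ on the $J$ overlapping strip subdomains $\Omega_j=(a_j,b_j)\times(0,\hat L)$, $a_j=(j-1)L-\frac{\delta}{2}$, $b_j=jL+\frac{\delta}{2}$, with overlap $\delta>0$ and homogeneous Dirichlet conditions on the outer boundary: $$-\partial_xu_j^n+p^-u_j^n=-\partial_xu_{j-1}^{n-1}+p^-u_{j-1}^{n-1}\ \text{ at }x=a_j\ (j\ge2),\qquad \partial_xu_j^n+p^+u_j^n=\partial_xu_{j+1}^{n-1}+p^+u_{j+1}^{n-1}\ \text{ at }x=b_j\ (j\le J-1),$$ where the real parameters $p^\pm>0$ are the same at all interfaces. After a sine expansion in $y$ with frequency $\tilde k$, put $\lambda=\lambda(\tilde k)=\sqrt{\tilde k^2+\eta-i\varepsilon}$ ($\Re\lambda>0$). The transmitted Robin traces $\mathcal R_+(b_j)$ ($1\le j\le J-1$) and $\mathcal R_-(a_j)$ ($2\le j\le J$) of the error then satisfy the iteration $$\mathcal R_-^{n}(a_j)=\alpha\,\mathcal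 R_-^{n-1}(a_{j-1})+\beta_j^-\,\mathcal R_+^{n-1}(b_{j-1}),\qquad \mathcal R_+^{n}(b_j)=\beta_j^+\,\mathcal R_-^{n-1}(a_{j+1})+\alpha\,\mathcal R_+^{n-1}(b_{j+1}),$$ where the $\alpha$-terms involving the absent traces $\mathcal R_-(a_1)$, $\mathcal R_+(b_J)$ are omitted, with $D=(\lambda+p^+)(\lambda+p^-)e^{\lambda(L+\delta)}-(\lambda-p^+)(\lambda-p^-)e^{-\lambda(L+\delta)}$, $$\alpha=\frac{(\lambda+p^+)(\lambda+p^-)e^{\lambda\delta}-(\lambda-p^+)(\lambda-p^-)e^{-\lambda\delta}}{D},\qquad \beta_j^\pm=\frac{(\lambda^2-(p^\pm)^2)(e^{-\lambda L}-e^{\lambda L})}{D},$$ except that, because of the outer Dirichlet conditions, $$\beta_2^-=-\frac{(\lambda+p^-)e^{-\lambda L}+(\lambda-p^-)e^{\lambda L}}{(\lambda+p^+)e^{\lambda(L+\delta)}+(\lambda-p^+)e^{-\lambda(L+\delta)}},\qquad \beta_{J-1}^+=-\frac{(\lambda+p^+)e^{-\lambda L}+(\lambda-p^+)e^{\lambda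 L}}{(\lambda+p^-)e^{\lambda(L+\delta)}+(\lambda-p^-)e^{-\lambda(L+\delta)}}.$$ Let $T(\tilde k,p^+,p^-)$ be the matrix of this iteration and let $$\rho_\delta(p^+,p^-)=\max_{\tilde k\in[\pi/\hat L,\,M_\delta\pi/\hat L]}\rho\bigl(T(\tilde k,p^+,p^-)\bigr)$$ be the convergence factor, where $\rho(T)$ is the spectral radius and $M_\delta\ge c/\delta$ for some $c>0$ and all small $\delta$ (for instance $M_\delta\sim 1/h$ with mesh size $h$ proportional to $\delta$). Put $s=\lambda(\pi/\hat L)=\sqrt{(\pi/\hat L)^2+\eta-i\varepsilon}$, $\Re s>0$, and $$K_J=\Re\,\frac{s\,(e^{2sL}+1-2\cos(\pi/J)e^{sL})}{e^{2sL}-1}\quad\text{if }\ \Re\frac{s}{\sinh(sL)}\ge 0,$$ while, if $\Re\frac{s}{\sinh(sL)}<0$, the sign in front of $2\cos(\pi/J)$ in $K_J$ is changed to $+$. **Theorem.** $K_J>0$, and the following holds as $\delta\to0^+$. 1. (One-sided Robin conditions, $p^+=p^-=p$.) For all sufficiently small $\delta$ there is a minimizer $p^*=p^*_\delta$ of $p\mapsto\rho_\delta(p,p)$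 over $p>0$, and every choice of minimizers satisfies $$p^*\sim\Bigl(\frac{K_J^2}{2}\Bigr)^{1/3}\delta^{-1/3},\qquad 1-\rho_\delta(p^*,p^*)\sim 2^{4/3}K_J^{1/3}\delta^{1/3}.$$ 2. (Two-sided Robin conditions.) For every $\delta>0$ and all $p^\pm>0$ one has $\rho_\delta(p^-,p^+)=\rho_\delta(p^+,p^-)$, so the roles of $p^+$ and $p^-$ can be switched. For all sufficiently small $\delta$ there is a minimizer $(p_+^*,p_-^*)$ of $\rho_\delta$ over $(0,\infty)^2$ with $p_+^*>p_-^*$, and every choice of minimizers over $(0,\infty)^2$ satisfies, up to the order of the pair (that is, with $p_+^*$ denoting the larger and $p_-^*$ the smaller component), $$p_+^*\sim\Bigl(\frac{K_J}{2}\Bigr)^{2/5}\delta^{-3/5},\qquad p_-^*\sim\Bigl(\frac{K_J}{2}\Bigr)^{4/5}\delta^{-1/5},\qquad 1-\rho_\delta(p_+^*,p_-^*)\sim 2^{4/5}K_J^{1/5}\delta^{1/5}.$$ -/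

import Mathlib

open Filter Topology Asymptotics
open scoped ENNReal

namespace StripOSM

/-- The symbol `λ(k) = √(k² + η - iε)`; `Complex.sqrt` is the principal branch, hence the root with
positive real part (see `sq_symbol` and `re_symbol_pos`). -/
noncomputable def symbol (η ε k : ℝ) : ℂ :=
  Complex.sqrt ((k : ℂ) ^ 2 + (η : ℂ) - Complex.I * (ε : ℂ))

theorem sq_symbol (η ε k : ℝ) :
    symbol η ε k ^ 2 = (k : ℂ) ^ 2 + (η : ℂ) - Complex.I * (ε : ℂ) := by
  unfold symbol Complex.sqrt
  exact Complex.cpow_nat_inv_pow _ two_ne_zero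

theorem re_symbol_pos {η k : ℝ} (ε : ℝ) (hη : 0 ≤ η) (hk : 0 < k) : 0 < (symbol η ε k).re := by
  have hre : ((k : ℂ) ^ 2 + (η : ℂ) - Complex.I * (ε : ℂ)).re = k ^ 2 + η := by
    simp [pow_two]
  unfold symbol Complex.sqrt
  rw [Complex.cpow_inv_two_re, hre]
  apply Real.sqrt_pos.2
  have := norm_nonneg ((k : ℂ) ^ 2 + (η : ℂ) - Complex.I * (ε : ℂ))
  positivity

/-! ### The substructured iteration

Subdomains are numbered `j = 1, …, J`; `pp j` and `pm j` are the Robin parameters `p_j⁺` (used at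
the right end `b_j = jL + δ/2`) and `p_j⁻` (used at the left end `a_j = (j-1)L - δ/2`) of
subdomain `j`, `l` stands for `λ(k)`, `L` is the subdomain width and `δ` the overlap. -/

/-- `D_j`, for a subdomain with Robin parameters `p` (right) and `m` (left). -/
noncomputable def denom (L δ : ℝ) (l : ℂ) (p m : ℝ) : ℂ :=
  (l + p) * (l + m) * Complex.exp (l * (L + δ)) - (l - p) * (l - m) * Complex.exp (-l * (L + δ))

/-- `α_j⁻`, `2 ≤ j ≤ J`. -/
noncomputable def alphaMinus (L δ : ℝ) (l : ℂ) (pp pm : ℕ → ℝ) (j : ℕ) : ℂ :=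
  ((l + pp (j - 1)) * (l + pm j) * Complex.exp (l * δ)
    - (l - pp (j - 1)) * (l - pm j) * Complex.exp (-l * δ)) / denom L δ l (pp (j - 1)) (pm (j - 1))

/-- `α_j⁺`, `1 ≤ j ≤ J - 1`. -/
noncomputable def alphaPlus (L δ : ℝ) (l : ℂ) (pp pm : ℕ → ℝ) (j : ℕ) : ℂ :=
  ((l + pm (j + 1)) * (l + pp j) * Complex.exp (l * δ)
    - (l - pm (j + 1)) * (l - pp j) * Complex.exp (-l * δ)) / denom L δ l (pp (j + 1)) (pm (j + 1))

/-- `β_j⁻`, `2 ≤ j ≤ J`. -/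
noncomputable def betaMinus (L δ : ℝ) (l : ℂ) (pp pm : ℕ → ℝ) (j : ℕ) : ℂ :=
  ((l + pm j) * (l - pm (j - 1)) * Complex.exp (-l * L)
    - (l - pm j) * (l + pm (j - 1)) * Complex.exp (l * L)) / denom L δ l (pp (j - 1)) (pm (j - 1))

/-- `β_j⁺`, `1 ≤ j ≤ J - 1`. -/
noncomputable def betaPlus (L δ : ℝ) (l : ℂ) (pp pm : ℕ → ℝ) (j : ℕ) : ℂ :=
  ((l + pp j) * (l - pp (j + 1)) * Complex.exp (-l * L)
    - (l - pp j) * (l + pp (j + 1)) * Complex.exp (l * L)) / denom L δ l (pp (j + 1)) (pm (j + 1))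

/-- The iteration matrix `T` with Robin conditions also at the outer boundaries (the zero first and
last rows and columns are removed). Interfaces are numbered `i = 0, …, J - 2`, interface `i` lying
between the subdomains `i + 1` and `i + 2`. The index `inl i` stands for the trace `R₊(b_{i+1})`,
the index `inr i` for `R₋(a_{i+2})`, so that the iteration reads
`R₊(b_j) ← β_j⁺ R₋(a_{j+1}) + α_j⁺ R₊(b_{j+1})` and
`R₋(a_j) ← α_j⁻ R₋(a_{j-1}) + β_j⁻ R₊(b_{j-1})`. -/
noncomputable def robinMatrix (J : ℕ) (L δ : ℝ) (l : ℂ) (pp pm : ℕ → ℝ) :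
    Matrix (Fin (J - 1) ⊕ Fin (J - 1)) (Fin (J - 1) ⊕ Fin (J - 1)) ℂ :=
  Matrix.fromBlocks
    (Matrix.of fun i k => if (k : ℕ) = i + 1 then alphaPlus L δ l pp pm (i + 1) else 0)
    (Matrix.of fun i k => if k = i then betaPlus L δ l pp pm (i + 1) else 0)
    (Matrix.of fun i k => if k = i then betaMinus L δ l pp pm (i + 2) else 0)
    (Matrix.of fun i k => if (k : ℕ) + 1 = i then alphaMinus L δ l pp pm (i + 2) else 0)

/-- `β_2⁻` when the left neighbour, subdomain `1`, has a Dirichlet condition at its left end. -/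
noncomputable def betaMinusDirichlet (L δ : ℝ) (l : ℂ) (pp pm : ℕ → ℝ) (j : ℕ) : ℂ :=
  -((l + pm j) * Complex.exp (-l * L) + (l - pm j) * Complex.exp (l * L)) /
    ((l + pp (j - 1)) * Complex.exp (l * (L + δ)) + (l - pp (j - 1)) * Complex.exp (-l * (L + δ)))

/-- `β_{J-1}⁺` when the right neighbour, subdomain `J`, has a Dirichlet condition at its right
end. -/
noncomputable def betaPlusDirichlet (L δ : ℝ) (l : ℂ) (pp pm : ℕ → ℝ) (j : ℕ) : ℂ :=
  -((l + pp j) * Complex.exp (-l * L) + (l - pp j) * Complex.exp (l * L)) /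
    ((l + pm (j + 1)) * Complex.exp (l * (L + δ)) + (l - pm (j + 1)) * Complex.exp (-l * (L + δ)))

/-- The iteration matrix `T` with Dirichlet conditions at the two outer boundaries: the limit of
`robinMatrix` as the outer parameters `p_1⁻` and `p_J⁺` tend to infinity, see
`tendsto_robinMatrix`. -/
noncomputable def iterationMatrix (J : ℕ) (L δ : ℝ) (l : ℂ) (pp pm : ℕ → ℝ) :
    Matrix (Fin (J - 1) ⊕ Fin (J - 1)) (Fin (J - 1) ⊕ Fin (J - 1)) ℂ :=
  Matrix.fromBlocks
    (Matrix.of fun i k => if (k : ℕ) = i + 1 then alphaPlus L δ l pp pm (i + 1) else 0)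
    (Matrix.of fun i k => if k = i then
      (if (i : ℕ) + 2 = J then betaPlusDirichlet L δ l pp pm (i + 1)
        else betaPlus L δ l pp pm (i + 1)) else 0)
    (Matrix.of fun i k => if k = i then
      (if (i : ℕ) = 0 then betaMinusDirichlet L δ l pp pm (i + 2)
        else betaMinus L δ l pp pm (i + 2)) else 0)
    (Matrix.of fun i k => if (k : ℕ) + 1 = i then alphaMinus L δ l pp pm (i + 2) else 0)

theorem dirichlet_denom_ne_zero {l : ℂ} (hl : 0 < l.re) {p X : ℝ} (hp : 0 < p) (hX : 0 < X) :
    (l + p) * Complex.exp (l * X) + (l - p) * Complex.exp (-l * X) ≠ 0 := by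
  intro h
  have h1 : (l + p) * Complex.exp (l * X) = -((l - p) * Complex.exp (-l * X)) :=
    eq_neg_of_add_eq_zero_left h
  have h2 := congrArg norm h1
  rw [norm_neg, norm_mul, norm_mul, Complex.norm_exp, Complex.norm_exp] at h2
  have h3 : ‖l - p‖ < ‖l + p‖ := by
    rw [← sq_lt_sq₀ (norm_nonneg _) (norm_nonneg _), ← Complex.normSq_eq_norm_sq,
      ← Complex.normSq_eq_norm_sq, Complex.normSq_apply, Complex.normSq_apply]
    simp only [Complex.sub_re, Complex.add_re, Complex.sub_im, Complex.add_im, Complex.ofReal_re,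
      Complex.ofReal_im]
    nlinarith [mul_pos hl hp]
  have h4 : Real.exp (-l * X).re ≤ Real.exp (l * X).re := by
    apply Real.exp_le_exp.2
    simp only [Complex.mul_re, Complex.neg_re, Complex.neg_im, Complex.ofReal_re,
      Complex.ofReal_im]
    nlinarith [mul_pos hl hX]
  have h5 := Real.exp_pos (l * X).re
  nlinarith [norm_nonneg (l - p)]

/-- A quotient of two affine functions of a real variable tends to the quotient of the slopes. -/
theorem tendsto_affine_div (a b c d : ℂ) (hd : d ≠ 0) :
    Tendsto (fun x : ℝ => (a + b * (x : ℂ)) / (c + d * (x : ℂ))) atTop (𝓝 (b / d)) := by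
  have hinv : Tendsto (fun x : ℝ => ((x⁻¹ : ℝ) : ℂ)) atTop (𝓝 0) := by
    have := (Complex.continuous_ofReal.tendsto (0 : ℝ)).comp tendsto_inv_atTop_zero
    rw [Complex.ofReal_zero] at this
    exact this
  have h : Tendsto (fun x : ℝ => (a * ((x⁻¹ : ℝ) : ℂ) + b) / (c * ((x⁻¹ : ℝ) : ℂ) + d)) atTop
      (𝓝 ((a * 0 + b) / (c * 0 + d))) :=
    ((hinv.const_mul a).add_const b).div ((hinv.const_mul c).add_const d) (by simpa using hd)
  have h' : (a * 0 + b) / (c * 0 + d) = b / d := by simp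
  rw [h'] at h
  refine h.congr' ?_
  filter_upwards [eventually_gt_atTop 0] with x hx
  have hx' : (x : ℂ) ≠ 0 := by exact_mod_cast hx.ne'
  have e1 : a * ((x⁻¹ : ℝ) : ℂ) + b = (a + b * x) * (x : ℂ)⁻¹ := by
    push_cast; field_simp
  have e2 : c * ((x⁻¹ : ℝ) : ℂ) + d = (c + d * x) * (x : ℂ)⁻¹ := by
    push_cast; field_simp
  rw [e1, e2, mul_div_mul_right _ _ (inv_ne_zero hx')]

/-- Dirichlet outer boundary conditions are the limit `p_a, p_b → ∞` of Robin conditions. -/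
theorem tendsto_robinMatrix {J : ℕ} {L δ : ℝ} {l : ℂ} {pp pm : ℕ → ℝ} (hJ : 2 ≤ J)
    (hL : 0 < L) (hδ : 0 < δ) (hl : 0 < l.re) (hpp : ∀ j, 0 < pp j) (hpm : ∀ j, 0 < pm j) :
    Tendsto (fun q : ℝ × ℝ =>
        robinMatrix J L δ l (Function.update pp J q.2) (Function.update pm 1 q.1))
      (atTop ×ˢ atTop) (𝓝 (iterationMatrix J L δ l pp pm)) := by
  have hne : ∀ p : ℝ, 0 < p → (l + p) * Complex.exp (l * (L + δ))
      + (l - p) * Complex.exp (-l * (L + δ)) ≠ 0 := fun p hp => by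
    have := dirichlet_denom_ne_zero hl hp (add_pos hL hδ)
    push_cast at this
    exact this
  refine tendsto_pi_nhds.2 fun r => tendsto_pi_nhds.2 fun c => ?_
  rcases r with i | i <;> rcases c with k | k <;>
    simp only [robinMatrix, iterationMatrix, Matrix.fromBlocks_apply₁₁, Matrix.fromBlocks_apply₁₂,
      Matrix.fromBlocks_apply₂₁, Matrix.fromBlocks_apply₂₂, Matrix.of_apply]
  · split_ifs with h
    · have hk := k.2
      have e1 : (i : ℕ) + 1 + 1 ≠ J := by omega
      have e2 : (i : ℕ) + 1 ≠ J := by omega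
      simp only [alphaPlus, ne_eq, e1, e2, not_false_eq_true, Function.update_of_ne,
        show (i : ℕ) + 1 + 1 ≠ 1 by omega]
      exact tendsto_const_nhds
    · exact tendsto_const_nhds
  · have hi := i.2
    split_ifs with h hJ'
    · have e2 : (i : ℕ) + 1 ≠ J := by omega
      simp only [betaPlus, betaPlusDirichlet, denom, ne_eq, e2, not_false_eq_true,
        Function.update_of_ne, show (i : ℕ) + 1 + 1 = J from hJ', Function.update_self,
        show J ≠ 1 by omega]
      have := (tendsto_affine_div
        ((l + pp (i + 1)) * l * Complex.exp (-l * L) - (l - pp (i + 1)) * l * Complex.exp (l * L))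
        (-((l + pp (i + 1)) * Complex.exp (-l * L) + (l - pp (i + 1)) * Complex.exp (l * L)))
        (l * (l + pm J) * Complex.exp (l * (L + δ)) - l * (l - pm J) * Complex.exp (-l * (L + δ)))
        ((l + pm J) * Complex.exp (l * (L + δ)) + (l - pm J) * Complex.exp (-l * (L + δ)))
        (hne _ (hpm J))).comp (tendsto_snd (f := (atTop : Filter ℝ)) (g := (atTop : Filter ℝ)))
      refine this.congr fun q => ?_
      simp only [Function.comp_apply]
      congr 1 <;> ring
    · have e1 : (i : ℕ) + 1 + 1 ≠ J := hJ'
      have e2 : (i : ℕ) + 1 ≠ J := by omega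
      simp only [betaPlus, ne_eq, e1, e2, not_false_eq_true, Function.update_of_ne,
        show (i : ℕ) + 1 + 1 ≠ 1 by omega]
      exact tendsto_const_nhds
    · exact tendsto_const_nhds
  · have hi := i.2
    split_ifs with h h0
    · have e2 : (1 : ℕ) ≠ J := by omega
      simp only [betaMinus, betaMinusDirichlet, denom, ne_eq, e2, not_false_eq_true,
        Function.update_of_ne, h0, Function.update_self, Nat.zero_add, Nat.reduceSub,
        show (2 : ℕ) ≠ 1 by omega]
      have := (tendsto_affine_div
        ((l + pm 2) * l * Complex.exp (-l * L) - (l - pm 2) * l * Complex.exp (l * L))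
        (-((l + pm 2) * Complex.exp (-l * L) + (l - pm 2) * Complex.exp (l * L)))
        (l * (l + pp 1) * Complex.exp (l * (L + δ)) - l * (l - pp 1) * Complex.exp (-l * (L + δ)))
        ((l + pp 1) * Complex.exp (l * (L + δ)) + (l - pp 1) * Complex.exp (-l * (L + δ)))
        (hne _ (hpp 1))).comp (tendsto_fst (f := (atTop : Filter ℝ)) (g := (atTop : Filter ℝ)))
      refine this.congr fun q => ?_
      simp only [Function.comp_apply]
      congr 1 <;> ring
    · have e1 : (i : ℕ) + 2 - 1 ≠ J := by omega
      have e2 : (i : ℕ) + 2 - 1 ≠ 1 := by omega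
      simp only [betaMinus, denom, ne_eq, e1, e2, not_false_eq_true, Function.update_of_ne,
        show (i : ℕ) + 2 ≠ 1 by omega]
      exact tendsto_const_nhds
    · exact tendsto_const_nhds
  · split_ifs with h
    · have hk := k.2
      have hi := i.2
      have e1 : (i : ℕ) + 2 - 1 ≠ J := by omega
      have e2 : (i : ℕ) + 2 - 1 ≠ 1 := by omega
      simp only [alphaMinus, denom, ne_eq, e1, e2, not_false_eq_true, Function.update_of_ne,
        show (i : ℕ) + 2 ≠ 1 by omega]
      exact tendsto_const_nhds
    · exact tendsto_const_nhds

/-- The convergence factor `max_{k ∈ [kmin, kmax]} ρ(T(k, p⁺, p⁻))` for `J` subdomains with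
Dirichlet outer boundary conditions and the parameters `p_j⁺ = pPlus`, `p_j⁻ = pMinus` at all
interfaces. -/
noncomputable def convergenceFactor (J : ℕ) (L δ η ε kmin kmax pPlus pMinus : ℝ) : ℝ≥0∞ :=
  ⨆ k ∈ Set.Icc kmin kmax,
    spectralRadius ℂ (iterationMatrix J L δ (symbol η ε k) (fun _ => pPlus) (fun _ => pMinus))

/-- `Re [s (e^{2sL} + 1 - 2 c e^{sL}) / (e^{2sL} - 1)]`; for `c = cos(π/J)` this is `K_J`. -/
noncomputable def lowFreqConst (s : ℂ) (L c : ℝ) : ℝ :=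
  (s * (Complex.exp (2 * s * L) + 1 - 2 * c * Complex.exp (s * L)) /
    (Complex.exp (2 * s * L) - 1)).re

end StripOSM

/-! ### Schur's test for symmetric nonnegative matrices. -/

namespace StripOSM

/-! Write `u, v` for the two reflection coefficients, `d = e^{-λδ}`, `E = e^{-λL}`, `g = u v d²`.
After a diagonal similarity the iteration matrix is `α V + D S`, where `V` shifts traces between
neighbouring interfaces, `S` swaps the two traces at an interface and `D` is diagonal. For large
parameters and small overlap `g` is close to 1, `α` is of order `E (1 - g)` and `D` is close to the
identity. Squaring gives `T² = γ + α A + remainder`, with `A = V S + S V` real symmetric and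
nonnegative, `γ` the product of two interior coefficients, and a remainder of second order
(`exists_norm_normalMatrix_sq_sub_le`). The Dirichlet entries differ from the interior ones only at
second order, so they do not enter the leading term. The sine vector is a positive eigenvector of
`A`, so by Schur's test its numerical range lies in `[-2 cos(π/J), 2 cos(π/J)]`, and both endpoints
are eigenvalues.

Put `S = 1/p⁺ + 1/p⁻ + δ`. At bounded frequencies `1 - g = 2λS + O(S²)`, so each eigenvalue
satisfies `|μ|² = 1 - 2 S Re[λ (1 + E² - tE)/(1 - E²)] + o(S)` with `t` in that interval. The real
part is `lowFreqConst λ L (t/2)`. It is affine in `t` and increasing in the frequency, so the worst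
case is the lowest frequency with an extreme `t`, and the rate there is `K S`
(`exists_lowFreq_upper`, `exists_lowFreq_lower`). Monotonicity follows from the derivatives of `z
tanh(z/2)` and `z coth(z/2)` in the sector `|Im z| ≤ Re z`.

At high frequencies `E` is exponentially small and `|μ|²` is essentially `|g|`
(`exists_highFreq_bounds`). With `x = Re λ`, the rate is about `p⁺x/(p⁺+x)² + p⁻x/(p⁻+x)² + xδ`, up
to relatively small errors.

It remains to maximize the smaller of the two rates. In the one-sided case `2K/p` is balanced
against `min_x (2p/x + xδ)`. With `δ = t³` and `K = 4q³` this gives `p = 2q²/t` and rate `4qt`. In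
the two-sided case `K/p⁻`, `min_x (p⁻/x + x/p⁺)` and `min_x (p⁺/x + xδ)` are balanced. With `δ = t⁵`
and `K = 2q⁵` this gives `p⁺ = q²/t³`, `p⁻ = q⁴/t` and rate `2qt`. These model parameters attain the
rates. Conversely, parameters at least as good as the model ones must pass the test at the lowest
frequency and at the minimizing `x`, which forces the same asymptotics (`oneSided_tendsto`,
`twoSided_tendsto`). Hence competitive parameters lie in a compact box, where the lower
semicontinuous convergence factor attains its minimum. -/

/-- Schur's test for a symmetric nonnegative matrix with a positive eigenvector. -/
theorem sum_mul_mul_le_of_eigenvector {n : Type*} [Fintype n] {B : n → n → ℝ}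
    (hB : ∀ i j, 0 ≤ B i j)
    (hsymm : ∀ i j, B i j = B j i) {w : n → ℝ} (hw : ∀ i, 0 < w i) {r : ℝ}
    (hBw : ∀ i, ∑ j, B i j * w j = r * w i) (a : n → ℝ) :
    ∑ i, ∑ j, B i j * (a i * a j) ≤ r * ∑ i, a i ^ 2 := by
  have h1 : ∀ i j, B i j * (a i * a j) ≤
      (B i j * w j) * (a i ^ 2 / w i) / 2 + (B j i * w i) * (a j ^ 2 / w j) / 2 := by
    intro i j
    rw [hsymm j i]
    have hi := hw i
    have hj := hw j
    -- The arithmetic-geometric inequality is weighted by `w`, so that summing over `j` produces the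
    -- row sums `∑ B i j w j` of the eigenvector equation.
    have key : a i * a j ≤ (w j * (a i ^ 2 / w i) + w i * (a j ^ 2 / w j)) / 2 := by
      have e : (w j * (a i ^ 2 / w i) + w i * (a j ^ 2 / w j)) / 2 - a i * a j
          = (w j * a i - w i * a j) ^ 2 / (2 * w i * w j) := by
        field_simp
        ring
      have : 0 ≤ (w j * a i - w i * a j) ^ 2 / (2 * w i * w j) := by positivity
      linarith
    calc _ ≤ B i j * ((w j * (a i ^ 2 / w i) + w i * (a j ^ 2 / w j)) / 2) :=
          mul_le_mul_of_nonneg_left key (hB i j)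
      _ = _ := by ring
  have h2 : ∑ i, ∑ j, (B i j * w j) * (a i ^ 2 / w i) / 2 = r * (∑ i, a i ^ 2) / 2 := by
    rw [Finset.mul_sum, Finset.sum_div]
    refine Finset.sum_congr rfl fun i _ => ?_
    rw [← Finset.sum_div, ← Finset.sum_mul, hBw i]
    have := (hw i).ne'
    field_simp
  calc _ ≤ ∑ i, ∑ j, ((B i j * w j) * (a i ^ 2 / w i) / 2 + (B j i * w i) * (a j ^ 2 / w j) / 2) :=
        Finset.sum_le_sum fun i _ => Finset.sum_le_sum fun j _ => h1 i j
    _ = _ := by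
      simp only [Finset.sum_add_distrib]
      rw [h2, Finset.sum_comm, h2]
      ring

/-- The form is real because the matrix is Hermitian. Its modulus is at most the real form evaluated
at the moduli of `v`, to which Schur's test applies. -/
theorem exists_quadraticForm_eq {n : Type*} [Fintype n] {B : n → n → ℝ}
    (hB : ∀ i j, 0 ≤ B i j)
    (hsymm : ∀ i j, B i j = B j i) {w : n → ℝ} (hw : ∀ i, 0 < w i) {r : ℝ}
    (hBw : ∀ i, ∑ j, B i j * w j = r * w i) (v : n → ℂ) :
    ∃ t : ℝ, |t| ≤ r * ∑ i, ‖v i‖ ^ 2 ∧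
      star v ⬝ᵥ (Matrix.of fun i j => (B i j : ℂ)).mulVec v = t := by
  have e1 : star v ⬝ᵥ (Matrix.of fun i j => (B i j : ℂ)).mulVec v =
      ∑ i, ∑ j, (B i j : ℂ) * (star (v i) * v j) := by
    simp only [dotProduct, Matrix.mulVec, Matrix.of_apply, Pi.star_apply, Finset.mul_sum]
    exact Finset.sum_congr rfl fun i _ => Finset.sum_congr rfl fun j _ => by ring
  have hreal : star (∑ i, ∑ j, (B i j : ℂ) * (star (v i) * v j)) =
      ∑ i, ∑ j, (B i j : ℂ) * (star (v i) * v j) := by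
    rw [star_sum, Finset.sum_comm]
    simp only [star_sum, star_mul', star_star]
    rw [Finset.sum_comm]
    conv_lhs => rw [Finset.sum_comm]
    refine Finset.sum_congr rfl fun i _ => Finset.sum_congr rfl fun j _ => ?_
    rw [hsymm j i, Complex.star_def, Complex.conj_ofReal]
    ring
  obtain ⟨t, ht⟩ := Complex.conj_eq_iff_real.1 hreal
  refine ⟨t, ?_, by rw [e1, ht]⟩
  have h1 : |t| = ‖∑ i, ∑ j, (B i j : ℂ) * (star (v i) * v j)‖ := by
    rw [ht, Complex.norm_real, Real.norm_eq_abs]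
  rw [h1]
  refine le_trans ?_ (sum_mul_mul_le_of_eigenvector hB hsymm hw hBw fun i => ‖v i‖)
  refine (norm_sum_le _ _).trans (Finset.sum_le_sum fun i _ =>
    (norm_sum_le _ _).trans (Finset.sum_le_sum fun j _ => ?_))
  rw [norm_mul, norm_mul, norm_star, Complex.norm_real, Real.norm_of_nonneg (hB i j)]

/-! ### Eigenvalues of complex matrices: perturbation, traces, quadratic forms. -/

section Spectral

open scoped Matrix.Norms.L2Operator

variable {n : Type*} [Fintype n] [DecidableEq n]

/-- The determinant is the product of `t - τ` over all eigenvalues with multiplicity, so it is at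
least the smallest factor to the power of the dimension. -/
theorem exists_spectrum_sub_pow_le (M : Matrix n n ℂ) (t : ℂ) [Nonempty n] :
    ∃ τ ∈ spectrum ℂ M, ‖t - τ‖ ^ Fintype.card n ≤ ‖(Matrix.scalar n t - M).det‖ := by
  by_contra! hcon
  have hs := IsAlgClosed.splits M.charpoly
  have h1 := hs.eval_eq_prod_roots t
  rw [Matrix.eval_charpoly, (Matrix.charpoly_monic M).leadingCoeff, one_mul] at h1
  have hcard : Multiset.card M.charpoly.roots = Fintype.card n := by
    rw [Polynomial.splits_iff_card_roots.1 hs, Matrix.charpoly_natDegree_eq_dim]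
  obtain ⟨τ₀, hτ₀⟩ := spectrum.nonempty_of_isAlgClosed_of_finiteDimensional ℂ M
  have hne : (M.charpoly.roots.map fun x => ‖t - x‖).toFinset.Nonempty := by
    refine ⟨‖t - τ₀‖, ?_⟩
    rw [Multiset.mem_toFinset, Multiset.mem_map]
    exact ⟨τ₀, (Polynomial.mem_roots (Matrix.charpoly_monic M).ne_zero).2
      (Matrix.mem_spectrum_iff_isRoot_charpoly.1 hτ₀), rfl⟩
  obtain ⟨r, hr, hmin⟩ := Finset.exists_min_image _ id hne
  rw [Multiset.mem_toFinset, Multiset.mem_map] at hr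
  obtain ⟨τ, hτ, rfl⟩ := hr
  have hτs : τ ∈ spectrum ℂ M := Matrix.mem_spectrum_iff_isRoot_charpoly.2
    ((Polynomial.mem_roots (Matrix.charpoly_monic M).ne_zero).1 hτ)
  refine (hcon τ hτs).not_ge ?_
  have h2 : ‖(M.charpoly.roots.map fun x => t - x).prod‖ =
      (M.charpoly.roots.map fun x => ‖t - x‖).prod := by
    have := map_multiset_prod (normHom : ℂ →*₀ ℝ) (M.charpoly.roots.map fun x => t - x)
    rw [Multiset.map_map] at this
    exact this
  rw [h1, h2, ← hcard, ← Multiset.prod_replicate, ← Multiset.map_const']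
  refine Multiset.prod_map_le_prod_map₀ _ _ (fun _ _ => norm_nonneg _) fun x hx => ?_
  refine hmin ‖t - x‖ ?_
  rw [Multiset.mem_toFinset, Multiset.mem_map]
  exact ⟨x, hx, rfl⟩

/-- Eigenvalues depend continuously on the matrix. -/
theorem eventually_exists_spectrum_near [Nonempty n] {A : Matrix n n ℂ} {t : ℂ}
    (ht : t ∈ spectrum ℂ A) {e : ℝ} (he : 0 < e) :
    ∀ᶠ M in 𝓝 A, ∃ τ ∈ spectrum ℂ M, ‖t - τ‖ < e := by
  have hc : Continuous fun M : Matrix n n ℂ => ‖(Matrix.scalar n t - M).det‖ :=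
    (Continuous.matrix_det (continuous_const.sub continuous_id)).norm
  have h0 : ‖(Matrix.scalar n t - A).det‖ = 0 := by
    rw [← Matrix.eval_charpoly, norm_eq_zero]
    exact Matrix.mem_spectrum_iff_isRoot_charpoly.1 ht
  have h := hc.tendsto A
  rw [h0] at h
  filter_upwards [h.eventually_lt_const (pow_pos he (Fintype.card n))] with M hM
  obtain ⟨τ, hτ, hle⟩ := exists_spectrum_sub_pow_le M t
  exact ⟨τ, hτ, lt_of_pow_lt_pow_left₀ _ he.le (hle.trans_lt hM)⟩

theorem ofReal_norm_le_spectralRadius {M : Matrix n n ℂ} {μ : ℂ} (hμ : μ ∈ spectrum ℂ M) :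
    ENNReal.ofReal ‖μ‖ ≤ spectralRadius ℂ M := by
  rw [ofReal_norm]
  exact le_iSup₂ (f := fun (k : ℂ) (_ : k ∈ spectrum ℂ M) => (‖k‖₊ : ℝ≥0∞)) μ hμ

theorem spectralRadius_le_ofReal {M : Matrix n n ℂ} {r : ℝ}
    (h : ∀ μ ∈ spectrum ℂ M, ‖μ‖ ≤ r) : spectralRadius ℂ M ≤ ENNReal.ofReal r :=
  iSup₂_le fun μ hμ => by
    have := ENNReal.ofReal_le_ofReal (h μ hμ)
    rwa [ofReal_norm] at this

/-- An eigenvalue of modulus above `r` keeps a close neighbour in the spectrum of every nearby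
matrix. This half of continuity survives the supremum over frequencies and suffices for minimizers
to exist. -/
theorem lowerSemicontinuous_spectralRadius [Nonempty n] :
    LowerSemicontinuous fun M : Matrix n n ℂ => spectralRadius ℂ M := by
  intro A r hr
  obtain ⟨t, ht, hrt⟩ : ∃ t ∈ spectrum ℂ A, r < (‖t‖₊ : ℝ≥0∞) := by
    have hr' : r < ⨆ k ∈ spectrum ℂ A, (‖k‖₊ : ℝ≥0∞) := hr
    simpa only [lt_iSup_iff, exists_prop] using hr'
  lift r to NNReal using hrt.ne_top
  have hrt' : (r : ℝ) < ‖t‖ := by exact_mod_cast hrt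
  filter_upwards [eventually_exists_spectrum_near ht (sub_pos.2 hrt')] with M hM
  obtain ⟨τ, hτ, hlt⟩ := hM
  refine lt_of_lt_of_le ?_ (ofReal_norm_le_spectralRadius hτ)
  rw [← ENNReal.ofReal_coe_nnreal, ENNReal.ofReal_lt_ofReal_iff_of_nonneg r.coe_nonneg]
  have := norm_sub_norm_le t τ
  linarith

theorem exists_sq_mem_spectrum {M : Matrix n n ℂ} {τ : ℂ} (hτ : τ ∈ spectrum ℂ (M ^ 2)) :
    ∃ μ ∈ spectrum ℂ M, μ ^ 2 = τ := by
  rw [spectrum.map_pow_of_pos M two_pos] at hτ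
  exact hτ

/-- The trace of `M²` is the sum of the squared eigenvalues. This bounds the spectral radius from
below without locating any single eigenvalue. -/
theorem norm_trace_sq_le {M : Matrix n n ℂ} {r : ℝ} (h : ∀ μ ∈ spectrum ℂ M, ‖μ‖ ≤ r) :
    ‖(M ^ 2).trace‖ ≤ Fintype.card n * r ^ 2 := by
  rw [Matrix.trace_eq_sum_roots_charpoly]
  have hcard : Multiset.card (M ^ 2).charpoly.roots = Fintype.card n := by
    rw [Polynomial.splits_iff_card_roots.1 (IsAlgClosed.splits _),
      Matrix.charpoly_natDegree_eq_dim]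
  refine (norm_multiset_sum_le _).trans ?_
  have := Multiset.sum_le_card_nsmul ((M ^ 2).charpoly.roots.map fun x => ‖x‖) (r ^ 2) ?_
  · rw [Multiset.card_map, hcard, nsmul_eq_mul] at this
    exact this
  · intro x hx
    obtain ⟨τ, hτ, rfl⟩ := Multiset.mem_map.1 hx
    obtain ⟨μ, hμ, rfl⟩ := exists_sq_mem_spectrum (Matrix.mem_spectrum_iff_isRoot_charpoly.2
      ((Polynomial.mem_roots (Matrix.charpoly_monic _).ne_zero).1 hτ))
    rw [norm_pow]
    exact pow_le_pow_left₀ (norm_nonneg _) (h μ hμ) 2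

theorem exists_eigenvector {M : Matrix n n ℂ} {μ : ℂ} (hμ : μ ∈ spectrum ℂ M) :
    ∃ v : n → ℂ, v ≠ 0 ∧ M.mulVec v = μ • v := by
  rw [← Matrix.spectrum_toLin', ← Module.End.hasEigenvalue_iff_mem_spectrum] at hμ
  obtain ⟨v, hv⟩ := hμ.exists_hasEigenvector
  exact ⟨v, hv.2, by simpa using hv.apply_eq_smul⟩

theorem mem_spectrum_of_mulVec {M : Matrix n n ℂ} {μ : ℂ} {v : n → ℂ} (hv : v ≠ 0)
    (h : M.mulVec v = μ • v) : μ ∈ spectrum ℂ M := by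
  rw [← Matrix.spectrum_toLin', ← Module.End.hasEigenvalue_iff_mem_spectrum]
  exact Module.End.hasEigenvalue_of_hasEigenvector
    ⟨Module.End.mem_eigenspace_iff.2 (by simpa using h), hv⟩

theorem norm_quadraticForm_le (M : Matrix n n ℂ) (v : n → ℂ) :
    ‖star v ⬝ᵥ M.mulVec v‖ ≤ ‖M‖ * ∑ i, ‖v i‖ ^ 2 := by
  have h1 := Matrix.l2_opNorm_mulVec M (WithLp.toLp 2 v)
  have h2 := norm_inner_le_norm (𝕜 := ℂ) (WithLp.toLp 2 v : EuclideanSpace ℂ n)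
    (WithLp.toLp 2 (M.mulVec v))
  rw [EuclideanSpace.inner_eq_star_dotProduct, dotProduct_comm] at h2
  have h3 := EuclideanSpace.norm_sq_eq (WithLp.toLp 2 v : EuclideanSpace ℂ n)
  refine h2.trans ?_
  have h4 : ‖(WithLp.toLp 2 (M.mulVec v) : EuclideanSpace ℂ n)‖ ≤
    ‖M‖ * ‖(WithLp.toLp 2 v : EuclideanSpace ℂ n)‖ := h1
  calc _ ≤ ‖(WithLp.toLp 2 v : EuclideanSpace ℂ n)‖ *
        (‖M‖ * ‖(WithLp.toLp 2 v : EuclideanSpace ℂ n)‖) := by gcongr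
    _ = ‖M‖ * ‖(WithLp.toLp 2 v : EuclideanSpace ℂ n)‖ ^ 2 := by ring
    _ = _ := by rw [h3]

theorem norm_entry_le (M : Matrix n n ℂ) (i j : n) : ‖M i j‖ ≤ ‖M‖ := by
  have h1 := Matrix.l2_opNorm_mulVec M (EuclideanSpace.single j 1)
  rw [PiLp.norm_single, norm_one, mul_one] at h1
  refine le_trans ?_ h1
  have h2 := PiLp.norm_apply_le
    ((EuclideanSpace.equiv n ℂ).symm (M.mulVec (EuclideanSpace.single j (1 : ℂ)).ofLp)) i
  simpa using h2

/-- If `T²` is close to `γ + α B` with `B` as in Schur's test, then the squares of the eigenvalues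
of `T` are close to `γ + α t` with `t` in the numerical range of `B`. -/
theorem exists_eigenvalue_sq_near {B : n → n → ℝ} (hB : ∀ i j, 0 ≤ B i j)
    (hsymm : ∀ i j, B i j = B j i) {w : n → ℝ} (hw : ∀ i, 0 < w i) {r : ℝ}
    (hBw : ∀ i, ∑ j, B i j * w j = r * w i) {T : Matrix n n ℂ} {γ α : ℂ} {e : ℝ}
    (he : ‖T ^ 2 - γ • 1 - α • (Matrix.of fun i j => (B i j : ℂ))‖ ≤ e) {μ : ℂ}
    (hμ : μ ∈ spectrum ℂ T) :
    ∃ t : ℝ, |t| ≤ r ∧ ‖μ ^ 2 - γ - α * t‖ ≤ e := by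
  obtain ⟨v, hv, hTv⟩ := exists_eigenvector hμ
  obtain ⟨t, ht, hBt⟩ := exists_quadraticForm_eq hB hsymm hw hBw v
  have hS : 0 < ∑ i, ‖v i‖ ^ 2 := by
    obtain ⟨i, hi⟩ := Function.ne_iff.1 hv
    exact Finset.sum_pos' (fun _ _ => by positivity)
      ⟨i, Finset.mem_univ i, by have := norm_pos_iff.2 hi; positivity⟩
  have hvv : star v ⬝ᵥ v = ((∑ i, ‖v i‖ ^ 2 : ℝ) : ℂ) := by
    simp only [dotProduct, Pi.star_apply, Complex.ofReal_sum, Complex.ofReal_pow]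
    exact Finset.sum_congr rfl fun i _ => Complex.conj_mul' (v i)
  set S := ∑ i, ‖v i‖ ^ 2 with hSdef
  have hT2 : (T ^ 2).mulVec v = μ ^ 2 • v := by
    rw [pow_two, ← Matrix.mulVec_mulVec, hTv, Matrix.mulVec_smul, hTv, smul_smul, pow_two]
  -- `T` need not be normal, so the comparison is made on an eigenvector of `T` itself: `t / S` is
  -- the Rayleigh quotient of `B` there, and pairing the remainder with that vector gives the
  -- estimate.
  refine ⟨t / S, ?_, ?_⟩
  · rw [abs_div, abs_of_pos hS, div_le_iff₀ hS]
    exact ht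
  · have h := norm_quadraticForm_le (T ^ 2 - γ • 1 - α • (Matrix.of fun i j => (B i j : ℂ))) v
    rw [Matrix.sub_mulVec, Matrix.sub_mulVec, Matrix.smul_mulVec, Matrix.smul_mulVec,
      Matrix.one_mulVec, hT2, dotProduct_sub, dotProduct_sub, dotProduct_smul, dotProduct_smul,
      dotProduct_smul, hBt, hvv, smul_eq_mul, smul_eq_mul, smul_eq_mul] at h
    have hSc : (S : ℂ) ≠ 0 := by exact_mod_cast hS.ne'
    have e2 : μ ^ 2 * (S : ℂ) - γ * S - α * t = (μ ^ 2 - γ - α * ((t / S : ℝ) : ℂ)) * S := by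
      push_cast
      field_simp
    rw [e2, norm_mul, Complex.norm_real, Real.norm_of_nonneg hS.le] at h
    exact (le_of_mul_le_mul_right h hS).trans he

end Spectral

/-! ### Normal form of the iteration matrix

With `u = (p⁺ - λ) / (p⁺ + λ)`, `v = (p⁻ - λ) / (p⁻ + λ)`, `d = e^{-λδ}`, `E = e^{-λL}` the iteration
matrix is diagonally similar to a matrix whose entries are rational functions of `u, v, d, E`. -/

/-- The coefficient `α` in terms of `g = u v d²` and `E`. -/
noncomputable def couplingCoeff (g E : ℂ) : ℂ := E * (1 - g) / (1 - g * E ^ 2)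

/-- The normalized coefficients `β^±` at interior interfaces. -/
noncomputable def interiorCoeff (u v d E : ℂ) : ℂ :=
  u * d * (1 - E ^ 2) / (1 - u * v * d ^ 2 * E ^ 2)

/-- The normalized coefficients `β^±` next to the outer boundaries. -/
noncomputable def boundaryCoeff (u v d E : ℂ) : ℂ :=
  d * (u - E ^ 2) / (1 - v * E ^ 2 * d ^ 2)

/-- The product of the two interior coefficients in terms of `g = u v d²` and `E`. -/
noncomputable def productCoeff (g E : ℂ) : ℂ := g * (1 - E ^ 2) ^ 2 / (1 - g * E ^ 2) ^ 2

/-- The block shift `R₊(b_j) ← R₊(b_{j+1})`, `R₋(a_j) ← R₋(a_{j-1})`. -/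
noncomputable def shiftMatrix (N : ℕ) : Matrix (Fin N ⊕ Fin N) (Fin N ⊕ Fin N) ℂ :=
  Matrix.fromBlocks (Matrix.of fun i k => if (k : ℕ) = i + 1 then 1 else 0) 0 0
    (Matrix.of fun i k => if (k : ℕ) + 1 = i then 1 else 0)

/-- The exchange of the two traces at each interface. -/
noncomputable def swapMatrix (N : ℕ) : Matrix (Fin N ⊕ Fin N) (Fin N ⊕ Fin N) ℂ :=
  Matrix.fromBlocks 0 1 1 0

/-- The vector of all normalized coefficients `β_j^±`. -/
noncomputable def coeffVec (J : ℕ) (u v d E : ℂ) : Fin (J - 1) ⊕ Fin (J - 1) → ℂ :=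
  Sum.elim (fun i => if (i : ℕ) + 2 = J then boundaryCoeff u v d E else interiorCoeff u v d E)
    (fun i => if (i : ℕ) = 0 then boundaryCoeff v u d E else interiorCoeff v u d E)

/-- The normal form of the iteration matrix. -/
noncomputable def normalMatrix (J : ℕ) (u v d E : ℂ) :
    Matrix (Fin (J - 1) ⊕ Fin (J - 1)) (Fin (J - 1) ⊕ Fin (J - 1)) ℂ :=
  couplingCoeff (u * v * d ^ 2) E • shiftMatrix (J - 1) +
    Matrix.diagonal (coeffVec J u v d E) * swapMatrix (J - 1)

theorem norm_sub_lt_norm_add {l : ℂ} (hl : 0 < l.re) {p : ℝ} (hp : 0 < p) :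
    ‖(p : ℂ) - l‖ < ‖l + p‖ := by
  rw [← sq_lt_sq₀ (norm_nonneg _) (norm_nonneg _), ← Complex.normSq_eq_norm_sq,
    ← Complex.normSq_eq_norm_sq, Complex.normSq_apply, Complex.normSq_apply]
  simp only [Complex.sub_re, Complex.add_re, Complex.sub_im, Complex.add_im, Complex.ofReal_re,
    Complex.ofReal_im]
  nlinarith [mul_pos hl hp]

theorem add_ofReal_ne_zero {l : ℂ} (hl : 0 < l.re) {p : ℝ} (hp : 0 < p) : l + p ≠ 0 :=
  norm_pos_iff.1 ((norm_nonneg _).trans_lt (norm_sub_lt_norm_add hl hp))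

theorem norm_reflection_lt_one {l : ℂ} (hl : 0 < l.re) {p : ℝ} (hp : 0 < p) :
    ‖((p : ℂ) - l) / (l + p)‖ < 1 := by
  rw [norm_div, div_lt_one (norm_pos_iff.2 (add_ofReal_ne_zero hl hp))]
  exact norm_sub_lt_norm_add hl hp

theorem norm_exp_neg_mul (l : ℂ) (x : ℝ) : ‖Complex.exp (-l * x)‖ = Real.exp (-(l.re * x)) := by
  rw [Complex.norm_exp]
  simp

theorem one_sub_ne_zero_of_norm_lt {z : ℂ} (h : ‖z‖ < 1) : 1 - z ≠ 0 := by
  intro h0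
  rw [← sub_eq_zero.1 h0, norm_one] at h
  exact lt_irrefl _ h

section Entries

variable {L δ p m : ℝ} {l : ℂ}

theorem exp_identities (L δ : ℝ) (l : ℂ) :
    Complex.exp (l * δ) = (Complex.exp (-l * δ))⁻¹ ∧
    Complex.exp (l * L) = (Complex.exp (-l * L))⁻¹ ∧
    Complex.exp (l * (L + δ)) = (Complex.exp (-l * L) * Complex.exp (-l * δ))⁻¹ ∧
    Complex.exp (-l * (L + δ)) = Complex.exp (-l * L) * Complex.exp (-l * δ) := by
  refine ⟨?_, ?_, ?_, ?_⟩
  · rw [← Complex.exp_neg]; ring_nf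
  · rw [← Complex.exp_neg]; ring_nf
  · rw [← Complex.exp_add, ← Complex.exp_neg]; ring_nf
  · rw [← Complex.exp_add]; ring_nf

theorem norm_mul_sq_lt_one {u v d E : ℂ} (hu : ‖u‖ ≤ 1) (hv : ‖v‖ ≤ 1) (hd : ‖d‖ ≤ 1)
    (hE : ‖E‖ < 1) : ‖u * v * d ^ 2 * E ^ 2‖ < 1 := by
  rw [norm_mul]
  have h1 : ‖u * v * d ^ 2‖ ≤ 1 := by
    rw [norm_mul, norm_mul, norm_pow]
    exact mul_le_one₀ (mul_le_one₀ hu (norm_nonneg _) hv) (by positivity)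
      (pow_le_one₀ (norm_nonneg _) hd)
  have h2 : ‖E ^ 2‖ < 1 := by
    rw [norm_pow]
    exact pow_lt_one₀ (norm_nonneg _) hE two_ne_zero
  calc _ ≤ 1 * ‖E ^ 2‖ := by gcongr
    _ < 1 := by rwa [one_mul]

theorem denom_eq {d E : ℂ} (hd : d = Complex.exp (-l * δ)) (hE : E = Complex.exp (-l * L))
    (hp : l + p ≠ 0) (hm : l + m ≠ 0) :
    denom L δ l p m = (l + p) * (l + m) *
      (1 - (p - l) / (l + p) * ((m - l) / (l + m)) * d ^ 2 * E ^ 2) / (E * d) := by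
  obtain ⟨e1, e2, e3, e4⟩ := exp_identities L δ l
  have hd0 : d ≠ 0 := hd ▸ Complex.exp_ne_zero _
  have hE0 : E ≠ 0 := hE ▸ Complex.exp_ne_zero _
  rw [denom, e3, e4, ← hd, ← hE]
  field_simp
  ring

theorem alpha_eq {d E : ℂ} (hd : d = Complex.exp (-l * δ)) (hE : E = Complex.exp (-l * L))
    (hp : l + p ≠ 0) (hm : l + m ≠ 0)
    (h1 : 1 - (p - l) / (l + p) * ((m - l) / (l + m)) * d ^ 2 * E ^ 2 ≠ 0) :
    ((l + p) * (l + m) * Complex.exp (l * δ) - (l - p) * (l - m) * Complex.exp (-l * δ)) /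
      denom L δ l p m = couplingCoeff ((p - l) / (l + p) * ((m - l) / (l + m)) * d ^ 2) E := by
  obtain ⟨e1, e2, e3, e4⟩ := exp_identities L δ l
  have hd0 : d ≠ 0 := hd ▸ Complex.exp_ne_zero _
  have hE0 : E ≠ 0 := hE ▸ Complex.exp_ne_zero _
  rw [denom_eq hd hE hp hm, e1, ← hd, couplingCoeff]
  have hden : (l + p) * (l + m) *
      (1 - (p - l) / (l + p) * ((m - l) / (l + m)) * d ^ 2 * E ^ 2) / (E * d) ≠ 0 :=
    div_ne_zero (mul_ne_zero (mul_ne_zero hp hm) h1) (mul_ne_zero hE0 hd0)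
  rw [div_eq_div_iff hden h1]
  generalize hX : 1 - (p - l) / (l + p) * ((m - l) / (l + m)) * d ^ 2 * E ^ 2 = X
  field_simp
  ring

theorem betaInterior_eq {d E : ℂ} (hd : d = Complex.exp (-l * δ)) (hE : E = Complex.exp (-l * L))
    (hp : l + p ≠ 0) (hm : l + m ≠ 0)
    (h1 : 1 - (p - l) / (l + p) * ((m - l) / (l + m)) * d ^ 2 * E ^ 2 ≠ 0) :
    ((l + p) * (l - p) * Complex.exp (-l * L) - (l - p) * (l + p) * Complex.exp (l * L)) /
      denom L δ l p m =
      (l + p) / (l + m) * interiorCoeff ((p - l) / (l + p)) ((m - l) / (l + m)) d E := by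
  obtain ⟨e1, e2, e3, e4⟩ := exp_identities L δ l
  have hd0 : d ≠ 0 := hd ▸ Complex.exp_ne_zero _
  have hE0 : E ≠ 0 := hE ▸ Complex.exp_ne_zero _
  rw [denom_eq hd hE hp hm, e2, ← hE, interiorCoeff, ← mul_div_assoc ((l + p) / (l + m))]
  have hden : (l + p) * (l + m) *
      (1 - (p - l) / (l + p) * ((m - l) / (l + m)) * d ^ 2 * E ^ 2) / (E * d) ≠ 0 :=
    div_ne_zero (mul_ne_zero (mul_ne_zero hp hm) h1) (mul_ne_zero hE0 hd0)
  rw [div_eq_div_iff hden h1]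
  generalize hX : 1 - (p - l) / (l + p) * ((m - l) / (l + m)) * d ^ 2 * E ^ 2 = X
  field_simp
  ring

theorem betaDirichlet_eq {d E : ℂ} (hd : d = Complex.exp (-l * δ)) (hE : E = Complex.exp (-l * L))
    (hp : l + p ≠ 0) (hm : l + m ≠ 0) (h1 : 1 - (m - l) / (l + m) * E ^ 2 * d ^ 2 ≠ 0) :
    -((l + p) * Complex.exp (-l * L) + (l - p) * Complex.exp (l * L)) /
      ((l + m) * Complex.exp (l * (L + δ)) + (l - m) * Complex.exp (-l * (L + δ))) =
      (l + p) / (l + m) * boundaryCoeff ((p - l) / (l + p)) ((m - l) / (l + m)) d E := by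
  obtain ⟨e1, e2, e3, e4⟩ := exp_identities L δ l
  have hd0 : d ≠ 0 := hd ▸ Complex.exp_ne_zero _
  have hE0 : E ≠ 0 := hE ▸ Complex.exp_ne_zero _
  rw [e2, e3, e4, ← hE, ← hd, boundaryCoeff, ← mul_div_assoc ((l + p) / (l + m))]
  have hden : (l + m) * (E * d)⁻¹ + (l - m) * (E * d) =
      (l + m) * (1 - (m - l) / (l + m) * E ^ 2 * d ^ 2) / (E * d) := by
    field_simp
    ring
  rw [hden, div_eq_div_iff (div_ne_zero (mul_ne_zero hm h1) (mul_ne_zero hE0 hd0)) h1]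
  generalize hX : 1 - (m - l) / (l + m) * E ^ 2 * d ^ 2 = X
  field_simp
  ring

end Entries

/-- The coefficients `β⁺` and `β⁻` carry the reciprocal factors `W = (λ + p)/(λ + m)` and `W⁻¹`.
Conjugation by `diag(W, 1)` removes both and leaves the diagonal blocks unchanged. -/
theorem spectrum_iterationMatrix {J : ℕ} {L δ p m : ℝ} {l : ℂ} (hL : 0 < L) (hδ : 0 ≤ δ)
    (hl : 0 < l.re) (hp : 0 < p) (hm : 0 < m) :
    spectrum ℂ (iterationMatrix J L δ l (fun _ => p) (fun _ => m)) =
      spectrum ℂ (normalMatrix J ((p - l) / (l + p)) ((m - l) / (l + m))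
        (Complex.exp (-l * δ)) (Complex.exp (-l * L))) := by
  have hlp := add_ofReal_ne_zero hl hp
  have hlm := add_ofReal_ne_zero hl hm
  have hdn : ‖Complex.exp (-l * δ)‖ ≤ 1 := by
    rw [norm_exp_neg_mul, Real.exp_le_one_iff]
    nlinarith
  have hEn : ‖Complex.exp (-l * L)‖ < 1 := by
    rw [norm_exp_neg_mul, Real.exp_lt_one_iff]
    nlinarith [mul_pos hl hL]
  have hun := (norm_reflection_lt_one hl hp).le
  have hvn := (norm_reflection_lt_one hl hm).le
  generalize hd : Complex.exp (-l * δ) = d at *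
  generalize hE : Complex.exp (-l * L) = E at *
  have h1 := one_sub_ne_zero_of_norm_lt (norm_mul_sq_lt_one hun hvn hdn hEn)
  have h2 := one_sub_ne_zero_of_norm_lt (norm_mul_sq_lt_one hvn hun hdn hEn)
  have h3 : ∀ w : ℂ, ‖w‖ ≤ 1 → 1 - w * E ^ 2 * d ^ 2 ≠ 0 := fun w hw => by
    have := one_sub_ne_zero_of_norm_lt
      (norm_mul_sq_lt_one hw (norm_one.le : ‖(1 : ℂ)‖ ≤ 1) hdn hEn)
    convert this using 2
    ring
  have ea1 : ∀ j, alphaPlus L δ l (fun _ => p) (fun _ => m) j =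
      couplingCoeff ((p - l) / (l + p) * ((m - l) / (l + m)) * d ^ 2) E := fun j => by
    rw [← alpha_eq hd.symm hE.symm hlp hlm h1, alphaPlus]
    ring
  have ea2 : ∀ j, alphaMinus L δ l (fun _ => p) (fun _ => m) j =
      couplingCoeff ((p - l) / (l + p) * ((m - l) / (l + m)) * d ^ 2) E := fun j => by
    rw [← alpha_eq hd.symm hE.symm hlp hlm h1, alphaMinus]
  have eb1 : ∀ j, betaPlus L δ l (fun _ => p) (fun _ => m) j =
      (l + p) / (l + m) * interiorCoeff ((p - l) / (l + p)) ((m - l) / (l + m)) d E := fun j =>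
    betaInterior_eq hd.symm hE.symm hlp hlm h1
  have eb2 : ∀ j, betaMinus L δ l (fun _ => p) (fun _ => m) j =
      (l + m) / (l + p) * interiorCoeff ((m - l) / (l + m)) ((p - l) / (l + p)) d E := fun j => by
    rw [← betaInterior_eq hd.symm hE.symm hlm hlp h2, betaMinus, denom, denom]
    ring
  have eb3 : ∀ j, betaPlusDirichlet L δ l (fun _ => p) (fun _ => m) j =
      (l + p) / (l + m) * boundaryCoeff ((p - l) / (l + p)) ((m - l) / (l + m)) d E := fun j =>
    betaDirichlet_eq hd.symm hE.symm hlp hlm (h3 _ hvn)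
  have eb4 : ∀ j, betaMinusDirichlet L δ l (fun _ => p) (fun _ => m) j =
      (l + m) / (l + p) * boundaryCoeff ((m - l) / (l + m)) ((p - l) / (l + p)) d E := fun j =>
    betaDirichlet_eq hd.symm hE.symm hlm hlp (h3 _ hun)
  have hW : (l + p) / (l + m) ≠ 0 := div_ne_zero hlp hlm
  have hW' : ((l + p) / (l + m))⁻¹ = (l + m) / (l + p) := inv_div _ _
  generalize (l + p) / (l + m) = W at *
  rw [← hW'] at eb2 eb4
  let w : Fin (J - 1) ⊕ Fin (J - 1) → ℂ := Sum.elim (fun _ => W) fun _ => 1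
  let w' : Fin (J - 1) ⊕ Fin (J - 1) → ℂ := Sum.elim (fun _ => W⁻¹) fun _ => 1
  have hww : ∀ i, w i * w' i = 1 := by
    rintro (i | i) <;> simp [w, w', hW]
  have hww' : ∀ i, w' i * w i = 1 := fun i => by rw [mul_comm, hww]
  let U : (Matrix (Fin (J - 1) ⊕ Fin (J - 1)) (Fin (J - 1) ⊕ Fin (J - 1)) ℂ)ˣ :=
    ⟨Matrix.diagonal w, Matrix.diagonal w',
      by simp only [Matrix.diagonal_mul_diagonal, hww, Matrix.diagonal_one],
      by simp only [Matrix.diagonal_mul_diagonal, hww', Matrix.diagonal_one]⟩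
  refine Eq.trans ?_ (spectrum.units_conjugate (u := U))
  congr 1
  change _ = Matrix.diagonal w * _ * Matrix.diagonal w'
  ext i j
  rw [Matrix.mul_diagonal, Matrix.diagonal_mul, normalMatrix, Matrix.add_apply,
    Matrix.diagonal_mul, Matrix.smul_apply]
  rcases i with i | i <;> rcases j with j | j <;>
    simp only [iterationMatrix, shiftMatrix, swapMatrix, Matrix.fromBlocks_apply₁₁,
      Matrix.fromBlocks_apply₁₂, Matrix.fromBlocks_apply₂₁, Matrix.fromBlocks_apply₂₂,
      Matrix.of_apply, coeffVec, Sum.elim_inl, Sum.elim_inr, w, w', ea1, ea2, eb1, eb2, eb3, eb4,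
      Matrix.zero_apply, Matrix.one_apply, smul_eq_mul, mul_zero, mul_one, add_zero, zero_add,
      one_mul, eq_comm (a := j) (b := i)]
  · split_ifs
    · field_simp
    · simp
  · split_ifs <;> simp
  · split_ifs <;> simp [mul_comm]
  · split_ifs <;> simp

/-! ### The square of the normal form -/

/-- The adjacency of neighbouring interfaces, between traces of different type. -/
def pathCoupling (N : ℕ) : Fin N ⊕ Fin N → Fin N ⊕ Fin N → ℝ :=
  Sum.elim
    (fun i => Sum.elim (fun _ => 0) fun k =>
      (if (k : ℕ) = i + 1 then 1 else 0) + if (k : ℕ) + 1 = i then 1 else 0)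
    (fun i => Sum.elim (fun k =>
      (if (k : ℕ) = i + 1 then 1 else 0) + if (k : ℕ) + 1 = i then 1 else 0) fun _ => 0)

/-- The complex matrix of `pathCoupling`. -/
noncomputable def couplingMatrix (N : ℕ) : Matrix (Fin N ⊕ Fin N) (Fin N ⊕ Fin N) ℂ :=
  Matrix.of fun i j => (pathCoupling N i j : ℂ)

theorem pathCoupling_nonneg (N : ℕ) (i j : Fin N ⊕ Fin N) : 0 ≤ pathCoupling N i j := by
  rcases i with i | i <;> rcases j with j | j <;> simp only [pathCoupling, Sum.elim_inl,
    Sum.elim_inr, le_refl] <;> split_ifs <;> norm_num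

theorem pathCoupling_symm (N : ℕ) (i j : Fin N ⊕ Fin N) :
    pathCoupling N i j = pathCoupling N j i := by
  rcases i with i | i <;> rcases j with j | j <;> simp only [pathCoupling, Sum.elim_inl,
    Sum.elim_inr] <;> rw [add_comm] <;> simp only [eq_comm]

/-- The Dirichlet ground state of the path with `J - 1` vertices. -/
noncomputable def sineVec (J : ℕ) (i : Fin (J - 1)) : ℝ := Real.sin (Real.pi * (i + 1) / J)

theorem sineVec_pos {J : ℕ} (hJ : 2 ≤ J) (i : Fin (J - 1)) : 0 < sineVec J i := by
  have hi : (i : ℕ) + 1 < J := by omega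
  have hi' : ((i : ℕ) : ℝ) + 1 < J := by exact_mod_cast hi
  have hJ' : (0 : ℝ) < J := by positivity
  apply Real.sin_pos_of_pos_of_lt_pi
  · have := Real.pi_pos
    positivity
  · rw [div_lt_iff₀ hJ']
    exact mul_lt_mul_of_pos_left hi' Real.pi_pos

/-- This is `sin(θ + π/J) + sin(θ - π/J) = 2 cos(π/J) sin θ`. The neighbours missing at the two ends
would carry `sin 0` and `sin π`, so leaving them out changes nothing. -/
theorem sum_sineVec {J : ℕ} (hJ : 2 ≤ J) (i : Fin (J - 1)) :
    ∑ k : Fin (J - 1), ((if (k : ℕ) = i + 1 then 1 else 0) + if (k : ℕ) + 1 = i then 1 else 0) *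
      sineVec J k = 2 * Real.cos (Real.pi / J) * sineVec J i := by
  have hJ' : (J : ℝ) ≠ 0 := by positivity
  have hi := i.2
  simp only [add_mul, Finset.sum_add_distrib, ite_mul, one_mul, zero_mul, sineVec]
  rw [Fin.sum_univ_eq_sum_range
      (fun k => if k = (i : ℕ) + 1 then Real.sin (Real.pi * (k + 1) / J) else 0) (J - 1),
    Fin.sum_univ_eq_sum_range
      (fun k => if k + 1 = (i : ℕ) then Real.sin (Real.pi * (k + 1) / J) else 0) (J - 1)]
  have h1 : ∑ k ∈ Finset.range (J - 1),
      (if k = (i : ℕ) + 1 then Real.sin (Real.pi * (k + 1) / J) else 0) =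
      Real.sin (Real.pi * (i + 1) / J + Real.pi / J) := by
    rw [Finset.sum_ite_eq']
    split_ifs with h
    · congr 1
      push_cast
      ring
    · have : (i : ℕ) + 2 = J := by
        rw [Finset.mem_range] at h
        omega
      have e : Real.pi * ((i : ℕ) + 1) / J + Real.pi / J = Real.pi := by
        have e2 : (J : ℝ) = (i : ℕ) + 2 := by exact_mod_cast this.symm
        rw [← add_div, div_eq_iff hJ', e2]
        ring
      rw [e, Real.sin_pi]
  have h2 : ∑ k ∈ Finset.range (J - 1),
      (if k + 1 = (i : ℕ) then Real.sin (Real.pi * (k + 1) / J) else 0) =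
      Real.sin (Real.pi * (i + 1) / J - Real.pi / J) := by
    have e : Real.pi * ((i : ℕ) + 1) / J - Real.pi / J = Real.pi * (i : ℕ) / J := by ring
    rw [e]
    rcases Nat.eq_zero_or_pos (i : ℕ) with h0 | h0
    · rw [h0]
      simp
    · rw [Finset.sum_eq_single ((i : ℕ) - 1)]
      · rw [if_pos (by omega)]
        congr 3
        exact_mod_cast (show (i : ℕ) - 1 + 1 = i by omega)
      · intro k _ hk
        rw [if_neg (by omega)]
      · intro h
        rw [Finset.mem_range] at h
        omega
  rw [h1, h2, Real.sin_add, Real.sin_sub]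
  ring

theorem sum_pathCoupling_mul {J : ℕ} (hJ : 2 ≤ J) (i : Fin (J - 1) ⊕ Fin (J - 1)) :
    ∑ j, pathCoupling (J - 1) i j * Sum.elim (sineVec J) (sineVec J) j =
      2 * Real.cos (Real.pi / J) * Sum.elim (sineVec J) (sineVec J) i := by
  rcases i with i | i <;>
    simp [pathCoupling, Fintype.sum_sum_type, ← sum_sineVec hJ i]

theorem cos_pi_div_nonneg {J : ℕ} (hJ : 2 ≤ J) : 0 ≤ Real.cos (Real.pi / J) := by
  have hJ' : (2 : ℝ) ≤ J := by exact_mod_cast hJ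
  have h1 : Real.pi / J ≤ Real.pi / 2 := div_le_div_of_nonneg_left Real.pi_pos.le two_pos hJ'
  have h2 : 0 ≤ Real.pi / J := div_nonneg Real.pi_pos.le (by positivity)
  exact Real.cos_nonneg_of_neg_pi_div_two_le_of_le (by linarith [Real.pi_pos]) h1

/-- Only traces of different type are coupled, so the graph is bipartite: changing the sign of the
sine vector on one side changes the sign of the eigenvalue. -/
theorem mem_spectrum_couplingMatrix {J : ℕ} (hJ : 2 ≤ J) {σ : ℝ} (hσ : σ = 1 ∨ σ = -1) :
    ((σ * (2 * Real.cos (Real.pi / J)) : ℝ) : ℂ) ∈ spectrum ℂ (couplingMatrix (J - 1)) := by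
  have hσ2 : σ * σ = 1 := by rcases hσ with rfl | rfl <;> norm_num
  let v : Fin (J - 1) ⊕ Fin (J - 1) → ℝ := Sum.elim (sineVec J) fun i => σ * sineVec J i
  have hv : ∀ i, ∑ j, pathCoupling (J - 1) i j * v j = σ * (2 * Real.cos (Real.pi / J)) * v i := by
    rintro (i | i)
    · simp only [pathCoupling, Fintype.sum_sum_type, v, Sum.elim_inl, Sum.elim_inr, zero_mul,
        Finset.sum_const_zero, zero_add, mul_left_comm _ σ, ← Finset.mul_sum, sum_sineVec hJ i]
      ring
    · simp only [pathCoupling, Fintype.sum_sum_type, v, Sum.elim_inl, Sum.elim_inr, zero_mul,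
        Finset.sum_const_zero, add_zero, sum_sineVec hJ i]
      rw [show σ * (2 * Real.cos (Real.pi / J)) * (σ * sineVec J i) =
        (σ * σ) * (2 * Real.cos (Real.pi / J) * sineVec J i) by ring, hσ2, one_mul]
  refine mem_spectrum_of_mulVec (v := fun i => (v i : ℂ)) ?_ ?_
  · intro h
    have h0 := congrFun h (Sum.inl ⟨0, by omega⟩)
    have : sineVec J ⟨0, by omega⟩ = 0 := by simpa [v] using h0
    exact (sineVec_pos hJ _).ne' this
  · ext i
    simp only [Matrix.mulVec, dotProduct, couplingMatrix, Matrix.of_apply, Pi.smul_apply,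
      smul_eq_mul]
    exact_mod_cast hv i

theorem shift_mul_swap_add (N : ℕ) :
    shiftMatrix N * swapMatrix N + swapMatrix N * shiftMatrix N = couplingMatrix N := by
  rw [shiftMatrix, swapMatrix, Matrix.fromBlocks_multiply, Matrix.fromBlocks_multiply]
  ext i j
  rcases i with i | i <;> rcases j with j | j <;>
    simp [couplingMatrix, pathCoupling, add_comm] <;> split_ifs <;> simp

theorem swap_mul_diagonal_mul_swap (N : ℕ) (a b : Fin N → ℂ) :
    swapMatrix N * Matrix.diagonal (Sum.elim a b) * swapMatrix N =
      Matrix.diagonal (Sum.elim b a) := by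
  rw [swapMatrix, ← Matrix.fromBlocks_diagonal, ← Matrix.fromBlocks_diagonal,
    Matrix.fromBlocks_multiply, Matrix.fromBlocks_multiply]
  simp

/-! ### Distance of the squared normal form from `γ + α A`. -/

section Norm

open scoped Matrix.Norms.L2Operator

theorem norm_diagonal_le {n : Type*} [Fintype n] [DecidableEq n] {v : n → ℂ} {r : ℝ} (hr : 0 ≤ r)
    (h : ∀ i, ‖v i‖ ≤ r) : ‖(Matrix.diagonal v : Matrix n n ℂ)‖ ≤ r := by
  rw [Matrix.l2_opNorm_diagonal]
  exact (pi_norm_le_iff_of_nonneg hr).2 h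

/-- Writing `D = 1 + (D - 1)` in the cross terms isolates `α (V S + S V)`. The term `D S D S` is
diagonal with entries `a i * b i`, since conjugation by the swap exchanges the two halves of `D`. -/
theorem norm_shift_add_sq_sub_le (N : ℕ) (al γ : ℂ) (a b : Fin N → ℂ) {φ ψ : ℝ} (hφ : 0 ≤ φ)
    (hψ : 0 ≤ ψ) (ha : ∀ i, ‖a i - 1‖ ≤ φ) (hb : ∀ i, ‖b i - 1‖ ≤ φ)
    (hab : ∀ i, ‖a i * b i - γ‖ ≤ ψ) :
    ‖(al • shiftMatrix N + Matrix.diagonal (Sum.elim a b) * swapMatrix N) ^ 2 - γ • 1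
      - al • couplingMatrix N‖ ≤
      ‖al‖ ^ 2 * ‖shiftMatrix N‖ ^ 2 + ‖al‖ * (2 * ‖shiftMatrix N‖ * ‖swapMatrix N‖ * φ) + ψ := by
  set V := shiftMatrix N
  set S := swapMatrix N
  set D : Matrix (Fin N ⊕ Fin N) (Fin N ⊕ Fin N) ℂ := Matrix.diagonal (Sum.elim a b)
  have hSDS : S * D * S = Matrix.diagonal (Sum.elim b a) := swap_mul_diagonal_mul_swap N a b
  have e1 : (al • V + D * S) ^ 2 - γ • 1 - al • couplingMatrix N =
      al ^ 2 • (V * V) + al • (V * ((D - 1) * S) + (D - 1) * (S * V)) + (D * (S * D * S) - γ • 1) := by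
    rw [← shift_mul_swap_add, pow_two, pow_two]
    simp only [mul_add, add_mul, sub_mul, mul_sub, smul_mul_assoc, mul_smul_comm, smul_add,
      smul_sub, smul_smul, mul_assoc, one_mul]
    abel
  have h1 : ‖D - 1‖ ≤ φ := by
    rw [← Matrix.diagonal_one, Matrix.diagonal_sub]
    exact norm_diagonal_le hφ (by rintro (i | i) <;> simp [ha, hb])
  have h2 : ‖D * (S * D * S) - γ • 1‖ ≤ ψ := by
    rw [hSDS, Matrix.diagonal_mul_diagonal, ← Matrix.diagonal_one, ← Matrix.diagonal_smul,
      Matrix.diagonal_sub]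
    refine norm_diagonal_le hψ ?_
    rintro (i | i)
    · simpa using hab i
    · simpa [mul_comm] using hab i
  have h3 : ‖V * ((D - 1) * S) + (D - 1) * (S * V)‖ ≤ 2 * ‖V‖ * ‖S‖ * φ := by
    calc _ ≤ ‖V‖ * (‖D - 1‖ * ‖S‖) + ‖D - 1‖ * (‖S‖ * ‖V‖) :=
          (norm_add_le _ _).trans (add_le_add
            ((norm_mul_le _ _).trans (by gcongr; exact norm_mul_le _ _))
            ((norm_mul_le _ _).trans (by gcongr; exact norm_mul_le _ _)))
      _ = 2 * ‖V‖ * ‖S‖ * ‖D - 1‖ := by ring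
      _ ≤ _ := by gcongr
  rw [e1]
  refine (norm_add₃_le).trans ?_
  rw [norm_smul, norm_smul, norm_pow]
  have h4 : ‖V * V‖ ≤ ‖V‖ ^ 2 := by
    rw [pow_two]
    exact norm_mul_le _ _
  gcongr

end Norm

/-! ### Estimates of the normalized coefficients. -/

section Bounds

variable {u v d E : ℂ} {e : ℝ}

theorem le_norm_one_sub {z : ℂ} (h : ‖z‖ ≤ e) : 1 - e ≤ ‖1 - z‖ := by
  have := norm_sub_norm_le (1 : ℂ) z
  rw [norm_one] at this
  linarith

theorem norm_mul_le_one {a b : ℂ} (ha : ‖a‖ ≤ 1) (hb : ‖b‖ ≤ 1) : ‖a * b‖ ≤ 1 := by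
  rw [norm_mul]
  exact mul_le_one₀ ha (norm_nonneg _) hb

theorem norm_mul_le_of_le_one {a b : ℂ} {r : ℝ} (ha : ‖a‖ ≤ 1) (hb : ‖b‖ ≤ r) : ‖a * b‖ ≤ r := by
  rw [norm_mul]
  have := mul_le_mul_of_nonneg_right ha (norm_nonneg b)
  linarith

theorem norm_one_sub_mul_le {a b : ℂ} (ha : ‖a‖ ≤ 1) : ‖1 - a * b‖ ≤ ‖1 - a‖ + ‖1 - b‖ := by
  have e : 1 - a * b = (1 - a) + a * (1 - b) := by ring
  rw [e]
  exact (norm_add_le _ _).trans (by gcongr; exact norm_mul_le_of_le_one ha le_rfl)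

theorem norm_one_sub_prod_le (hu : ‖u‖ ≤ 1) (hv : ‖v‖ ≤ 1) (hd : ‖d‖ ≤ 1) :
    ‖1 - u * v * d ^ 2‖ ≤ 2 * (‖1 - u‖ + ‖1 - v‖ + ‖1 - d‖) := by
  have h1 := norm_one_sub_mul_le (b := d ^ 2) (norm_mul_le_one hu hv)
  have h2 := norm_one_sub_mul_le (b := v) hu
  have h3 := norm_one_sub_mul_le (b := d) hd
  rw [← pow_two] at h3
  linarith [norm_nonneg (1 - u), norm_nonneg (1 - v)]

theorem norm_prod_le_one (hu : ‖u‖ ≤ 1) (hv : ‖v‖ ≤ 1) (hd : ‖d‖ ≤ 1) :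
    ‖u * v * d ^ 2‖ ≤ 1 := by
  rw [pow_two]
  exact norm_mul_le_one (norm_mul_le_one hu hv) (norm_mul_le_one hd hd)

theorem norm_couplingCoeff_le {g : ℂ} (hg : ‖g‖ ≤ 1) (hE : ‖E‖ ^ 2 ≤ e) (he : e < 1) :
    ‖couplingCoeff g E‖ ≤ ‖E‖ * ‖1 - g‖ / (1 - e) := by
  rw [couplingCoeff, norm_div, norm_mul]
  have := le_norm_one_sub (norm_mul_le_of_le_one hg ((norm_pow E 2).le.trans hE))
  have h0 : 0 < 1 - e := by linarith
  gcongr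

theorem productCoeff_eq (u v d E : ℂ) :
    productCoeff (u * v * d ^ 2) E = interiorCoeff u v d E * interiorCoeff v u d E := by
  rw [productCoeff, interiorCoeff, interiorCoeff, div_mul_div_comm]
  congr 1 <;> ring

theorem norm_interiorCoeff_sub_one_le (hu : ‖u‖ ≤ 1) (hv : ‖v‖ ≤ 1) (hd : ‖d‖ ≤ 1)
    (hE : ‖E‖ ^ 2 ≤ e) (he : e < 1) :
    ‖interiorCoeff u v d E - 1‖ ≤ 2 * (‖1 - u‖ + ‖1 - v‖ + ‖1 - d‖) / (1 - e) := by
  have hEn : ‖E ^ 2‖ ≤ e := (norm_pow E 2).le.trans hE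
  have h0 : 0 < 1 - e := by linarith
  have hden := le_norm_one_sub (norm_mul_le_of_le_one (norm_prod_le_one hu hv hd) hEn)
  have hne : 1 - u * v * d ^ 2 * E ^ 2 ≠ 0 := norm_pos_iff.1 (h0.trans_le hden)
  have e1 : interiorCoeff u v d E - 1 =
      -((1 - u * d) + E ^ 2 * (u * d) * (1 - v * d)) / (1 - u * v * d ^ 2 * E ^ 2) := by
    rw [interiorCoeff, eq_div_iff hne, sub_mul, div_mul_cancel₀ _ hne]
    ring
  rw [e1, norm_div, norm_neg]
  have hE1 : ‖E ^ 2‖ ≤ 1 := hEn.trans he.le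
  have h1 : ‖(1 - u * d) + E ^ 2 * (u * d) * (1 - v * d)‖ ≤
      2 * (‖1 - u‖ + ‖1 - v‖ + ‖1 - d‖) := by
    have a1 := norm_one_sub_mul_le (b := d) hu
    have a2 := norm_one_sub_mul_le (b := d) hv
    have a3 := norm_mul_le_of_le_one (norm_mul_le_one hE1 (norm_mul_le_one hu hd)) a2
    have := norm_add_le (1 - u * d) (E ^ 2 * (u * d) * (1 - v * d))
    linarith [norm_nonneg (1 - u), norm_nonneg (1 - v)]
  gcongr

theorem norm_boundaryCoeff_sub_one_le (hu : ‖u‖ ≤ 1) (hv : ‖v‖ ≤ 1) (hd : ‖d‖ ≤ 1)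
    (hE : ‖E‖ ^ 2 ≤ e) (he : e < 1) :
    ‖boundaryCoeff u v d E - 1‖ ≤ 2 * (‖1 - u‖ + ‖1 - v‖ + ‖1 - d‖) / (1 - e) := by
  have hEn : ‖E ^ 2‖ ≤ e := (norm_pow E 2).le.trans hE
  have h0 : 0 < 1 - e := by linarith
  have hden : 1 - e ≤ ‖1 - v * E ^ 2 * d ^ 2‖ := by
    have := le_norm_one_sub
      (norm_mul_le_of_le_one (norm_mul_le_one hv (norm_mul_le_one hd hd)) hEn)
    convert this using 3
    ring
  have hne : 1 - v * E ^ 2 * d ^ 2 ≠ 0 := norm_pos_iff.1 (h0.trans_le hden)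
  have e1 : boundaryCoeff u v d E - 1 =
      -((1 - u * d) + E ^ 2 * d * (1 - v * d)) / (1 - v * E ^ 2 * d ^ 2) := by
    rw [boundaryCoeff, eq_div_iff hne, sub_mul, div_mul_cancel₀ _ hne]
    ring
  rw [e1, norm_div, norm_neg]
  have hE1 : ‖E ^ 2‖ ≤ 1 := hEn.trans he.le
  have h1 : ‖(1 - u * d) + E ^ 2 * d * (1 - v * d)‖ ≤
      2 * (‖1 - u‖ + ‖1 - v‖ + ‖1 - d‖) := by
    have a1 := norm_one_sub_mul_le (b := d) hu
    have a2 := norm_one_sub_mul_le (b := d) hv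
    have a3 := norm_mul_le_of_le_one (norm_mul_le_one hE1 hd) a2
    have := norm_add_le (1 - u * d) (E ^ 2 * d * (1 - v * d))
    linarith [norm_nonneg (1 - u), norm_nonneg (1 - v)]
  gcongr

/-- The numerator of the difference is `-d E² (1 - u) (1 - g)`, a product of two small factors. This
is why the outer Dirichlet conditions are invisible at leading order. -/
theorem norm_boundaryCoeff_sub_interiorCoeff_le (hu : ‖u‖ ≤ 1) (hv : ‖v‖ ≤ 1) (hd : ‖d‖ ≤ 1)
    (hE : ‖E‖ ^ 2 ≤ e) (he : e < 1) :
    ‖boundaryCoeff u v d E - interiorCoeff u v d E‖ ≤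
      ‖E‖ ^ 2 * ‖1 - u‖ * ‖1 - u * v * d ^ 2‖ / (1 - e) ^ 2 := by
  have hEn : ‖E ^ 2‖ ≤ e := (norm_pow E 2).le.trans hE
  have h0 : 0 < 1 - e := by linarith
  have hden := le_norm_one_sub (norm_mul_le_of_le_one (norm_prod_le_one hu hv hd) hEn)
  have hne : 1 - u * v * d ^ 2 * E ^ 2 ≠ 0 := norm_pos_iff.1 (h0.trans_le hden)
  have hden' : 1 - e ≤ ‖1 - v * E ^ 2 * d ^ 2‖ := by
    have := le_norm_one_sub
      (norm_mul_le_of_le_one (norm_mul_le_one hv (norm_mul_le_one hd hd)) hEn)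
    convert this using 3
    ring
  have hne' : 1 - v * E ^ 2 * d ^ 2 ≠ 0 := norm_pos_iff.1 (h0.trans_le hden')
  have e1 : boundaryCoeff u v d E - interiorCoeff u v d E =
      -(d * (E ^ 2 * (1 - u) * (1 - u * v * d ^ 2))) /
        ((1 - v * E ^ 2 * d ^ 2) * (1 - u * v * d ^ 2 * E ^ 2)) := by
    rw [boundaryCoeff, interiorCoeff, div_sub_div _ _ hne' hne]
    congr 1
    ring
  rw [e1, norm_div, norm_neg, norm_mul (1 - v * E ^ 2 * d ^ 2), pow_two (1 - e)]
  have h1 : ‖d * (E ^ 2 * (1 - u) * (1 - u * v * d ^ 2))‖ ≤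
      ‖E‖ ^ 2 * ‖1 - u‖ * ‖1 - u * v * d ^ 2‖ := by
    refine norm_mul_le_of_le_one hd ?_
    rw [norm_mul, norm_mul, norm_pow]
  gcongr

theorem norm_one_sub_add_le (hu : ‖u‖ ≤ 1) (hv : ‖v‖ ≤ 1) (hd : ‖d‖ ≤ 1) :
    ‖1 - u‖ + ‖1 - v‖ + ‖1 - d‖ ≤ 6 := by
  have : ∀ z : ℂ, ‖z‖ ≤ 1 → ‖1 - z‖ ≤ 2 := fun z hz =>
    (norm_sub_le _ _).trans (by rw [norm_one]; linarith)
  linarith [this u hu, this v hv, this d hd]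

theorem norm_coeff_le {b : ℂ} (hu : ‖u‖ ≤ 1) (hv : ‖v‖ ≤ 1) (hd : ‖d‖ ≤ 1) (he0 : 0 ≤ e)
    (he : e < 1) (hb : ‖b - 1‖ ≤ 2 * (‖1 - u‖ + ‖1 - v‖ + ‖1 - d‖) / (1 - e)) :
    ‖b‖ ≤ 13 / (1 - e) := by
  have h0 : 0 < 1 - e := by linarith
  have h1 : ‖b‖ ≤ ‖b - 1‖ + 1 := by
    have := norm_add_le (b - 1) 1
    rwa [sub_add_cancel, norm_one] at this
  have h2 : 2 * (‖1 - u‖ + ‖1 - v‖ + ‖1 - d‖) / (1 - e) ≤ 12 / (1 - e) := by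
    gcongr
    linarith [norm_one_sub_add_le hu hv hd]
  have h3 : 1 ≤ 1 / (1 - e) := (one_le_div h0).2 (by linarith)
  have h4 : 13 / (1 - e) = 12 / (1 - e) + 1 / (1 - e) := by ring
  linarith

theorem norm_boundaryCoeff_sub_interiorCoeff_le' (hu : ‖u‖ ≤ 1) (hv : ‖v‖ ≤ 1) (hd : ‖d‖ ≤ 1)
    (hE : ‖E‖ ^ 2 ≤ e) (he : e < 1) :
    ‖boundaryCoeff u v d E - interiorCoeff u v d E‖ ≤
      ‖E‖ * ‖1 - u * v * d ^ 2‖ * (‖1 - u‖ + ‖1 - v‖ + ‖1 - d‖) / (1 - e) ^ 2 := by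
  refine (norm_boundaryCoeff_sub_interiorCoeff_le hu hv hd hE he).trans ?_
  have hE1 : ‖E‖ ≤ 1 := by
    by_contra! h
    nlinarith
  have h1 : ‖E‖ ^ 2 ≤ ‖E‖ := by
    rw [pow_two]
    exact mul_le_of_le_one_left (norm_nonneg _) hE1
  have h2 : ‖1 - u‖ ≤ ‖1 - u‖ + ‖1 - v‖ + ‖1 - d‖ := by
    linarith [norm_nonneg (1 - v), norm_nonneg (1 - d)]
  calc _ ≤ ‖E‖ * (‖1 - u‖ + ‖1 - v‖ + ‖1 - d‖) * ‖1 - u * v * d ^ 2‖ / (1 - e) ^ 2 := by gcongr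
    _ = _ := by ring

/-- `γ` is the product of the two interior coefficients. Replacing either factor by its boundary
version costs a second-order term times a factor bounded by `13 / (1 - e)`, hence `26` in total. -/
theorem norm_mul_sub_productCoeff_le {a b : ℂ} (hu : ‖u‖ ≤ 1) (hv : ‖v‖ ≤ 1) (hd : ‖d‖ ≤ 1)
    (hE : ‖E‖ ^ 2 ≤ e) (he : e < 1)
    (ha : a = boundaryCoeff u v d E ∨ a = interiorCoeff u v d E)
    (hb : b = boundaryCoeff v u d E ∨ b = interiorCoeff v u d E) :
    ‖a * b - productCoeff (u * v * d ^ 2) E‖ ≤ 26 / (1 - e) ^ 3 *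
      (‖E‖ * ‖1 - u * v * d ^ 2‖ * (‖1 - u‖ + ‖1 - v‖ + ‖1 - d‖)) := by
  have h0 : 0 < 1 - e := by linarith
  have he0 : 0 ≤ e := (sq_nonneg _).trans hE
  have hηsymm : ‖1 - v‖ + ‖1 - u‖ + ‖1 - d‖ = ‖1 - u‖ + ‖1 - v‖ + ‖1 - d‖ := by ring
  have hgsymm : v * u * d ^ 2 = u * v * d ^ 2 := by ring
  have d1 := norm_boundaryCoeff_sub_interiorCoeff_le' hu hv hd hE he
  have d2 := norm_boundaryCoeff_sub_interiorCoeff_le' hv hu hd hE he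
  have i1 := norm_coeff_le hu hv hd he0 he (norm_interiorCoeff_sub_one_le hu hv hd hE he)
  have i2 := norm_coeff_le hv hu hd he0 he (norm_interiorCoeff_sub_one_le hv hu hd hE he)
  have b2 := norm_coeff_le hv hu hd he0 he (norm_boundaryCoeff_sub_one_le hv hu hd hE he)
  rw [hηsymm, hgsymm] at d2
  set Δ := ‖E‖ * ‖1 - u * v * d ^ 2‖ * (‖1 - u‖ + ‖1 - v‖ + ‖1 - d‖) with hΔ
  have hΔnn : 0 ≤ Δ := by positivity
  have ha' : ‖a - interiorCoeff u v d E‖ ≤ Δ / (1 - e) ^ 2 := by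
    rcases ha with rfl | rfl
    · exact d1
    · rw [sub_self, norm_zero]
      positivity
  have hb' : ‖b - interiorCoeff v u d E‖ ≤ Δ / (1 - e) ^ 2 := by
    rcases hb with rfl | rfl
    · exact d2
    · rw [sub_self, norm_zero]
      positivity
  have hb'' : ‖b‖ ≤ 13 / (1 - e) := by rcases hb with rfl | rfl <;> assumption
  have e1 : a * b - productCoeff (u * v * d ^ 2) E = (a - interiorCoeff u v d E) * b +
      interiorCoeff u v d E * (b - interiorCoeff v u d E) := by
    rw [productCoeff_eq]
    ring
  rw [e1]
  refine (norm_add_le _ _).trans ?_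
  rw [norm_mul, norm_mul]
  calc _ ≤ Δ / (1 - e) ^ 2 * (13 / (1 - e)) + (13 / (1 - e)) * (Δ / (1 - e) ^ 2) := by gcongr
    _ = _ := by
      field_simp
      ring

/-- All three error terms are absorbed into a multiple of `E h η`, where `h` stands for `‖1 - g‖`
and `η` for `‖1 - u‖ + ‖1 - v‖ + ‖1 - d‖`. Keeping the factor `E h` matters: it is the size of `α`,
by which the remainder is later divided. -/
theorem exists_norm_sq_bound {V S e : ℝ} (hV : 0 ≤ V) (hS : 0 ≤ S) (he : e < 1) :
    ∃ C : ℝ, 0 < C ∧ ∀ E h η al : ℝ, 0 ≤ E → 0 ≤ h → 0 ≤ η → 0 ≤ al → E ≤ 1 → h ≤ 2 * η →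
      al ≤ E * h / (1 - e) →
      al ^ 2 * V ^ 2 + al * (2 * V * S * (2 * η / (1 - e))) + 26 / (1 - e) ^ 3 * (E * h * η) ≤
      C * (E * h * η) := by
  have h0 : 0 < 1 - e := by linarith
  refine ⟨2 / (1 - e) ^ 2 * V ^ 2 + 4 * V * S / (1 - e) ^ 2 + 26 / (1 - e) ^ 3, by positivity, ?_⟩
  intro E h η al hE hh hη hal hE1 hhη hle
  have h1 : al ^ 2 ≤ 2 / (1 - e) ^ 2 * (E * h * η) := by
    calc al ^ 2 ≤ (E * h / (1 - e)) ^ 2 := by gcongr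
      _ = E * (E * h * h) / (1 - e) ^ 2 := by
        rw [div_pow]
        ring
      _ ≤ 1 * (E * h * (2 * η)) / (1 - e) ^ 2 := by gcongr
      _ = _ := by ring
  have h2 : al * (2 * V * S * (2 * η / (1 - e))) ≤ 4 * V * S / (1 - e) ^ 2 * (E * h * η) := by
    calc _ ≤ E * h / (1 - e) * (2 * V * S * (2 * η / (1 - e))) := by gcongr
      _ = _ := by
        field_simp
        ring
  have h3 : al ^ 2 * V ^ 2 ≤ 2 / (1 - e) ^ 2 * (E * h * η) * V ^ 2 := by gcongr
  linarith

end Bounds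

section Norm

open scoped Matrix.Norms.L2Operator

/-- Up to terms of second order, the square of the normal form is `γ + α A` with the real symmetric
matrix `A = couplingMatrix`. -/
theorem exists_norm_normalMatrix_sq_sub_le (J : ℕ) {e : ℝ} (he : e < 1) :
    ∃ C : ℝ, 0 < C ∧ ∀ u v d E : ℂ, ‖u‖ ≤ 1 → ‖v‖ ≤ 1 → ‖d‖ ≤ 1 → ‖E‖ ^ 2 ≤ e →
      ‖normalMatrix J u v d E ^ 2 - productCoeff (u * v * d ^ 2) E • 1
        - couplingCoeff (u * v * d ^ 2) E • couplingMatrix (J - 1)‖ ≤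
      C * (‖E‖ * ‖1 - u * v * d ^ 2‖ * (‖1 - u‖ + ‖1 - v‖ + ‖1 - d‖)) := by
  obtain ⟨C, hC, hbound⟩ := exists_norm_sq_bound (norm_nonneg (shiftMatrix (J - 1)))
    (norm_nonneg (swapMatrix (J - 1))) he
  refine ⟨C, hC, fun u v d E hu hv hd hE => ?_⟩
  have h0 : 0 < 1 - e := by linarith
  have hE1 : ‖E‖ ≤ 1 := by
    by_contra! h
    nlinarith
  have hηsymm : ‖1 - v‖ + ‖1 - u‖ + ‖1 - d‖ = ‖1 - u‖ + ‖1 - v‖ + ‖1 - d‖ := by ring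
  have i2 := norm_interiorCoeff_sub_one_le hv hu hd hE he
  have b2 := norm_boundaryCoeff_sub_one_le hv hu hd hE he
  rw [hηsymm] at i2 b2
  refine (norm_shift_add_sq_sub_le (J - 1) (couplingCoeff (u * v * d ^ 2) E)
    (productCoeff (u * v * d ^ 2) E) _ _
    (φ := 2 * (‖1 - u‖ + ‖1 - v‖ + ‖1 - d‖) / (1 - e))
    (ψ := 26 / (1 - e) ^ 3 *
      (‖E‖ * ‖1 - u * v * d ^ 2‖ * (‖1 - u‖ + ‖1 - v‖ + ‖1 - d‖)))
    (by positivity) (by positivity) (fun i => ?_) (fun i => ?_) (fun i => ?_)).trans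
    (hbound _ _ _ _ (norm_nonneg _) (norm_nonneg _) (by positivity) (norm_nonneg _) hE1
      (norm_one_sub_prod_le hu hv hd) (norm_couplingCoeff_le (norm_prod_le_one hu hv hd) hE he))
  · split_ifs
    · exact norm_boundaryCoeff_sub_one_le hu hv hd hE he
    · exact norm_interiorCoeff_sub_one_le hu hv hd hE he
  · split_ifs
    · exact b2
    · exact i2
  · apply norm_mul_sub_productCoeff_le hu hv hd hE he <;> split_ifs <;> simp

end Norm

/-! ### Monotonicity of the low frequency constant in the frequency -/

/-! ### Real inequalities behind the monotonicity. -/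

section RealInequalities

theorem nonneg_of_deriv_nonneg {f f' : ℝ → ℝ} {b : ℝ} (hf : ∀ x, HasDerivAt f (f' x) x)
    (hf' : ∀ x, 0 ≤ x → x ≤ b → 0 ≤ f' x) (h0 : f 0 = 0) {x : ℝ} (hx : 0 ≤ x) (hxb : x ≤ b) :
    0 ≤ f x := by
  have hmono : MonotoneOn f (Set.Icc 0 b) := by
    refine monotoneOn_of_deriv_nonneg (convex_Icc 0 b)
      (fun y _ => (hf y).continuousAt.continuousWithinAt)
      (fun y _ => (hf y).differentiableAt.differentiableWithinAt) fun y hy => ?_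
    rw [interior_Icc] at hy
    rw [(hf y).deriv]
    exact hf' y hy.1.le hy.2.le
  have := hmono ⟨le_rfl, hx.trans hxb⟩ ⟨hx, hxb⟩ hx
  rwa [h0] at this

theorem cosh_ge_one_add {x : ℝ} (hx : 0 ≤ x) : 1 + x ^ 2 / 2 ≤ Real.cosh x := by
  have := nonneg_of_deriv_nonneg (f := fun x => Real.cosh x - 1 - x ^ 2 / 2)
    (f' := fun x => Real.sinh x - x) (b := x) (fun y => by
      have := ((Real.hasDerivAt_cosh y).sub_const 1).sub ((hasDerivAt_pow 2 y).div_const 2)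
      exact this.congr_deriv (by simp)) (fun y hy _ => sub_nonneg.2 (Real.self_le_sinh_iff.2 hy)) (by simp) hx le_rfl
  linarith

theorem sinh_ge_add_cube {x : ℝ} (hx : 0 ≤ x) : x + x ^ 3 / 6 ≤ Real.sinh x := by
  have := nonneg_of_deriv_nonneg (f := fun x => Real.sinh x - x - x ^ 3 / 6)
    (f' := fun x => Real.cosh x - (1 + x ^ 2 / 2)) (b := x) (fun y => by
      have := ((Real.hasDerivAt_sinh y).sub (hasDerivAt_id y)).sub ((hasDerivAt_pow 3 y).div_const 6)
      exact this.congr_deriv (by simp; ring)) (fun y hy _ => sub_nonneg.2 (cosh_ge_one_add hy)) (by simp) hx le_rfl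
  linarith

theorem sinh_le_mul_cosh {x : ℝ} (hx : 0 ≤ x) : Real.sinh x ≤ x * Real.cosh x := by
  have := nonneg_of_deriv_nonneg (f := fun x => x * Real.cosh x - Real.sinh x)
    (f' := fun x => x * Real.sinh x) (b := x) (fun y => by
      have := ((hasDerivAt_id y).mul (Real.hasDerivAt_cosh y)).sub (Real.hasDerivAt_sinh y)
      exact this.congr_deriv (by simp)) (fun y hy _ => mul_nonneg hy (Real.sinh_nonneg_iff.2 hy)) (by simp) hx le_rfl
  linarith

theorem two_mul_cosh_sub_one_le {x : ℝ} (hx : 0 ≤ x) :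
    2 * (Real.cosh x - 1) ≤ x * Real.sinh x := by
  have := nonneg_of_deriv_nonneg (f := fun x => x * Real.sinh x - 2 * (Real.cosh x - 1))
    (f' := fun x => x * Real.cosh x - Real.sinh x) (b := x) (fun y => by
      have := ((hasDerivAt_id y).mul (Real.hasDerivAt_sinh y)).sub
        (((Real.hasDerivAt_cosh y).sub_const 1).const_mul 2)
      exact this.congr_deriv (by simp; ring)) (fun y hy _ => sub_nonneg.2 (sinh_le_mul_cosh hy)) (by simp) hx le_rfl
  linarith

/-- The difference of the two sides and its first two derivatives vanish at 0, and the third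
derivative is nonnegative because `sinh x ≤ x cosh x`. The three levels are integrated back in turn.
-/
theorem cosh_sub_one_mul_le {x : ℝ} (hx : 0 ≤ x) :
    (Real.cosh x - 1) * (2 - x ^ 2 / 6) ≤ x ^ 2 := by
  have h3 : ∀ y : ℝ, 0 ≤ y →
      0 ≤ 5 / 3 - Real.cosh y * (5 / 3) + Real.cosh y * y ^ 2 / 6 + 2 / 3 * (y * Real.sinh y) :=
    fun y hy => nonneg_of_deriv_nonneg
      (f := fun y => 5 / 3 - Real.cosh y * (5 / 3) + Real.cosh y * y ^ 2 / 6 +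
        2 / 3 * (y * Real.sinh y))
      (f' := fun y => y * Real.cosh y - Real.sinh y + Real.sinh y * y ^ 2 / 6) (b := y)
      (fun y => by
        have := ((((Real.hasDerivAt_cosh y).mul_const (5 / 3)).const_sub (5 / 3)).add
          (((Real.hasDerivAt_cosh y).mul (hasDerivAt_pow 2 y)).div_const 6)).add
          (((hasDerivAt_id y).mul (Real.hasDerivAt_sinh y)).const_mul (2 / 3))
        exact this.congr_deriv (by simp; ring))
      (fun z hz _ => by
        have h1 := sinh_le_mul_cosh hz
        have h2 := Real.sinh_nonneg_iff.2 hz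
        have : 0 ≤ Real.sinh z * z ^ 2 / 6 := by positivity
        linarith) (by simp) hy le_rfl
  have h2 : ∀ y : ℝ, 0 ≤ y →
      0 ≤ 2 * y - Real.sinh y * (2 - y ^ 2 / 6) + (Real.cosh y - 1) * (y / 3) :=
    fun y hy => nonneg_of_deriv_nonneg
      (f := fun y => 2 * y - Real.sinh y * (2 - y ^ 2 / 6) + (Real.cosh y - 1) * (y / 3))
      (f' := fun y => 5 / 3 - Real.cosh y * (5 / 3) + Real.cosh y * y ^ 2 / 6 +
        2 / 3 * (y * Real.sinh y)) (b := y)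
      (fun y => by
        have := (((hasDerivAt_id y).const_mul 2).sub ((Real.hasDerivAt_sinh y).mul
          (((hasDerivAt_pow 2 y).div_const 6).const_sub 2))).add
          (((Real.hasDerivAt_cosh y).sub_const 1).mul ((hasDerivAt_id y).div_const 3))
        exact this.congr_deriv (by simp; ring))
      (fun z hz _ => h3 z hz) (by simp) hy le_rfl
  have := nonneg_of_deriv_nonneg (f := fun x => x ^ 2 - (Real.cosh x - 1) * (2 - x ^ 2 / 6))
    (f' := fun y => 2 * y - Real.sinh y * (2 - y ^ 2 / 6) + (Real.cosh y - 1) * (y / 3)) (b := x)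
    (fun y => by
      have := (hasDerivAt_pow 2 y).sub (((Real.hasDerivAt_cosh y).sub_const 1).mul
          (((hasDerivAt_pow 2 y).div_const 6).const_sub 2))
      exact this.congr_deriv (by simp; ring)) (fun z hz _ => h2 z hz) (by simp) hx le_rfl
  linarith

theorem cos_le_quartic {y : ℝ} (hy : 0 ≤ y) : Real.cos y ≤ 1 - y ^ 2 / 2 + y ^ 4 / 24 := by
  have := nonneg_of_deriv_nonneg (f := fun y => 1 - y ^ 2 / 2 + y ^ 4 / 24 - Real.cos y)
    (f' := fun y => Real.sin y - (y - y ^ 3 / 6)) (b := y) (fun y => by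
      have := ((((hasDerivAt_pow 2 y).div_const 2).const_sub 1).add
        ((hasDerivAt_pow 4 y).div_const 24)).sub (Real.hasDerivAt_cos y)
      exact this.congr_deriv (by simp; ring)) (fun y hy _ => sub_nonneg.2 (Real.sin_ge_sub_cube hy)) (by simp) hy le_rfl
  linarith

theorem mul_sin_le {y : ℝ} (hy : 0 ≤ y) (hy' : y ≤ Real.pi) :
    y * Real.sin y ≤ 2 * (1 - Real.cos y) := by
  have h1 : ∀ y : ℝ, 0 ≤ y → y ≤ Real.pi → 0 ≤ Real.sin y - y * Real.cos y := fun y hy hy' =>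
    nonneg_of_deriv_nonneg (f := fun y => Real.sin y - y * Real.cos y)
      (f' := fun y => y * Real.sin y) (b := Real.pi) (fun y => by
        have := (Real.hasDerivAt_sin y).sub ((hasDerivAt_id y).mul (Real.hasDerivAt_cos y))
        exact this.congr_deriv (by simp)) (fun y hy hy' => mul_nonneg hy (Real.sin_nonneg_of_nonneg_of_le_pi hy hy'))
        (by simp) hy hy'
  have := nonneg_of_deriv_nonneg (f := fun y => 2 * (1 - Real.cos y) - y * Real.sin y)
    (f' := fun y => Real.sin y - y * Real.cos y) (b := Real.pi) (fun y => by
      have := (((Real.hasDerivAt_cos y).const_sub 1).const_mul 2).sub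
        ((hasDerivAt_id y).mul (Real.hasDerivAt_sin y))
      exact this.congr_deriv (by simp; ring)) h1 (by simp) hy hy'
  linarith

theorem mul_sinh_ge {x : ℝ} (hx : 0 ≤ x) : x ^ 2 + x ^ 4 / 6 ≤ x * Real.sinh x := by
  have := mul_le_mul_of_nonneg_left (sinh_ge_add_cube hx) hx
  linarith [this, show x * (x + x ^ 3 / 6) = x ^ 2 + x ^ 4 / 6 by ring]

theorem mul_sin_le_sq {y : ℝ} (hy : 0 ≤ y) : y * Real.sin y ≤ y ^ 2 := by
  have := mul_le_mul_of_nonneg_left (Real.sin_le hy) hy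
  linarith [this, pow_two y]

/-- From `x sinh x ≥ x² + x⁴/6`, `y sin y ≥ y² - y⁴/6` and `y ≤ x` one gets `x sinh x + y sin y ≥ x²
+ y²`. The expression is then at least `(x² + y²)(1 + cosh x)(1 + cos y)`. -/
theorem tanh_type_nonneg {x y : ℝ} (hx : 0 ≤ x) (hy : 0 ≤ y) (hxy : y ≤ x) :
    0 ≤ (x * Real.sinh x + y * Real.sin y) * (Real.cosh x + Real.cos y) +
      (x ^ 2 + y ^ 2) * (1 + Real.cosh x * Real.cos y) := by
  have h1 := mul_sinh_ge hx
  have h2 := mul_le_mul_of_nonneg_left (Real.sin_ge_sub_cube hy) hy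
  have h3 : y ^ 4 ≤ x ^ 4 := by gcongr
  have hC := Real.one_le_cosh x
  have hq := Real.neg_one_le_cos y
  have h4 : 0 ≤ Real.cosh x + Real.cos y := by linarith
  have h5 : 0 ≤ (1 + Real.cosh x) * (1 + Real.cos y) :=
    mul_nonneg (by linarith) (by linarith)
  have h6 : x ^ 2 + y ^ 2 ≤ x * Real.sinh x + y * Real.sin y := by
    have : y * (y - y ^ 3 / 6) = y ^ 2 - y ^ 4 / 6 := by ring
    linarith
  have h7 := mul_le_mul_of_nonneg_right h6 h4
  have h8 : 0 ≤ (x ^ 2 + y ^ 2) * ((1 + Real.cosh x) * (1 + Real.cos y)) :=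
    mul_nonneg (by positivity) h5
  linarith [show (x ^ 2 + y ^ 2) * ((1 + Real.cosh x) * (1 + Real.cos y)) =
    (x ^ 2 + y ^ 2) * (Real.cosh x + Real.cos y) +
      (x ^ 2 + y ^ 2) * (1 + Real.cosh x * Real.cos y) by ring]

theorem coth_type_polynomial {a b : ℝ} (ha : a ≤ 6) (hb : 0 ≤ b) (hab : b ≤ a) :
    0 ≤ a ^ 2 / 6 - b + b / 4 * (1 - b / 12) * (4 - a / 3 + 2 * (a + b)) := by
  have h1 : 0 ≤ b * (a - b) := mul_nonneg hb (by linarith)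
  have h2 : 0 ≤ b * b * (6 - a) := by
    have := mul_nonneg hb hb
    exact mul_nonneg this (by linarith)
  have h3 : 0 ≤ b * b * (6 - b) := by
    have := mul_nonneg hb hb
    exact mul_nonneg this (by linarith)
  have h4 : b ^ 2 ≤ a ^ 2 := by nlinarith
  nlinarith

/-- In terms of `S = cosh x - 1` and `T = 1 - cos y` the expression is `S(P - Q - r²) + T(P - Q +
r²) + S T r²`, with `P = x sinh x`, `Q = y sin y`, `r² = x² + y²`. Only the first bracket can be
negative, and for small `x` the other terms have to compensate for it. -/
theorem coth_type_nonneg {x y : ℝ} (hx : 0 ≤ x) (hy : 0 ≤ y) (hxy : y ≤ x) :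
    0 ≤ (x * Real.sinh x - y * Real.sin y) * (Real.cosh x - Real.cos y) +
      (x ^ 2 + y ^ 2) * (1 - Real.cosh x * Real.cos y) := by
  have h1 := mul_sinh_ge hx
  have h2 := mul_sin_le_sq hy
  have hyx2 : y ^ 2 ≤ x ^ 2 := by gcongr
  have hy2 : 0 ≤ y ^ 2 := sq_nonneg y
  set S := Real.cosh x - 1 with hS
  set T := 1 - Real.cos y with hT
  have hS0 : 0 ≤ S := sub_nonneg.2 (Real.one_le_cosh x)
  have hT0 : 0 ≤ T := sub_nonneg.2 (Real.cos_le_one y)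
  have hT2 : T ≤ 2 := by linarith [Real.neg_one_le_cos y]
  have eC : Real.cosh x = 1 + S := by rw [hS]; ring
  have eq : Real.cos y = 1 - T := by rw [hT]; ring
  have key : (x * Real.sinh x - y * Real.sin y) * (Real.cosh x - Real.cos y) +
      (x ^ 2 + y ^ 2) * (1 - Real.cosh x * Real.cos y) =
      S * (x * Real.sinh x - y * Real.sin y - (x ^ 2 + y ^ 2)) +
      T * (x * Real.sinh x - y * Real.sin y + (x ^ 2 + y ^ 2)) + S * T * (x ^ 2 + y ^ 2) := by
    rw [eC, eq]
    ring
  rw [key]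
  have hST : 0 ≤ S * T * (x ^ 2 + y ^ 2) := by positivity
  have hTA : 0 ≤ T * (x * Real.sinh x - y * Real.sin y + (x ^ 2 + y ^ 2)) :=
    mul_nonneg hT0 (by nlinarith [sq_nonneg (x ^ 2)])
  -- Since `P ≥ x² + x⁴/6` and `Q ≤ y² ≤ x²`, the first bracket is at least `x²(x²/6 - 2)`, which is
  -- nonnegative beyond this threshold.
  rcases le_or_gt 12 (x ^ 2) with h12 | h12
  · have : 0 ≤ S * (x * Real.sinh x - y * Real.sin y - (x ^ 2 + y ^ 2)) :=
      mul_nonneg hS0 (by nlinarith)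
    linarith
  -- The cross terms `T P - S Q` are nonnegative: `Q ≤ 2T` on `[0, π]` and `2S ≤ P`. For `y > π` the
  -- bound `x² < 12` gives `y < 4`, where the sine is not positive.
  have hL : S * (y * Real.sin y) ≤ T * (x * Real.sinh x) := by
    rcases le_or_gt y Real.pi with hp | hp
    · have a1 := mul_le_mul_of_nonneg_left (mul_sin_le hy hp) hS0
      have a2 := mul_le_mul_of_nonneg_left (two_mul_cosh_sub_one_le hx) hT0
      rw [← hT] at a1
      rw [← hS] at a2
      linarith
    · have h4 : y < 4 := by nlinarith
      have a1 : Real.sin y ≤ 0 := by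
        have := Real.sin_nonneg_of_nonneg_of_le_pi (x := y - Real.pi) (by linarith)
          (by linarith [Real.pi_gt_three])
        rw [Real.sin_sub_pi] at this
        linarith
      have a2 : S * (y * Real.sin y) ≤ 0 :=
        mul_nonpos_of_nonneg_of_nonpos hS0 (mul_nonpos_of_nonneg_of_nonpos hy a1)
      have a3 : 0 ≤ T * (x * Real.sinh x) :=
        mul_nonneg hT0 (by nlinarith [sq_nonneg (x ^ 2)])
      linarith
  have hTy : 0 ≤ T * (y ^ 2 - y * Real.sin y) := mul_nonneg hT0 (by linarith)
  have hmain : 0 ≤ S * (x * Real.sinh x - (x ^ 2 + y ^ 2)) + T * x ^ 2 + S * T * (x ^ 2 + y ^ 2) := by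
    rcases le_or_gt 6 (x ^ 2) with h6 | h6
    · have : 0 ≤ S * (x * Real.sinh x - (x ^ 2 + y ^ 2)) := mul_nonneg hS0 (by nlinarith)
      have : 0 ≤ T * x ^ 2 := by positivity
      linarith
    -- Replacing `x²` by `S (2 - x²/6)` in `T x²` lets `S` be factored out. The quartic bound for
    -- the cosine then leaves a polynomial inequality in `x²` and `y²`.
    · have b1 : S * (2 - x ^ 2 / 6) ≤ x ^ 2 := cosh_sub_one_mul_le hx
      have b2 : y ^ 2 / 2 * (1 - y ^ 2 / 12) ≤ T := by
        have := cos_le_quartic hy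
        have e : y ^ 2 / 2 * (1 - y ^ 2 / 12) = y ^ 2 / 2 - y ^ 4 / 24 := by ring
        rw [hT, e]
        linarith
      have b3 := mul_le_mul_of_nonneg_left b1 hT0
      have b4 := coth_type_polynomial h6.le hy2 hyx2
      have b5 : 0 ≤ x ^ 4 / 6 - y ^ 2 + T * (2 - x ^ 2 / 6 + (x ^ 2 + y ^ 2)) := by
        have b6 : y ^ 2 / 2 * (1 - y ^ 2 / 12) * (2 - x ^ 2 / 6 + (x ^ 2 + y ^ 2)) ≤
            T * (2 - x ^ 2 / 6 + (x ^ 2 + y ^ 2)) :=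
          mul_le_mul_of_nonneg_right b2 (by nlinarith)
        nlinarith
      have b7 := mul_nonneg hS0 b5
      have b8 := mul_le_mul_of_nonneg_left h1 hS0
      linarith
  linarith

end RealInequalities

/-! ### The symbol as a function of the frequency. -/

section Symbol

variable {η ε k : ℝ}

theorem re_sq_sub_im_sq_symbol (η ε k : ℝ) :
    (symbol η ε k).re ^ 2 - (symbol η ε k).im ^ 2 = k ^ 2 + η := by
  have := congrArg Complex.re (sq_symbol η ε k)
  simp only [pow_two, Complex.mul_re, Complex.sub_re, Complex.add_re, Complex.ofReal_re,
    Complex.ofReal_im, Complex.I_re, Complex.I_im] at this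
  linarith

theorem two_mul_re_mul_im_symbol (η ε k : ℝ) :
    2 * ((symbol η ε k).re * (symbol η ε k).im) = -ε := by
  have := congrArg Complex.im (sq_symbol η ε k)
  simp only [pow_two, Complex.mul_im, Complex.sub_im, Complex.add_im, Complex.ofReal_re,
    Complex.ofReal_im, Complex.I_re, Complex.I_im] at this
  linarith

theorem abs_im_symbol_lt (ε : ℝ) (hη : 0 ≤ η) (hk : 0 < k) :
    |(symbol η ε k).im| < (symbol η ε k).re := by
  apply abs_lt_of_sq_lt_sq _ (re_symbol_pos ε hη hk).le
  nlinarith [re_sq_sub_im_sq_symbol η ε k]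

theorem le_re_symbol (ε : ℝ) (hη : 0 ≤ η) (hk : 0 < k) : k ≤ (symbol η ε k).re := by
  have := re_symbol_pos ε hη hk
  nlinarith [re_sq_sub_im_sq_symbol η ε k, sq_nonneg (symbol η ε k).im]

theorem norm_symbol_le (ε : ℝ) (hη : 0 ≤ η) (hk : 0 < k) :
    ‖symbol η ε k‖ ≤ 2 * (symbol η ε k).re := by
  have := Complex.norm_le_abs_re_add_abs_im (symbol η ε k)
  rw [abs_of_pos (re_symbol_pos ε hη hk)] at this
  linarith [abs_im_symbol_lt ε hη hk]

theorem abs_im_symbol_eq (hη : 0 ≤ η) (hε : 0 ≤ ε) (hk : 0 < k) :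
    |(symbol η ε k).im| = ε / (2 * (symbol η ε k).re) := by
  have h0 := re_symbol_pos ε hη hk
  have h1 : |(symbol η ε k).re * (symbol η ε k).im| = ε / 2 := by
    rw [← abs_of_nonneg (div_nonneg hε two_pos.le), ← abs_neg (ε / 2)]
    congr 1
    linarith [two_mul_re_mul_im_symbol η ε k]
  rw [abs_mul, abs_of_pos h0] at h1
  rw [eq_div_iff (by positivity)]
  linarith

/-- Every sufficiently large number is the real part of `λ(k)` for some admissible `k`. -/
theorem exists_re_symbol_eq (hη : 0 ≤ η) {kmin : ℝ} (hkmin : 0 < kmin) {x : ℝ}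
    (hx : kmin ≤ x) (hx2 : η + ε ^ 2 / 4 + kmin ^ 2 ≤ x) (hx1 : 1 ≤ x) :
    ∃ k, kmin ≤ k ∧ k ≤ x ∧ (symbol η ε k).re = x := by
  have hx0 : 0 < x := by linarith
  -- The equation to solve is `(x - iy)² = k² + η - iε`. Its imaginary part fixes `y`, and its real
  -- part then gives `k² = x² - y² - η`.
  set y := ε / (2 * x) with hy
  have hyx : 2 * x * y = ε := by rw [hy]; field_simp
  have hy2 : y ^ 2 ≤ ε ^ 2 / 4 := by
    rw [← hyx]
    nlinarith [sq_nonneg y, sq_nonneg (y * x), mul_nonneg (sq_nonneg y) (by nlinarith : 0 ≤ x ^ 2 - 1)]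
  have hk2 : kmin ^ 2 ≤ x ^ 2 - y ^ 2 - η := by nlinarith
  refine ⟨Real.sqrt (x ^ 2 - y ^ 2 - η), Real.le_sqrt_of_sq_le hk2, ?_, ?_⟩
  · rw [Real.sqrt_le_left hx0.le]
    nlinarith [sq_nonneg y]
  · set k := Real.sqrt (x ^ 2 - y ^ 2 - η)
    have hk : k ^ 2 = x ^ 2 - y ^ 2 - η := Real.sq_sqrt ((sq_nonneg _).trans hk2)
    have hk0 : 0 < k := hkmin.trans_le (Real.le_sqrt_of_sq_le hk2)
    have h1 := re_sq_sub_im_sq_symbol η ε k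
    have h2 := two_mul_re_mul_im_symbol η ε k
    have h3 := re_symbol_pos ε hη hk0
    set a := (symbol η ε k).re
    set b := (symbol η ε k).im
    -- The squared real part solves a quadratic equation with roots `x²` and `-y²`, and positivity
    -- excludes the second.
    have h4 : (a ^ 2 - x ^ 2) * (a ^ 2 + y ^ 2) = 0 := by
      have e1 : a ^ 2 - b ^ 2 = x ^ 2 - y ^ 2 := by rw [h1, hk]; ring
      have e2 : (a * b) ^ 2 = (x * y) ^ 2 := by
        have : a * b = -(x * y) := by linarith
        rw [this, neg_sq]
      linear_combination a ^ 2 * e1 + e2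
    have h5 : a ^ 2 - x ^ 2 = 0 := by
      rcases mul_eq_zero.1 h4 with h | h
      · exact h
      · nlinarith [sq_nonneg y, sq_pos_of_pos h3]
    nlinarith

theorem hasDerivAt_symbol (ε : ℝ) (hη : 0 ≤ η) (hk : 0 < k) :
    HasDerivAt (symbol η ε) (k / symbol η ε k) k := by
  set w := (k : ℂ) ^ 2 + (η : ℂ) - Complex.I * (ε : ℂ) with hw
  have hre : w.re = k ^ 2 + η := by simp [hw, pow_two]
  have hw0 : w ∈ Complex.slitPlane := by
    left
    rw [hre]
    positivity
  have h1 : HasDerivAt (fun k : ℝ => (k : ℂ) ^ 2 + (η : ℂ) - Complex.I * (ε : ℂ))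
      (2 * (k : ℂ)) k := by
    have := (((Complex.ofRealCLM.hasDerivAt (x := k)).pow 2).add_const (η : ℂ)).sub_const
      (Complex.I * (ε : ℂ))
    exact this.congr_deriv (by simp)
  have h2 : HasDerivAt (fun z : ℂ => z ^ (2⁻¹ : ℂ)) (2⁻¹ * w ^ ((2⁻¹ : ℂ) - 1) * 1) w :=
    (hasDerivAt_id w).cpow_const hw0
  have h3 := HasDerivAt.scomp k h2 h1
  have hs : symbol η ε k = w ^ (2⁻¹ : ℂ) := rfl
  have hne : w ≠ 0 := Complex.slitPlane_ne_zero hw0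
  have hsne : w ^ (2⁻¹ : ℂ) ≠ 0 := by
    rw [← hs]
    intro h
    have := re_symbol_pos ε hη hk
    rw [h, Complex.zero_re] at this
    exact lt_irrefl _ this
  refine HasDerivAt.congr_deriv h3 ?_
  rw [hs, Complex.cpow_sub _ _ hne, Complex.cpow_one, smul_eq_mul, mul_one]
  have hsq : w ^ (2⁻¹ : ℂ) * w ^ (2⁻¹ : ℂ) = w := by
    rw [← pow_two, ← hs, sq_symbol]
  rw [eq_div_iff hsne]
  generalize w ^ (2⁻¹ : ℂ) = r at *
  field_simp
  linear_combination (k : ℂ) * hsq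

end Symbol

/-! ### Positivity and monotonicity of the low frequency constant. -/

section LowFrequency

theorem re_sinh (z : ℂ) : (Complex.sinh z).re = Real.sinh z.re * Real.cos z.im := by
  conv_lhs => rw [← Complex.re_add_im z]
  rw [Complex.sinh_add, Complex.sinh_mul_I, Complex.cosh_mul_I, ← Complex.ofReal_sinh,
    ← Complex.ofReal_cosh, ← Complex.ofReal_sin, ← Complex.ofReal_cos]
  simp only [Complex.add_re, Complex.mul_re, Complex.mul_im, Complex.ofReal_re,
    Complex.ofReal_im, Complex.I_re, Complex.I_im]
  ring

theorem im_sinh (z : ℂ) : (Complex.sinh z).im = Real.cosh z.re * Real.sin z.im := by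
  conv_lhs => rw [← Complex.re_add_im z]
  rw [Complex.sinh_add, Complex.sinh_mul_I, Complex.cosh_mul_I, ← Complex.ofReal_sinh,
    ← Complex.ofReal_cosh, ← Complex.ofReal_sin, ← Complex.ofReal_cos]
  simp only [Complex.add_im, Complex.mul_re, Complex.mul_im, Complex.ofReal_re,
    Complex.ofReal_im, Complex.I_re, Complex.I_im]
  ring

theorem re_cosh (z : ℂ) : (Complex.cosh z).re = Real.cosh z.re * Real.cos z.im := by
  conv_lhs => rw [← Complex.re_add_im z]
  rw [Complex.cosh_add, Complex.sinh_mul_I, Complex.cosh_mul_I, ← Complex.ofReal_sinh,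
    ← Complex.ofReal_cosh, ← Complex.ofReal_sin, ← Complex.ofReal_cos]
  simp only [Complex.add_re, Complex.mul_re, Complex.mul_im, Complex.ofReal_re,
    Complex.ofReal_im, Complex.I_re, Complex.I_im]
  ring

theorem im_cosh (z : ℂ) : (Complex.cosh z).im = Real.sinh z.re * Real.sin z.im := by
  conv_lhs => rw [← Complex.re_add_im z]
  rw [Complex.cosh_add, Complex.sinh_mul_I, Complex.cosh_mul_I, ← Complex.ofReal_sinh,
    ← Complex.ofReal_cosh, ← Complex.ofReal_sin, ← Complex.ofReal_cos]
  simp only [Complex.add_im, Complex.mul_re, Complex.mul_im, Complex.ofReal_re,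
    Complex.ofReal_im, Complex.I_re, Complex.I_im]
  ring

theorem sinh_ne_zero_of_re_pos {z : ℂ} (hz : 0 < z.re) : Complex.sinh z ≠ 0 := by
  intro h
  have h1 := re_sinh z
  have h2 := im_sinh z
  rw [h, Complex.zero_re] at h1
  rw [h, Complex.zero_im] at h2
  have hs := Real.sinh_pos_iff.2 hz
  have hc := Real.cosh_pos z.re
  have h3 : Real.cos z.im = 0 := by
    rcases mul_eq_zero.1 h1.symm with h | h
    · exact absurd h hs.ne'
    · exact h
  have h4 : Real.sin z.im = 0 := by
    rcases mul_eq_zero.1 h2.symm with h | h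
    · exact absurd h hc.ne'
    · exact h
  have := Real.sin_sq_add_cos_sq z.im
  rw [h3, h4] at this
  norm_num at this

/-- Numerator and denominator share the factor `2 e^{sL}`. In this form `c = 1` gives `Re(s
tanh(sL/2))` and `c = -1` gives `Re(s coth(sL/2))`. -/
theorem lowFreqConst_eq {s : ℂ} {L : ℝ} (c : ℝ) (hz : 0 < (s * L).re) :
    lowFreqConst s L c = (s * (Complex.cosh (s * L) - c) / Complex.sinh (s * L)).re := by
  have hsh := sinh_ne_zero_of_re_pos hz
  have e1 : Complex.exp (2 * s * L) = Complex.exp (s * L) ^ 2 := by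
    rw [← Complex.exp_nat_mul]
    ring_nf
  have e2 : Complex.exp (s * L) ^ 2 - 1 = 2 * Complex.exp (s * L) * Complex.sinh (s * L) := by
    rw [Complex.sinh, Complex.exp_neg]
    field_simp [Complex.exp_ne_zero]
  have e3 : Complex.exp (s * L) ^ 2 + 1 = 2 * Complex.exp (s * L) * Complex.cosh (s * L) := by
    rw [Complex.cosh, Complex.exp_neg]
    field_simp [Complex.exp_ne_zero]
  rw [lowFreqConst, e1, e2, e3]
  congr 1
  have := Complex.exp_ne_zero (s * L)
  field_simp

/-- For `|c| ≤ 1` this is a convex combination, so positivity and monotonicity need only be proved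
at `c = ±1`, where the expressions factor. -/
theorem lowFreqConst_affine (s : ℂ) (L c : ℝ) :
    lowFreqConst s L c =
      (1 + c) / 2 * lowFreqConst s L 1 + (1 - c) / 2 * lowFreqConst s L (-1) := by
  have e : ∀ c : ℝ, lowFreqConst s L c =
      (s * (Complex.exp (2 * s * L) + 1) / (Complex.exp (2 * s * L) - 1)).re -
        c * (2 * s * Complex.exp (s * L) / (Complex.exp (2 * s * L) - 1)).re := fun c => by
    rw [lowFreqConst, ← Complex.re_ofReal_mul, ← Complex.sub_re]
    congr 1
    ring
  rw [e c, e 1, e (-1)]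
  ring

theorem abs_mul_sin_abs (y : ℝ) : |y| * Real.sin |y| = y * Real.sin y := by
  rcases abs_choice y with h | h <;> rw [h]
  rw [Real.sin_neg]
  ring

/-- With `s = a + ib`, the numerator factors as `(cosh aL - σ cos bL)(a sinh aL - σ b sin bL)`
because `σ² = 1`. The second factor is positive since `|b sin bL| ≤ b² L ≤ a² L < a sinh aL`. -/
theorem lowFreqConst_pos_of_sign {s : ℂ} {L σ : ℝ} (hL : 0 < L) (hs : 0 < s.re)
    (hs' : |s.im| < s.re) (hσ : σ = 1 ∨ σ = -1) : 0 < lowFreqConst s L σ := by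
  have hzre : (s * L).re = s.re * L := by simp
  have hzim : (s * L).im = s.im * L := by simp
  have hz : 0 < (s * L).re := by rw [hzre]; positivity
  rw [lowFreqConst_eq σ hz, Complex.div_re, ← add_div]
  refine div_pos ?_ (Complex.normSq_pos.2 (sinh_ne_zero_of_re_pos hz))
  have key : (s * (Complex.cosh (s * L) - σ)).re * (Complex.sinh (s * L)).re +
      (s * (Complex.cosh (s * L) - σ)).im * (Complex.sinh (s * L)).im =
      (Real.cosh (s.re * L) - σ * Real.cos (s.im * L)) *
        (s.re * Real.sinh (s.re * L) - σ * (s.im * Real.sin (s.im * L))) := by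
    have hσ2 : σ ^ 2 = 1 := by rcases hσ with rfl | rfl <;> norm_num
    simp only [Complex.mul_re, Complex.mul_im, Complex.sub_re, Complex.sub_im, re_sinh, im_sinh,
      re_cosh, im_cosh, hzre, hzim, Complex.ofReal_re, Complex.ofReal_im, sub_zero]
    have h1 := Real.cosh_sq (s.re * L)
    have h2 := Real.sin_sq_add_cos_sq (s.im * L)
    linear_combination
      s.im * Real.cos (s.im * L) * Real.sin (s.im * L) * h1 +
      s.re * Real.cosh (s.re * L) * Real.sinh (s.re * L) * h2 -
      s.im * Real.cos (s.im * L) * Real.sin (s.im * L) * hσ2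
  rw [key]
  have hx : 0 < s.re * L := by positivity
  have hC : 1 < Real.cosh (s.re * L) := Real.one_lt_cosh.2 hx.ne'
  have hq := Real.abs_cos_le_one (s.im * L)
  have hsh := mul_lt_mul_of_pos_left (Real.self_lt_sinh_iff.2 hx) hs
  have hσ1 : |σ| = 1 := by rcases hσ with rfl | rfl <;> norm_num
  have hsin : |σ * (s.im * Real.sin (s.im * L))| ≤ s.im ^ 2 * L := by
    rw [abs_mul, hσ1, one_mul, abs_mul]
    have h1 : |Real.sin (s.im * L)| ≤ |s.im * L| := Real.abs_sin_le_abs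
    calc _ ≤ |s.im| * |s.im * L| := by gcongr
      _ = s.im ^ 2 * L := by rw [abs_mul, abs_of_pos hL, ← mul_assoc, abs_mul_abs_self, pow_two]
  have hcos : |σ * Real.cos (s.im * L)| ≤ 1 := by rw [abs_mul, hσ1, one_mul]; exact hq
  have him : s.im ^ 2 ≤ s.re ^ 2 := by
    rw [← sq_abs s.im]
    exact pow_le_pow_left₀ (abs_nonneg _) hs'.le 2
  refine mul_pos (by linarith [(abs_le.1 hcos).2]) ?_
  have := (abs_le.1 hsin).2
  nlinarith

/-- Up to the positive factor `kL`, this is the derivative in `k` of the low frequency constant at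
`c = σ`, with `z = λ(k) L`. The numerator of the real part is exactly the expression in
`tanh_type_nonneg` or `coth_type_nonneg`. -/
theorem re_logDeriv_nonneg {z : ℂ} (hz : 0 < z.re) (hz' : |z.im| ≤ z.re) {σ : ℝ}
    (hσ : σ = 1 ∨ σ = -1) :
    0 ≤ ((Complex.sinh z + σ * z) / (z * (Complex.cosh z + σ))).re := by
  rw [Complex.div_re, ← add_div]
  refine div_nonneg ?_ (Complex.normSq_nonneg _)
  have hσ2 : σ ^ 2 = 1 := by rcases hσ with rfl | rfl <;> norm_num
  have key : (Complex.sinh z + σ * z).re * (z * (Complex.cosh z + σ)).re +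
      (Complex.sinh z + σ * z).im * (z * (Complex.cosh z + σ)).im =
      (z.re * Real.sinh z.re + σ * (z.im * Real.sin z.im)) *
        (Real.cosh z.re + σ * Real.cos z.im) +
        (z.re ^ 2 + z.im ^ 2) * (1 + σ * (Real.cosh z.re * Real.cos z.im)) := by
    simp only [Complex.mul_re, Complex.mul_im, Complex.add_re, Complex.add_im, re_sinh, im_sinh,
      re_cosh, im_cosh, Complex.ofReal_re, Complex.ofReal_im, zero_mul, sub_zero, add_zero]
    have h1 := Real.cosh_sq z.re
    have h2 := Real.sin_sq_add_cos_sq z.im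
    linear_combination
      z.im * Real.cos z.im * Real.sin z.im * h1 + z.re * Real.cosh z.re * Real.sinh z.re * h2 +
      (z.re ^ 2 + z.im ^ 2 - z.im * Real.cos z.im * Real.sin z.im) * hσ2
  rw [key, ← abs_mul_sin_abs z.im, ← Real.cos_abs z.im, ← sq_abs z.im]
  rcases hσ with rfl | rfl
  · have := tanh_type_nonneg hz.le (abs_nonneg z.im) hz'
    linarith
  · have := coth_type_nonneg hz.le (abs_nonneg z.im) hz'
    linarith

theorem monotoneOn_lowFreqConst_symbol_of_sign {η : ℝ} (ε : ℝ) {L σ : ℝ} (hη : 0 ≤ η) (hL : 0 < L)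
    (hσ : σ = 1 ∨ σ = -1) :
    MonotoneOn (fun k => lowFreqConst (symbol η ε k) L σ) (Set.Ioi 0) := by
  have hσ2 : (σ : ℂ) ^ 2 = 1 := by rcases hσ with rfl | rfl <;> norm_num
  have hre : ∀ k : ℝ, 0 < k → 0 < (symbol η ε k * L).re := fun k hk => by
    have := re_symbol_pos ε hη hk
    simp only [Complex.mul_re, Complex.ofReal_re, Complex.ofReal_im, mul_zero, sub_zero]
    positivity
  have hderiv : ∀ k : ℝ, 0 < k → HasDerivAt (fun k => lowFreqConst (symbol η ε k) L σ)
      (k * L * ((Complex.sinh (symbol η ε k * L) + σ * (symbol η ε k * L)) /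
        ((symbol η ε k * L) * (Complex.cosh (symbol η ε k * L) + σ))).re) k := by
    intro k hk
    have hsh := sinh_ne_zero_of_re_pos (hre k hk)
    have hsy := hasDerivAt_symbol ε hη hk
    have hlam : symbol η ε k ≠ 0 := fun h => by
      have := re_symbol_pos ε hη hk
      rw [h, Complex.zero_re] at this
      exact lt_irrefl _ this
    have h1 : HasDerivAt (fun z : ℂ => z * (Complex.cosh (z * L) - σ) / Complex.sinh (z * L))
        (((1 * (Complex.cosh (symbol η ε k * L) - σ) +
          symbol η ε k * (Complex.sinh (symbol η ε k * L) * (1 * L))) *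
            Complex.sinh (symbol η ε k * L) -
          symbol η ε k * (Complex.cosh (symbol η ε k * L) - σ) *
            (Complex.cosh (symbol η ε k * L) * (1 * L))) / Complex.sinh (symbol η ε k * L) ^ 2)
        (symbol η ε k) := by
      have hm := (hasDerivAt_id (symbol η ε k)).mul_const (L : ℂ)
      exact ((hasDerivAt_id _).mul (hm.ccosh.sub_const _)).div hm.csinh hsh
    have h2 := HasDerivAt.scomp k h1 hsy
    have h3 := (Complex.reCLM.hasFDerivAt.comp_hasDerivAt k h2)
    have h4 : HasDerivAt (fun k => lowFreqConst (symbol η ε k) L σ) _ k :=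
      h3.congr_of_eventuallyEq (by
        filter_upwards [eventually_gt_nhds hk] with k' hk'
        rw [lowFreqConst_eq σ (hre k' hk')]
        rfl)
    refine h4.congr_deriv ?_
    rw [Complex.reCLM_apply, smul_eq_mul, ← Complex.re_ofReal_mul]
    congr 1
    have hLne : (L : ℂ) ≠ 0 := by exact_mod_cast hL.ne'
    have hsq := Complex.cosh_sq (symbol η ε k * L)
    set z := symbol η ε k * L with hz
    have hprod : Complex.sinh z ^ 2 = (Complex.cosh z - σ) * (Complex.cosh z + σ) := by
      linear_combination -hsq + hσ2
    have hcp : Complex.cosh z + σ ≠ 0 := fun h => by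
      rw [h, mul_zero] at hprod
      exact hsh (pow_eq_zero_iff two_ne_zero |>.1 hprod)
    have hcm : Complex.cosh z - σ ≠ 0 := fun h => by
      rw [h, zero_mul] at hprod
      exact hsh (pow_eq_zero_iff two_ne_zero |>.1 hprod)
    -- Since `σ² = 1`, one has `-1 + σ cosh z = σ (cosh z - σ)`. The common factor `cosh z - σ` then
    -- cancels against `sinh² z = (cosh z - σ)(cosh z + σ)`.
    have hnum : (1 * (Complex.cosh z - σ) + symbol η ε k * (Complex.sinh z * (1 * L))) *
        Complex.sinh z - symbol η ε k * (Complex.cosh z - σ) * (Complex.cosh z * (1 * L)) =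
        (Complex.sinh z + σ * z) * (Complex.cosh z - σ) := by
      rw [hz] at hsq ⊢
      linear_combination (-(symbol η ε k * L)) * hsq + symbol η ε k * L * hσ2
    have hkz : (k : ℂ) / symbol η ε k = k * L / z := by
      rw [hz]
      field_simp
    have hz0 : z ≠ 0 := mul_ne_zero hlam hLne
    rw [hnum, hprod, hkz]
    push_cast
    clear_value z
    field_simp
  refine monotoneOn_of_deriv_nonneg (convex_Ioi 0)
    (fun k hk => (hderiv k hk).continuousAt.continuousWithinAt)
    (fun k hk => ?_) fun k hk => ?_
  · rw [interior_Ioi] at hk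
    exact (hderiv k hk).differentiableAt.differentiableWithinAt
  · rw [interior_Ioi] at hk
    have hk0 : 0 < k := hk
    rw [(hderiv k hk).deriv]
    refine mul_nonneg (by positivity) (re_logDeriv_nonneg (hre k hk) ?_ hσ)
    have := (abs_im_symbol_lt ε hη hk0).le
    simp only [Complex.mul_re, Complex.mul_im, Complex.ofReal_re, Complex.ofReal_im, mul_zero,
      sub_zero, zero_add, abs_mul, abs_of_pos hL]
    gcongr

theorem lowFreqConst_symbol_mono {η ε L c k k' : ℝ} (hη : 0 ≤ η) (hL : 0 < L) (hc : |c| ≤ 1)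
    (hk : 0 < k) (hkk : k ≤ k') :
    lowFreqConst (symbol η ε k) L c ≤ lowFreqConst (symbol η ε k') L c := by
  have hc' := abs_le.1 hc
  rw [lowFreqConst_affine _ L c, lowFreqConst_affine (symbol η ε k') L c]
  have h1 := monotoneOn_lowFreqConst_symbol_of_sign ε hη hL (Or.inl rfl) hk (hk.trans_le hkk) hkk
  have h2 := monotoneOn_lowFreqConst_symbol_of_sign ε hη hL (Or.inr rfl) hk (hk.trans_le hkk) hkk
  dsimp only at h1 h2
  have : 0 ≤ (1 + c) / 2 := by linarith
  have : 0 ≤ (1 - c) / 2 := by linarith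
  gcongr

theorem lowFreqConst_pos {s : ℂ} {L c : ℝ} (hL : 0 < L) (hs : 0 < s.re) (hs' : |s.im| < s.re)
    (hc : |c| ≤ 1) : 0 < lowFreqConst s L c := by
  have hc' := abs_le.1 hc
  rw [lowFreqConst_affine]
  have h1 := lowFreqConst_pos_of_sign hL hs hs' (Or.inl rfl)
  have h2 := lowFreqConst_pos_of_sign hL hs hs' (Or.inr rfl)
  rcases lt_or_ge (-1) c with h | h
  · have : 0 < (1 + c) / 2 := by linarith
    have : 0 ≤ (1 - c) / 2 := by linarith
    positivity
  · have : 0 ≤ (1 + c) / 2 := by linarith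
    have : 0 < (1 - c) / 2 := by linarith
    positivity

end LowFrequency

/-! ### Expansion of the coefficients -/

section Expansion

variable {l : ℂ} {p m δ L : ℝ}

theorem le_norm_add_ofReal (p : ℝ) (hl : 0 < l.re) : p ≤ ‖l + p‖ := by
  have := Complex.re_le_norm (l + p)
  rw [Complex.add_re, Complex.ofReal_re] at this
  linarith

theorem one_sub_reflection (hl : 0 < l.re) (hp : 0 < p) :
    1 - (p - l) / (l + p) = 2 * l / (l + p) := by
  have := add_ofReal_ne_zero hl hp
  field_simp
  ring

theorem norm_one_sub_reflection_le (hl : 0 < l.re) (hp : 0 < p) :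
    ‖1 - (p - l) / (l + p)‖ ≤ 2 * ‖l‖ * (1 / p) := by
  rw [one_sub_reflection hl hp, norm_div, norm_mul, Complex.norm_ofNat, mul_one_div]
  exact div_le_div_of_nonneg_left (by positivity) hp (le_norm_add_ofReal p hl)

theorem norm_one_sub_exp_le (hl : 0 < l.re) (hδ : 0 ≤ δ) :
    ‖1 - Complex.exp (-l * δ)‖ ≤ 2 * ‖l‖ * δ := by
  rw [norm_sub_rev]
  have hn : ‖-l * (δ : ℂ)‖ = ‖l‖ * δ := by
    rw [norm_mul, norm_neg, Complex.norm_real, Real.norm_of_nonneg hδ]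
  rcases le_or_gt (‖l‖ * δ) 1 with h | h
  · have := Complex.norm_exp_sub_one_le (x := -l * (δ : ℂ)) (hn.le.trans h)
    rw [hn] at this
    linarith
  · have h1 : ‖Complex.exp (-l * δ)‖ ≤ 1 := by
      rw [norm_exp_neg_mul, Real.exp_le_one_iff]
      nlinarith
    have := norm_sub_le (Complex.exp (-l * δ)) 1
    rw [norm_one] at this
    linarith

theorem norm_exp_le_one (hl : 0 < l.re) (hδ : 0 ≤ δ) : ‖Complex.exp (-l * δ)‖ ≤ 1 := by
  rw [norm_exp_neg_mul, Real.exp_le_one_iff]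
  nlinarith

theorem sum_norm_one_sub_le (hl : 0 < l.re) (hp : 0 < p) (hm : 0 < m) (hδ : 0 ≤ δ) :
    ‖1 - (p - l) / (l + p)‖ + ‖1 - (m - l) / (l + m)‖ + ‖1 - Complex.exp (-l * δ)‖ ≤
      2 * ‖l‖ * (1 / p + 1 / m + δ) := by
  have h1 := norm_one_sub_reflection_le hl hp
  have h2 := norm_one_sub_reflection_le hl hm
  have h3 := norm_one_sub_exp_le hl hδ
  linarith

/-- The product `g = r⁺ r⁻ e^{-2λδ}` of the two reflection coefficients and the overlap factor. -/
noncomputable def reflectionProduct (p m δ : ℝ) (l : ℂ) : ℂ :=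
  (p - l) / (l + p) * ((m - l) / (l + m)) * Complex.exp (-l * δ) ^ 2

theorem norm_reflectionProduct_le_one (hl : 0 < l.re) (hp : 0 < p) (hm : 0 < m) (hδ : 0 ≤ δ) :
    ‖reflectionProduct p m δ l‖ ≤ 1 :=
  norm_prod_le_one (norm_reflection_lt_one hl hp).le (norm_reflection_lt_one hl hm).le
    (norm_exp_le_one hl hδ)

theorem norm_one_sub_reflectionProduct_le (hl : 0 < l.re) (hp : 0 < p) (hm : 0 < m)
    (hδ : 0 ≤ δ) :
    ‖1 - reflectionProduct p m δ l‖ ≤ 4 * ‖l‖ * (1 / p + 1 / m + δ) := by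
  have h1 := norm_one_sub_prod_le (norm_reflection_lt_one hl hp).le
    (norm_reflection_lt_one hl hm).le (norm_exp_le_one hl hδ)
  have h2 := sum_norm_one_sub_le hl hp hm hδ
  rw [reflectionProduct]
  linarith

theorem norm_one_sub_reflection_sub_le (hl : 0 < l.re) (hp : 0 < p) :
    ‖1 - (p - l) / (l + p) - 2 * l * ((1 / p : ℝ) : ℂ)‖ ≤ 2 * (‖l‖ * (1 / p)) ^ 2 := by
  have h0 := add_ofReal_ne_zero hl hp
  have hp' : (p : ℂ) ≠ 0 := by exact_mod_cast hp.ne'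
  have e : 1 - (p - l) / (l + p) - 2 * l * ((1 / p : ℝ) : ℂ) = -(2 * l ^ 2) / (p * (l + p)) := by
    rw [one_sub_reflection hl hp]
    push_cast
    field_simp
    ring
  rw [e, norm_div, norm_neg, norm_mul, norm_mul, norm_pow, Complex.norm_ofNat, Complex.norm_real,
    Real.norm_of_nonneg hp.le]
  calc 2 * ‖l‖ ^ 2 / (p * ‖l + p‖) ≤ 2 * ‖l‖ ^ 2 / (p * p) := by
        gcongr
        exact le_norm_add_ofReal p hl
    _ = _ := by
      field_simp

theorem norm_one_sub_exp_sq_sub_le (hδ : 0 ≤ δ) (hlδ : 2 * (‖l‖ * δ) ≤ 1) :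
    ‖1 - Complex.exp (-l * δ) ^ 2 - 2 * l * (δ : ℂ)‖ ≤ 4 * (‖l‖ * δ) ^ 2 := by
  have e : 1 - Complex.exp (-l * δ) ^ 2 - 2 * l * (δ : ℂ) =
      -(Complex.exp (-(2 * l * δ)) - 1 - (-(2 * l * δ))) := by
    rw [← Complex.exp_nat_mul]
    push_cast
    ring_nf
  have hn : ‖-(2 * l * (δ : ℂ))‖ = 2 * (‖l‖ * δ) := by
    rw [norm_neg, norm_mul, norm_mul, Complex.norm_ofNat, Complex.norm_real,
      Real.norm_of_nonneg hδ]
    ring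
  rw [e, norm_neg]
  refine (Complex.norm_exp_sub_one_sub_id_le (hn.le.trans hlδ)).trans (le_of_eq ?_)
  rw [hn]
  ring

theorem norm_one_sub_reflectionProduct_sub_le (hl : 0 < l.re) (hp : 0 < p) (hm : 0 < m)
    (hδ : 0 ≤ δ) (hlδ : 2 * (‖l‖ * δ) ≤ 1) :
    ‖1 - reflectionProduct p m δ l - 2 * l * ((1 / p + 1 / m + δ : ℝ) : ℂ)‖ ≤
      28 * (‖l‖ * (1 / p + 1 / m + δ)) ^ 2 := by
  have hu := (norm_reflection_lt_one hl hp).le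
  have hd := norm_exp_le_one hl hδ
  have a1 := norm_one_sub_reflection_le hl hp
  have a2 := norm_one_sub_reflection_le hl hm
  have a3 : ‖1 - Complex.exp (-l * δ) ^ 2‖ ≤ 4 * ‖l‖ * δ := by
    have h1 := norm_one_sub_exp_le hl hδ
    have h2 := norm_one_sub_mul_le (b := Complex.exp (-l * δ)) hd
    rw [← pow_two] at h2
    linarith
  have b1 := norm_one_sub_reflection_sub_le hl hp
  have b2 := norm_one_sub_reflection_sub_le hl hm
  have b3 := norm_one_sub_exp_sq_sub_le hδ hlδ
  have hp1 : 0 < 1 / p := by positivity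
  have hm1 : 0 < 1 / m := by positivity
  rw [reflectionProduct]
  push_cast at b1 b2 ⊢
  set u := ((p : ℂ) - l) / (l + p)
  set v := ((m : ℂ) - l) / (l + m)
  set d := Complex.exp (-l * δ)
  set a := 1 / p
  set b := 1 / m
  set r := ‖l‖
  have hr : 0 ≤ r := norm_nonneg l
  -- Expansion of `1 - u v d²` in the small quantities `1 - u`, `1 - v`, `1 - d²`. The linear terms
  -- sum to `2λS` up to squares, and all remaining terms are products of two small factors.
  have e : 1 - u * v * d ^ 2 - 2 * l * (1 / p + 1 / m + δ) =
      ((1 - u) - 2 * l * (1 / p)) + ((1 - v) - 2 * l * (1 / m)) + ((1 - d ^ 2) - 2 * l * δ) +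
      -((1 - u) * (1 - v)) + -((1 - u) * (1 - d ^ 2)) + -(u * ((1 - v) * (1 - d ^ 2))) := by ring
  rw [e]
  have c1 : ‖-((1 - u) * (1 - v))‖ ≤ (2 * r * a) * (2 * r * b) := by
    rw [norm_neg, norm_mul]
    gcongr
  have c2 : ‖-((1 - u) * (1 - d ^ 2))‖ ≤ (2 * r * a) * (4 * r * δ) := by
    rw [norm_neg, norm_mul]
    gcongr
  have c3 : ‖-(u * ((1 - v) * (1 - d ^ 2)))‖ ≤ (2 * r * b) * (4 * r * δ) := by
    rw [norm_neg]
    refine norm_mul_le_of_le_one hu ?_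
    rw [norm_mul]
    gcongr
  refine (norm_add_le _ _).trans ?_
  refine (add_le_add_left (norm_add_le _ _) _).trans ?_
  refine (add_le_add_left (add_le_add_left (norm_add_le _ _) _) _).trans ?_
  refine (add_le_add_left (add_le_add_left (add_le_add_left norm_add₃_le _) _) _).trans ?_
  have hab : 0 ≤ a * b := by positivity
  have haδ : 0 ≤ a * δ := by positivity
  have hbδ : 0 ≤ b * δ := by positivity
  have hfin : 2 * (r * a) ^ 2 + 2 * (r * b) ^ 2 + 4 * (r * δ) ^ 2 + (2 * r * a) * (2 * r * b) +
      (2 * r * a) * (4 * r * δ) + (2 * r * b) * (4 * r * δ) ≤ 28 * (r * (a + b + δ)) ^ 2 := by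
    have : 0 ≤ r ^ 2 * (26 * a ^ 2 + 26 * b ^ 2 + 24 * δ ^ 2 + 52 * (a * b) + 48 * (a * δ) +
      48 * (b * δ)) := by positivity
    nlinarith
  linarith

end Expansion

/-! ### First-order expansion of `γ + α t` as `g` tends to 1. -/

section Coefficients

variable {g E : ℂ} {e : ℝ}

theorem norm_productCoeff_sub_le (hg : ‖g‖ ≤ 1) (hE : ‖E‖ ^ 2 ≤ e) (he : e < 1) :
    ‖productCoeff g E - g‖ ≤ 4 / (1 - e) ^ 2 * (‖E‖ * ‖1 - g‖) := by
  have hEn : ‖E ^ 2‖ ≤ e := (norm_pow E 2).le.trans hE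
  have h0 : 0 < 1 - e := by linarith
  have hE1 : ‖E‖ ≤ 1 := by
    by_contra! h
    nlinarith
  have hden := le_norm_one_sub (norm_mul_le_of_le_one hg hEn)
  have hne : 1 - g * E ^ 2 ≠ 0 := norm_pos_iff.1 (h0.trans_le hden)
  have e1 : productCoeff g E - g =
      -(g * ((E * (E * (1 - g))) * ((1 - E ^ 2) + (1 - g * E ^ 2)))) / (1 - g * E ^ 2) ^ 2 := by
    rw [productCoeff, eq_div_iff (pow_ne_zero 2 hne), sub_mul,
      div_mul_cancel₀ _ (pow_ne_zero 2 hne)]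
    ring
  rw [e1, norm_div, norm_neg, norm_pow]
  have h2 : ∀ z : ℂ, ‖z‖ ≤ 1 → ‖1 - z‖ ≤ 2 := fun z hz =>
    (norm_sub_le _ _).trans (by rw [norm_one]; linarith)
  have h1 : ‖g * ((E * (E * (1 - g))) * ((1 - E ^ 2) + (1 - g * E ^ 2)))‖ ≤
      (‖E‖ * ‖1 - g‖) * 4 := by
    refine norm_mul_le_of_le_one hg ?_
    rw [norm_mul]
    have a1 : ‖E * (E * (1 - g))‖ ≤ ‖E‖ * ‖1 - g‖ :=
      norm_mul_le_of_le_one hE1 (norm_mul _ _).le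
    have a2 : ‖(1 - E ^ 2) + (1 - g * E ^ 2)‖ ≤ 4 := by
      refine (norm_add_le _ _).trans ?_
      linarith [h2 _ (hEn.trans he.le), h2 _ (norm_mul_le_one hg (hEn.trans he.le))]
    gcongr
  calc _ ≤ (‖E‖ * ‖1 - g‖) * 4 / (1 - e) ^ 2 := by gcongr
    _ = _ := by ring

/-- The difference is exactly divisible by `(1 - g)²`. For `|g| ≤ 1`, `|E| ≤ 1`, `|t| ≤ 2` the five
terms of the cofactor are bounded by `6 + 8 + 4 + 4 + 4 = 26`. -/
theorem norm_productCoeff_add_sub_le (hg : ‖g‖ ≤ 1) (hE : ‖E‖ ^ 2 ≤ e) (he : e < 1) {t : ℝ}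
    (ht : |t| ≤ 2) :
    ‖productCoeff g E + couplingCoeff g E * t -
      (1 - (1 - g) * ((1 + E ^ 2 - t * E) / (1 - E ^ 2)))‖ ≤ 26 / (1 - e) ^ 3 * ‖1 - g‖ ^ 2 := by
  have hEn : ‖E ^ 2‖ ≤ e := (norm_pow E 2).le.trans hE
  have h0 : 0 < 1 - e := by linarith
  have hE1 : ‖E‖ ≤ 1 := by
    by_contra! h
    nlinarith
  have hden := le_norm_one_sub (norm_mul_le_of_le_one hg hEn)
  have hne : 1 - g * E ^ 2 ≠ 0 := norm_pos_iff.1 (h0.trans_le hden)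
  have hden' := le_norm_one_sub hEn
  have hne' : 1 - E ^ 2 ≠ 0 := norm_pos_iff.1 (h0.trans_le hden')
  have h2 : ∀ z : ℂ, ‖z‖ ≤ 1 → ‖1 - z‖ ≤ 2 := fun z hz =>
    (norm_sub_le _ _).trans (by rw [norm_one]; linarith)
  have hw := h2 _ (hEn.trans he.le)
  have hD := h2 _ (norm_mul_le_one hg (hEn.trans he.le))
  have hh := h2 _ hg
  have e1 : productCoeff g E + couplingCoeff g E * t -
      (1 - (1 - g) * ((1 + E ^ 2 - t * E) / (1 - E ^ 2))) =
      (1 - g) ^ 2 * (3 * (1 - E ^ 2) * E ^ 4 + 2 * (1 - E ^ 2) ^ 2 * E ^ 2 +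
        (1 - E ^ 2) * (1 - g) * E ^ 4 + 2 * (1 - g) * E ^ 6 - t * E ^ 3 * (1 - g * E ^ 2)) /
        ((1 - E ^ 2) * (1 - g * E ^ 2) ^ 2) := by
    rw [productCoeff, couplingCoeff]
    field_simp
    ring
  have hn : ‖3 * (1 - E ^ 2) * E ^ 4 + 2 * (1 - E ^ 2) ^ 2 * E ^ 2 +
        (1 - E ^ 2) * (1 - g) * E ^ 4 + 2 * (1 - g) * E ^ 6 - t * E ^ 3 * (1 - g * E ^ 2)‖ ≤ 26 := by
    have hpow : ∀ n, ‖E‖ ^ n ≤ 1 := fun n => pow_le_one₀ (norm_nonneg _) hE1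
    refine (norm_sub_le _ _).trans ?_
    refine (add_le_add_left (norm_add_le _ _) _).trans ?_
    refine (add_le_add_left (add_le_add_left norm_add₃_le _) _).trans ?_
    simp only [norm_mul, norm_pow, Complex.norm_ofNat, Complex.norm_real, Real.norm_eq_abs]
    have a1 : 3 * ‖1 - E ^ 2‖ * ‖E‖ ^ 4 ≤ 3 * 2 * 1 := by gcongr; exact hpow 4
    have a2 : 2 * ‖1 - E ^ 2‖ ^ 2 * ‖E‖ ^ 2 ≤ 2 * 2 ^ 2 * 1 := by gcongr; exact hpow 2
    have a3 : ‖1 - E ^ 2‖ * ‖1 - g‖ * ‖E‖ ^ 4 ≤ 2 * 2 * 1 := by gcongr; exact hpow 4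
    have a4 : 2 * ‖1 - g‖ * ‖E‖ ^ 6 ≤ 2 * 2 * 1 := by gcongr; exact hpow 6
    have a5 : |t| * ‖E‖ ^ 3 * ‖1 - g * E ^ 2‖ ≤ 2 * 1 * 2 := by gcongr; exact hpow 3
    linarith
  rw [e1, norm_div, norm_mul, norm_mul, norm_pow, norm_pow]
  calc _ ≤ ‖1 - g‖ ^ 2 * 26 / ((1 - e) * (1 - e) ^ 2) := by gcongr
    _ = _ := by ring

theorem re_mul_div_eq_lowFreqConst (l : ℂ) (L t : ℝ) :
    (l * ((1 + Complex.exp (-l * L) ^ 2 - t * Complex.exp (-l * L)) /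
      (1 - Complex.exp (-l * L) ^ 2))).re = lowFreqConst l L (t / 2) := by
  rw [lowFreqConst]
  congr 1
  have e2 : Complex.exp (l * L) = (Complex.exp (-l * L))⁻¹ := (exp_identities L 0 l).2.1
  have e1 : Complex.exp (2 * l * L) = (Complex.exp (-l * L))⁻¹ ^ 2 := by
    rw [← e2, ← Complex.exp_nat_mul]
    ring_nf
  have hne := Complex.exp_ne_zero (-l * L)
  rw [e1, e2]
  generalize Complex.exp (-l * L) = E at *
  have h3 : E⁻¹ ^ 2 - 1 = (1 - E ^ 2) * E⁻¹ ^ 2 := by field_simp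
  have h4 : l * (E⁻¹ ^ 2 + 1 - 2 * ((t / 2 : ℝ) : ℂ) * E⁻¹) =
      l * (1 + E ^ 2 - t * E) * E⁻¹ ^ 2 := by
    push_cast
    field_simp
  rw [h3, h4, mul_div_mul_right _ _ (pow_ne_zero 2 (inv_ne_zero hne)), mul_div_assoc]

/-- To first order the modulus of `1 - z` only sees the real part of `z`, because `|1 - z|² = 1 - 2
Re z + |z|²`. This is where the real part in `K` comes from. -/
theorem norm_one_sub_le_one_sub_re (z : ℂ) : ‖1 - z‖ ≤ 1 - z.re + ‖z‖ ^ 2 := by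
  have h1 : ‖1 - z‖ ^ 2 = 1 - 2 * z.re + ‖z‖ ^ 2 := by
    rw [← Complex.normSq_eq_norm_sq, ← Complex.normSq_eq_norm_sq, Complex.normSq_apply,
      Complex.normSq_apply]
    simp only [Complex.sub_re, Complex.one_re, Complex.sub_im, Complex.one_im]
    ring
  have h2 : z.re ^ 2 ≤ ‖z‖ ^ 2 := by
    rw [← sq_abs z.re]
    exact pow_le_pow_left₀ (abs_nonneg _) (Complex.abs_re_le_norm z) 2
  refine le_of_sq_le_sq ?_ ?_
  · rw [h1]
    have : 0 ≤ ‖z‖ ^ 2 * ‖1 - z‖ ^ 2 := by positivity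
    rw [h1] at this
    nlinarith [sq_nonneg z.re]
  · nlinarith [sq_nonneg (z.re - 1 / 2)]

theorem one_sub_re_le_norm_one_sub (z : ℂ) : 1 - z.re ≤ ‖1 - z‖ := by
  have := Complex.re_le_norm (1 - z)
  rwa [Complex.sub_re, Complex.one_re] at this

end Coefficients

/-! ### Eigenvalues of the iteration matrix -/

section Eigenvalues

open scoped Matrix.Norms.L2Operator

variable {J : ℕ} {L κ : ℝ}

theorem norm_exp_sq_le {l : ℂ} (hL : 0 < L) (hl : κ ≤ l.re) :
    ‖Complex.exp (-l * L)‖ ^ 2 ≤ Real.exp (-(κ * L)) ^ 2 := by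
  rw [norm_exp_neg_mul]
  gcongr

theorem exp_sq_lt_one (hL : 0 < L) (hκ : 0 < κ) : Real.exp (-(κ * L)) ^ 2 < 1 := by
  apply pow_lt_one₀ (Real.exp_pos _).le _ two_ne_zero
  rw [Real.exp_lt_one_iff]
  have := mul_pos hκ hL
  linarith

/-- The normal form of the iteration matrix for given parameters. -/
noncomputable def robinNormalMatrix (J : ℕ) (L p m δ : ℝ) (l : ℂ) :
    Matrix (Fin (J - 1) ⊕ Fin (J - 1)) (Fin (J - 1) ⊕ Fin (J - 1)) ℂ :=
  normalMatrix J ((p - l) / (l + p)) ((m - l) / (l + m)) (Complex.exp (-l * δ))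
    (Complex.exp (-l * L))

theorem exists_norm_robinNormalMatrix_sq_sub_le (J : ℕ) (hL : 0 < L) (hκ : 0 < κ) :
    ∃ C : ℝ, 0 < C ∧ ∀ (l : ℂ) (p m δ : ℝ), κ ≤ l.re → 0 < p → 0 < m → 0 ≤ δ →
      ‖robinNormalMatrix J L p m δ l ^ 2
        - productCoeff (reflectionProduct p m δ l) (Complex.exp (-l * L)) • 1
        - couplingCoeff (reflectionProduct p m δ l) (Complex.exp (-l * L)) •
          couplingMatrix (J - 1)‖ ≤
      C * (‖Complex.exp (-l * L)‖ * ‖1 - reflectionProduct p m δ l‖ *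
        (‖1 - (p - l) / (l + p)‖ + ‖1 - (m - l) / (l + m)‖ + ‖1 - Complex.exp (-l * δ)‖)) := by
  obtain ⟨C, hC, h⟩ := exists_norm_normalMatrix_sq_sub_le J (exp_sq_lt_one hL hκ)
  refine ⟨C, hC, fun l p m δ hl hp hm hδ => ?_⟩
  have hl0 : 0 < l.re := hκ.trans_le hl
  exact h _ _ _ _ (norm_reflection_lt_one hl0 hp).le (norm_reflection_lt_one hl0 hm).le
    (norm_exp_le_one hl0 hδ) (norm_exp_sq_le hL hl)

theorem exists_eigenvalue_sq_sub_le {l : ℂ} {p m δ e : ℝ} (hJ : 2 ≤ J)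
    (he : ‖robinNormalMatrix J L p m δ l ^ 2
        - productCoeff (reflectionProduct p m δ l) (Complex.exp (-l * L)) • 1
        - couplingCoeff (reflectionProduct p m δ l) (Complex.exp (-l * L)) •
          couplingMatrix (J - 1)‖ ≤ e) {μ : ℂ}
    (hμ : μ ∈ spectrum ℂ (robinNormalMatrix J L p m δ l)) :
    ∃ t : ℝ, |t| ≤ 2 * Real.cos (Real.pi / J) ∧
      ‖μ ^ 2 - productCoeff (reflectionProduct p m δ l) (Complex.exp (-l * L)) -
        couplingCoeff (reflectionProduct p m δ l) (Complex.exp (-l * L)) * t‖ ≤ e := by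
  refine exists_eigenvalue_sq_near (pathCoupling_nonneg (J - 1)) (pathCoupling_symm (J - 1))
    (w := Sum.elim (sineVec J) (sineVec J)) ?_ (sum_pathCoupling_mul hJ) he hμ
  rintro (i | i) <;> exact sineVec_pos hJ i

theorem abs_le_two_of_abs_le_cos {t : ℝ} (ht : |t| ≤ 2 * Real.cos (Real.pi / J)) : |t| ≤ 2 :=
  ht.trans (by linarith [Real.cos_le_one (Real.pi / J)])

/-- The leading order expansion of `γ + α t` for large parameters. -/
theorem exists_norm_expansion_le (hL : 0 < L) (hκ : 0 < κ) (R : ℝ) :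
    ∃ C : ℝ, 0 < C ∧ ∀ (l : ℂ) (p m δ t : ℝ), κ ≤ l.re → ‖l‖ ≤ R → 0 < p → 0 < m → 0 ≤ δ →
      2 * (R * δ) ≤ 1 → |t| ≤ 2 →
      ‖productCoeff (reflectionProduct p m δ l) (Complex.exp (-l * L)) +
        couplingCoeff (reflectionProduct p m δ l) (Complex.exp (-l * L)) * t -
        (1 - ((2 * (1 / p + 1 / m + δ) : ℝ) : ℂ) *
          (l * ((1 + Complex.exp (-l * L) ^ 2 - t * Complex.exp (-l * L)) /
            (1 - Complex.exp (-l * L) ^ 2))))‖ ≤ C * (1 / p + 1 / m + δ) ^ 2 ∧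
      ‖l * ((1 + Complex.exp (-l * L) ^ 2 - t * Complex.exp (-l * L)) /
            (1 - Complex.exp (-l * L) ^ 2))‖ ≤ C := by
  set e := Real.exp (-(κ * L)) ^ 2 with he_def
  have he : e < 1 := exp_sq_lt_one hL hκ
  have h0 : 0 < 1 - e := by linarith
  set R' := max R 0 with hR'
  have hR0 : 0 ≤ R' := le_max_right _ _
  set C := 26 / (1 - e) ^ 3 * (4 * R') ^ 2 + 28 * R' ^ 2 * (4 / (1 - e)) with hCdef
  have hC0 : 0 ≤ C := by positivity
  refine ⟨C + R' * (4 / (1 - e)) + 1, by positivity, ?_⟩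
  intro l p m δ t hl hlR hp hm hδ hRδ ht
  have hl0 : 0 < l.re := hκ.trans_le hl
  have hlR' : ‖l‖ ≤ R' := hlR.trans (le_max_left _ _)
  have hE : ‖Complex.exp (-l * L)‖ ^ 2 ≤ e := norm_exp_sq_le hL hl
  have hE1 : ‖Complex.exp (-l * L)‖ ≤ 1 := by
    by_contra! h
    nlinarith
  have hg := norm_reflectionProduct_le_one hl0 hp hm hδ
  have h1 := norm_productCoeff_add_sub_le hg hE he ht
  have h2 := norm_one_sub_reflectionProduct_le hl0 hp hm hδ
  have h3 := norm_one_sub_reflectionProduct_sub_le hl0 hp hm hδ (by nlinarith)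
  set S := 1 / p + 1 / m + δ with hS
  have hS0 : 0 ≤ S := by positivity
  set g := reflectionProduct p m δ l
  set E := Complex.exp (-l * L)
  have hEn : ‖E ^ 2‖ ≤ e := (norm_pow E 2).le.trans hE
  have hq : ‖(1 + E ^ 2 - t * E) / (1 - E ^ 2)‖ ≤ 4 / (1 - e) := by
    rw [norm_div]
    have a1 : ‖1 + E ^ 2 - t * E‖ ≤ 4 := by
      refine (norm_sub_le _ _).trans ?_
      refine (add_le_add_left (norm_add_le _ _) _).trans ?_
      rw [norm_one, norm_mul, Complex.norm_real, Real.norm_eq_abs]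
      have : |t| * ‖E‖ ≤ 2 * 1 := by gcongr
      linarith
    have a2 := le_norm_one_sub hEn
    gcongr
  set q := (1 + E ^ 2 - t * E) / (1 - E ^ 2)
  constructor
  · have e1 : productCoeff g E + couplingCoeff g E * t - (1 - ((2 * S : ℝ) : ℂ) * (l * q)) =
        (productCoeff g E + couplingCoeff g E * t - (1 - (1 - g) * q)) +
          -((1 - g - 2 * l * (S : ℂ)) * q) := by
      push_cast
      ring
    rw [e1]
    refine (norm_add_le _ _).trans ?_
    rw [norm_neg, norm_mul]
    have h4 : 26 / (1 - e) ^ 3 * ‖1 - g‖ ^ 2 ≤ 26 / (1 - e) ^ 3 * (4 * R') ^ 2 * S ^ 2 := by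
      rw [mul_assoc, ← mul_pow]
      gcongr
      exact h2.trans (by gcongr)
    have h5 : ‖1 - g - 2 * l * (S : ℂ)‖ * ‖q‖ ≤ 28 * R' ^ 2 * (4 / (1 - e)) * S ^ 2 := by
      calc _ ≤ 28 * (R' * S) ^ 2 * (4 / (1 - e)) := by
            gcongr
            exact h3.trans (by gcongr)
        _ = _ := by ring
    have h6 : 0 ≤ (R' * (4 / (1 - e)) + 1) * S ^ 2 := by positivity
    rw [hCdef]
    linarith
  · rw [norm_mul]
    have : ‖l‖ * ‖q‖ ≤ R' * (4 / (1 - e)) := by gcongr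
    linarith

/-- At bounded frequencies the squared eigenvalues are at most `1 - 2 K (1/p⁺ + 1/p⁻ + δ)` up to
terms of second order. -/
theorem exists_lowFreq_upper (hJ : 2 ≤ J) (hL : 0 < L) (hκ : 0 < κ) (R : ℝ) :
    ∃ C : ℝ, 0 < C ∧ ∀ (l : ℂ) (p m δ K : ℝ), κ ≤ l.re → ‖l‖ ≤ R → 0 < p → 0 < m → 0 ≤ δ →
      2 * (R * δ) ≤ 1 →
      (∀ c, |c| ≤ Real.cos (Real.pi / J) → K ≤ lowFreqConst l L c) →
      ∀ μ ∈ spectrum ℂ (robinNormalMatrix J L p m δ l),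
        ‖μ‖ ^ 2 ≤ 1 - 2 * K * (1 / p + 1 / m + δ) + C * (1 / p + 1 / m + δ) ^ 2 := by
  obtain ⟨C₁, hC₁, hM⟩ := exists_norm_robinNormalMatrix_sq_sub_le J hL hκ
  obtain ⟨C₂, hC₂, hX⟩ := exists_norm_expansion_le hL hκ R
  refine ⟨C₂ + (2 * C₂) ^ 2 + C₁ * (1 * (4 * R) * (2 * R) + 1) + 1, by nlinarith [sq_nonneg R], ?_⟩
  intro l p m δ K hl hlR hp hm hδ hRδ hK μ hμ
  have hl0 : 0 < l.re := hκ.trans_le hl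
  obtain ⟨t, ht, hμt⟩ := exists_eigenvalue_sq_sub_le hJ (hM l p m δ hl hp hm hδ) hμ
  obtain ⟨h1, h2⟩ := hX l p m δ t hl hlR hp hm hδ hRδ (abs_le_two_of_abs_le_cos ht)
  have h3 := hK (t / 2) (by rw [abs_div, abs_two]; linarith)
  rw [← re_mul_div_eq_lowFreqConst] at h3
  have h4 := norm_one_sub_reflectionProduct_le hl0 hp hm hδ
  have h5 := sum_norm_one_sub_le hl0 hp hm hδ
  have hE1 : ‖Complex.exp (-l * L)‖ ≤ 1 := norm_exp_le_one hl0 hL.le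
  set S := 1 / p + 1 / m + δ with hS
  have hS0 : 0 ≤ S := by positivity
  set F := l * ((1 + Complex.exp (-l * L) ^ 2 - t * Complex.exp (-l * L)) /
    (1 - Complex.exp (-l * L) ^ 2))
  have h6 : ‖1 - ((2 * S : ℝ) : ℂ) * F‖ ≤ 1 - 2 * S * K + (2 * C₂) ^ 2 * S ^ 2 := by
    refine (norm_one_sub_le_one_sub_re _).trans ?_
    rw [Complex.re_ofReal_mul, norm_mul, Complex.norm_real, Real.norm_of_nonneg (by positivity)]
    have a1 : 2 * S * K ≤ 2 * S * F.re := by gcongr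
    have a2 : (2 * S * ‖F‖) ^ 2 ≤ (2 * C₂) ^ 2 * S ^ 2 := by
      rw [← mul_pow]
      apply pow_le_pow_left₀ (by positivity)
      calc 2 * S * ‖F‖ ≤ 2 * S * C₂ := by gcongr
        _ = _ := by ring
    linarith
  have hR0 : 0 ≤ R := (norm_nonneg l).trans hlR
  have h7 : C₁ * (‖Complex.exp (-l * L)‖ * ‖1 - reflectionProduct p m δ l‖ *
        (‖1 - (p - l) / (l + p)‖ + ‖1 - (m - l) / (l + m)‖ + ‖1 - Complex.exp (-l * δ)‖)) ≤
      C₁ * (1 * (4 * R) * (2 * R)) * S ^ 2 := by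
    calc _ ≤ C₁ * (1 * (4 * R * S) * (2 * R * S)) := by
          gcongr
          · exact h4.trans (by gcongr)
          · exact h5.trans (by gcongr)
      _ = _ := by ring
  rw [← norm_pow]
  have h8 : μ ^ 2 = (μ ^ 2 - productCoeff (reflectionProduct p m δ l) (Complex.exp (-l * L)) -
        couplingCoeff (reflectionProduct p m δ l) (Complex.exp (-l * L)) * t) +
      (productCoeff (reflectionProduct p m δ l) (Complex.exp (-l * L)) +
        couplingCoeff (reflectionProduct p m δ l) (Complex.exp (-l * L)) * t -
        (1 - ((2 * S : ℝ) : ℂ) * F)) + (1 - ((2 * S : ℝ) : ℂ) * F) := by ring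
  rw [h8]
  refine norm_add₃_le.trans ?_
  have h9 : 0 ≤ (C₁ + 1) * S ^ 2 := by positivity
  linarith

set_option maxHeartbeats 800000 in
/-- At a fixed frequency there is an eigenvalue attaining the leading order bound. -/
theorem exists_lowFreq_lower (hJ : 2 ≤ J) (hL : 0 < L) {l : ℂ} (hl : 0 < l.re) {σ : ℝ}
    (hσ : σ = 1 ∨ σ = -1) {ε : ℝ} (hε : 0 < ε) :
    ∃ r > 0, ∀ p m δ : ℝ, 0 < p → 0 < m → 0 ≤ δ → 1 / p + 1 / m + δ < r →
      ∃ μ ∈ spectrum ℂ (robinNormalMatrix J L p m δ l),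
        1 - 2 * (lowFreqConst l L (σ * Real.cos (Real.pi / J)) + ε) * (1 / p + 1 / m + δ) ≤
          ‖μ‖ ^ 2 := by
  obtain ⟨C₁, hC₁, hM⟩ := exists_norm_robinNormalMatrix_sq_sub_le J hL hl
  obtain ⟨C₂, hC₂, hX⟩ := exists_norm_expansion_le hL hl ‖l‖
  set N := ‖l‖ with hN
  have hN0 : 0 < N := by
    have := Complex.re_le_norm l
    linarith
  set e := Real.exp (-(l.re * L)) ^ 2 with he_def
  have he : e < 1 := exp_sq_lt_one hL hl
  have h0 : 0 < 1 - e := by linarith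
  set t := σ * (2 * Real.cos (Real.pi / J)) with ht_def
  have ht : |t| ≤ 2 := by
    have h1 := cos_pi_div_nonneg hJ
    have h2 := Real.cos_le_one (Real.pi / J)
    have hσ1 : |σ| = 1 := by rcases hσ with rfl | rfl <;> norm_num
    rw [ht_def, abs_mul, hσ1, one_mul, abs_of_nonneg (by positivity)]
    linarith
  -- Chosen so that `|α| ζ ≤ ε S`, given `|α| ≤ 4 N S / (1 - e)`.
  set ζ := ε * (1 - e) / (4 * N) with hζ
  have hζ0 : 0 < ζ := by positivity
  have : Nonempty (Fin (J - 1) ⊕ Fin (J - 1)) := ⟨Sum.inl ⟨0, by omega⟩⟩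
  have hnear := eventually_exists_spectrum_near (mem_spectrum_couplingMatrix hJ hσ) hζ0
  rw [Metric.eventually_nhds_iff] at hnear
  obtain ⟨r₀, hr₀, hnear⟩ := hnear
  -- The three bounds on `S` serve, in order, to put the rescaled matrix within `r₀` of `A`, to make
  -- `|λ| δ` small enough for the expansion, and to absorb `C₂ S²` into `ε S`.
  refine ⟨min (r₀ / (C₁ * (2 * (2 * N)) + 1)) (min (1 / (2 * N)) (ε / C₂)), ?_, ?_⟩
  · positivity
  intro p m δ hp hm hδ hr
  have hr1 := hr.trans_le (min_le_left _ _)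
  have hr2 := (hr.trans_le (min_le_right _ _)).trans_le (min_le_left _ _)
  have hr3 := (hr.trans_le (min_le_right _ _)).trans_le (min_le_right _ _)
  have hp1 : 0 < 1 / p := by positivity
  have hm1 : 0 < 1 / m := by positivity
  have hNδ : 2 * (N * δ) ≤ 1 := by
    rw [lt_div_iff₀ (by positivity)] at hr2
    have : 2 * N * δ ≤ 2 * N * (1 / p + 1 / m + δ) := by gcongr; linarith
    linarith
  obtain ⟨h1, h2⟩ := hX l p m δ t le_rfl le_rfl hp hm hδ hNδ ht
  have hM' := hM l p m δ le_rfl hp hm hδ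
  have h3 := re_mul_div_eq_lowFreqConst l L t
  have h4 := norm_one_sub_reflectionProduct_le hl hp hm hδ
  have h5 := sum_norm_one_sub_le hl hp hm hδ
  have hE : ‖Complex.exp (-l * L)‖ ^ 2 ≤ e := norm_exp_sq_le hL le_rfl
  have hE1 : ‖Complex.exp (-l * L)‖ ≤ 1 := norm_exp_le_one hl hL.le
  have hE0 : 0 < ‖Complex.exp (-l * L)‖ := norm_pos_iff.2 (Complex.exp_ne_zero _)
  -- Strictness is needed here: it makes `1 - g`, and hence `α`, nonzero, so that division by `α` is
  -- allowed.
  have hg1 : ‖reflectionProduct p m δ l‖ < 1 := by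
    rw [reflectionProduct, mul_assoc, norm_mul]
    have a1 := norm_reflection_lt_one hl hp
    have a2 : ‖((m : ℂ) - l) / (l + m) * Complex.exp (-l * δ) ^ 2‖ ≤ 1 := by
      rw [pow_two]
      exact norm_mul_le_one (norm_reflection_lt_one hl hm).le
        (norm_mul_le_one (norm_exp_le_one hl hδ) (norm_exp_le_one hl hδ))
    calc _ ≤ ‖((p : ℂ) - l) / (l + p)‖ * 1 := by gcongr
      _ < 1 := by rwa [mul_one]
  have hg : 0 < ‖1 - reflectionProduct p m δ l‖ :=
    norm_pos_iff.2 (one_sub_ne_zero_of_norm_lt hg1)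
  have hal := norm_couplingCoeff_le hg1.le hE he
  have hal' : ‖Complex.exp (-l * L)‖ * ‖1 - reflectionProduct p m δ l‖ / 2 ≤
      ‖couplingCoeff (reflectionProduct p m δ l) (Complex.exp (-l * L))‖ := by
    rw [couplingCoeff, norm_div, norm_mul]
    have a1 : ‖1 - reflectionProduct p m δ l * Complex.exp (-l * L) ^ 2‖ ≤ 2 := by
      refine (norm_sub_le _ _).trans ?_
      have := norm_mul_le_one hg1.le (norm_mul_le_one hE1 hE1)
      rw [← pow_two] at this
      rw [norm_one]
      linarith
    have a2 : 0 < ‖1 - reflectionProduct p m δ l * Complex.exp (-l * L) ^ 2‖ := by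
      refine norm_pos_iff.2 (one_sub_ne_zero_of_norm_lt ?_)
      rw [norm_mul, norm_pow]
      have := pow_le_one₀ (n := 2) (norm_nonneg _) hE1
      calc _ ≤ ‖reflectionProduct p m δ l‖ * 1 := by gcongr
        _ < 1 := by rwa [mul_one]
    gcongr
  set S := 1 / p + 1 / m + δ with hS
  have hS0 : 0 < S := by positivity
  set g := reflectionProduct p m δ l
  set E := Complex.exp (-l * L)
  set al := couplingCoeff g E
  set γ := productCoeff g E
  set T := robinNormalMatrix J L p m δ l
  set A := couplingMatrix (J - 1)
  have hal0 : 0 < ‖al‖ := lt_of_lt_of_le (by positivity) hal'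
  have hane : al ≠ 0 := norm_pos_iff.1 hal0
  -- The remainder is bounded by `C₁ |E| |1 - g|` times a quantity of order `S`, and `|α| ≥ |E| |1 -
  -- g| / 2`. After division only `O(S)` is left, however small `α` itself is.
  have hdist : dist (al⁻¹ • (T ^ 2 - γ • 1)) A < r₀ := by
    have e1 : al⁻¹ • (T ^ 2 - γ • 1) - A = al⁻¹ • (T ^ 2 - γ • 1 - al • A) := by
      rw [smul_sub _ _ (al • A), smul_smul, inv_mul_cancel₀ hane, one_smul]
    rw [dist_eq_norm, e1, norm_smul, norm_inv, inv_mul_lt_iff₀ hal0]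
    refine hM'.trans_lt ?_
    rw [lt_div_iff₀ (by positivity)] at hr1
    have hpos : 0 < ‖E‖ * ‖1 - g‖ := by positivity
    calc _ ≤ C₁ * (‖E‖ * ‖1 - g‖ * (2 * N * S)) := by gcongr
      _ = (‖E‖ * ‖1 - g‖ / 2) * (S * (C₁ * (2 * (2 * N)))) := by ring
      _ < (‖E‖ * ‖1 - g‖ / 2) * r₀ := by gcongr; linarith
      _ ≤ ‖al‖ * r₀ := by gcongr
  obtain ⟨τ, hτ, hτt⟩ := hnear hdist
  obtain ⟨v, hv, hvτ⟩ := exists_eigenvector hτ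
  have hT2 : γ + al * τ ∈ spectrum ℂ (T ^ 2) := by
    refine mem_spectrum_of_mulVec hv ?_
    have e2 : T ^ 2 = γ • 1 + al • (al⁻¹ • (T ^ 2 - γ • 1)) := by
      rw [smul_smul, mul_inv_cancel₀ hane, one_smul]
      abel
    rw [e2, Matrix.add_mulVec, Matrix.smul_mulVec, Matrix.smul_mulVec, hvτ, Matrix.one_mulVec,
      smul_smul, ← add_smul]
  obtain ⟨μ, hμ, hμ2⟩ := exists_sq_mem_spectrum hT2
  refine ⟨μ, hμ, ?_⟩
  rw [← norm_pow, hμ2]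
  set F := l * ((1 + E ^ 2 - t * E) / (1 - E ^ 2))
  have hFre : F.re = lowFreqConst l L (σ * Real.cos (Real.pi / J)) := by
    rw [h3, ht_def]
    congr 1
    ring
  have b1 := one_sub_re_le_norm_one_sub (((2 * S : ℝ) : ℂ) * F)
  rw [Complex.re_ofReal_mul, hFre] at b1
  have e3 : 1 - ((2 * S : ℝ) : ℂ) * F = (γ + al * τ) + -(γ + al * t - (1 - ((2 * S : ℝ) : ℂ) * F)) +
      al * (t - τ) := by ring
  have b2 : ‖1 - ((2 * S : ℝ) : ℂ) * F‖ ≤ ‖γ + al * τ‖ + C₂ * S ^ 2 + ‖al‖ * ζ := by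
    rw [e3]
    refine norm_add₃_le.trans ?_
    rw [norm_neg, norm_mul]
    gcongr
  have b3 : C₂ * S ^ 2 ≤ ε * S := by
    rw [lt_div_iff₀ hC₂] at hr3
    calc C₂ * S ^ 2 = S * C₂ * S := by ring
      _ ≤ ε * S := by gcongr
  have b4 : ‖al‖ * ζ ≤ ε * S := by
    have a1 : ‖al‖ ≤ 4 * N * S / (1 - e) := by
      refine hal.trans ?_
      have a2 : ‖E‖ * ‖1 - g‖ ≤ 4 * N * S :=
        (mul_le_of_le_one_left (norm_nonneg _) hE1).trans h4
      gcongr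
    calc ‖al‖ * ζ ≤ 4 * N * S / (1 - e) * ζ := by gcongr
      _ = ε * S := by
        rw [hζ]
        field_simp
  have b5 := b1.trans b2
  have b6 : 1 - 2 * (lowFreqConst l L (σ * Real.cos (Real.pi / J)) + ε) * S =
      1 - 2 * S * lowFreqConst l L (σ * Real.cos (Real.pi / J)) - ε * S - ε * S := by ring
  rw [b6]
  linarith only [b5, b3, b4]

/-- Bounds of the spectrum by the reflection product, sharp up to exponentially small terms at high
frequencies. -/
theorem exists_highFreq_bounds (hJ : 2 ≤ J) (hL : 0 < L) (hκ : 0 < κ) :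
    ∃ C : ℝ, 0 < C ∧ ∀ (l : ℂ) (p m δ : ℝ), κ ≤ l.re → 0 < p → 0 < m → 0 ≤ δ →
      (∀ μ ∈ spectrum ℂ (robinNormalMatrix J L p m δ l),
        ‖μ‖ ^ 2 ≤ ‖reflectionProduct p m δ l‖ +
          C * (‖Complex.exp (-l * L)‖ * ‖1 - reflectionProduct p m δ l‖)) ∧
      ∀ r, (∀ μ ∈ spectrum ℂ (robinNormalMatrix J L p m δ l), ‖μ‖ ≤ r) →
        ‖reflectionProduct p m δ l‖ ≤ r ^ 2 +
          C * (‖Complex.exp (-l * L)‖ * ‖1 - reflectionProduct p m δ l‖) := by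
  obtain ⟨C₁, hC₁, hM⟩ := exists_norm_robinNormalMatrix_sq_sub_le J hL hκ
  set e := Real.exp (-(κ * L)) ^ 2 with he_def
  have he : e < 1 := exp_sq_lt_one hL hκ
  have h0 : 0 < 1 - e := by linarith
  refine ⟨4 / (1 - e) ^ 2 + 2 / (1 - e) + C₁ * 6, by positivity, ?_⟩
  intro l p m δ hl hp hm hδ
  have hl0 : 0 < l.re := hκ.trans_le hl
  have hE : ‖Complex.exp (-l * L)‖ ^ 2 ≤ e := norm_exp_sq_le hL hl
  have hg := norm_reflectionProduct_le_one hl0 hp hm hδ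
  have hγ := norm_productCoeff_sub_le hg hE he
  have hal := norm_couplingCoeff_le hg hE he
  have hη := norm_one_sub_add_le (norm_reflection_lt_one hl0 hp).le
    (norm_reflection_lt_one hl0 hm).le (norm_exp_le_one hl0 hδ)
  have hM' : _ ≤ C₁ * 6 * (‖Complex.exp (-l * L)‖ * ‖1 - reflectionProduct p m δ l‖) :=
    (hM l p m δ hl hp hm hδ).trans (by
      calc _ ≤ C₁ * (‖Complex.exp (-l * L)‖ * ‖1 - reflectionProduct p m δ l‖ * 6) := by gcongr
        _ = _ := by ring)
  set X := ‖Complex.exp (-l * L)‖ * ‖1 - reflectionProduct p m δ l‖ with hX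
  have hX0 : 0 ≤ X := by positivity
  set g := reflectionProduct p m δ l
  set E := Complex.exp (-l * L)
  set al := couplingCoeff g E
  set γ := productCoeff g E
  constructor
  · intro μ hμ
    obtain ⟨t, ht, hμt⟩ := exists_eigenvalue_sq_sub_le hJ hM' hμ
    have ht2 := abs_le_two_of_abs_le_cos ht
    have e1 : μ ^ 2 = g + (γ - g) + al * t + (μ ^ 2 - γ - al * t) := by ring
    rw [← norm_pow, e1]
    refine (norm_add_le _ _).trans ?_
    refine (add_le_add_left norm_add₃_le _).trans ?_
    rw [norm_mul, Complex.norm_real, Real.norm_eq_abs]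
    have a1 : ‖al‖ * |t| ≤ X / (1 - e) * 2 := by gcongr
    have a2 : X / (1 - e) * 2 = 2 / (1 - e) * X := by ring
    linarith
  · intro r hr
    have htr := norm_trace_sq_le hr
    set T := robinNormalMatrix J L p m δ l
    set A := couplingMatrix (J - 1)
    set n := Fintype.card (Fin (J - 1) ⊕ Fin (J - 1)) with hn
    have hn0 : 0 < n := Fintype.card_pos_iff.2 ⟨Sum.inl ⟨0, by omega⟩⟩
    have hn0' : (0 : ℝ) < n := by exact_mod_cast hn0
    -- Taking traces removes `α A`, so the mean of the squared eigenvalues is `γ` up to the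
    -- remainder. A bound `r` on all eigenvalues therefore bounds `|γ|`, and hence `|g|`.
    have hAtr : A.trace = 0 := by
      rw [Matrix.trace, Fintype.sum_sum_type]
      simp [A, couplingMatrix, pathCoupling]
    have htr2 : ‖(T ^ 2 - γ • 1 - al • A).trace‖ ≤ n * (C₁ * 6 * X) := by
      rw [Matrix.trace]
      refine (norm_sum_le _ _).trans ?_
      refine (Finset.sum_le_card_nsmul Finset.univ _ (C₁ * 6 * X) fun i _ =>
        (norm_entry_le _ i i).trans hM').trans (le_of_eq ?_)
      rw [nsmul_eq_mul, Finset.card_univ]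
    rw [Matrix.trace_sub, Matrix.trace_sub, Matrix.trace_smul, Matrix.trace_smul, hAtr, smul_zero,
      sub_zero, Matrix.trace_one, smul_eq_mul, ← hn] at htr2
    have h1 : ‖γ * n‖ ≤ n * r ^ 2 + n * (C₁ * 6 * X) := by
      have e2 : γ * n = (T ^ 2).trace - ((T ^ 2).trace - γ * n) := by ring
      rw [e2]
      exact (norm_sub_le _ _).trans (add_le_add htr htr2)
    rw [norm_mul, Complex.norm_natCast, mul_comm, ← mul_add] at h1
    have h2 := le_of_mul_le_mul_left h1 hn0'
    have h3 : ‖g‖ ≤ ‖γ‖ + ‖γ - g‖ := by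
      have := norm_sub_le γ (γ - g)
      rwa [sub_sub_cancel] at this
    have h4 : 0 ≤ 2 / (1 - e) * X := by positivity
    linarith

end Eigenvalues

/-! ### The modulus of the reflection product -/

section Reflection

variable {l : ℂ} {p m δ : ℝ}

theorem norm_sq_ofReal_sub (p : ℝ) (l : ℂ) : ‖(p : ℂ) - l‖ ^ 2 = (p - l.re) ^ 2 + l.im ^ 2 := by
  rw [← Complex.normSq_eq_norm_sq, Complex.normSq_apply]
  simp only [Complex.sub_re, Complex.sub_im, Complex.ofReal_re, Complex.ofReal_im]
  ring

theorem norm_sq_add_ofReal (l : ℂ) (p : ℝ) : ‖l + (p : ℂ)‖ ^ 2 = (p + l.re) ^ 2 + l.im ^ 2 := by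
  rw [← Complex.normSq_eq_norm_sq, Complex.normSq_apply]
  simp only [Complex.add_re, Complex.add_im, Complex.ofReal_re, Complex.ofReal_im]
  ring

/-- The imaginary part adds the same amount to both squared moduli, which can only increase a
quotient that is at most 1. -/
theorem abs_sub_div_le_norm_reflection (hl : 0 < l.re) (hp : 0 < p) :
    |p - l.re| / (p + l.re) ≤ ‖((p : ℂ) - l) / (l + p)‖ := by
  rw [norm_div, div_le_div_iff₀ (by positivity) (norm_pos_iff.2 (add_ofReal_ne_zero hl hp))]
  apply abs_le_of_sq_le_sq' _ (by positivity) |>.2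
  rw [mul_pow, mul_pow, norm_sq_ofReal_sub, norm_sq_add_ofReal, sq_abs]
  nlinarith [mul_nonneg (mul_pos hl hp).le (sq_nonneg l.im)]

/-- This is `(1 - s)/(1 + s) ≥ 1 - 2s` for the ratio `s` of `p` and `Re λ`. It holds for either
order of the ratio, so the tests need not know which of the two is larger; only the small ratio is
informative. -/
theorem one_sub_le_norm_reflection (hl : 0 < l.re) (hp : 0 < p) {s : ℝ}
    (hs : s = p / l.re ∨ s = l.re / p) : 1 - 2 * s ≤ ‖((p : ℂ) - l) / (l + p)‖ := by
  refine le_trans ?_ (abs_sub_div_le_norm_reflection hl hp)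
  rw [le_div_iff₀ (by positivity)]
  rcases hs with rfl | rfl
  · refine le_trans ?_ (neg_le_abs _)
    have : p / l.re * l.re = p := div_mul_cancel₀ _ hl.ne'
    nlinarith [div_pos hp hl]
  · refine le_trans ?_ (le_abs_self _)
    have : l.re / p * p = l.re := div_mul_cancel₀ _ hp.ne'
    nlinarith [div_pos hl hp]

theorem norm_exp_sq_eq (l : ℂ) (δ : ℝ) :
    ‖Complex.exp (-l * δ) ^ 2‖ = Real.exp (-(2 * (l.re * δ))) := by
  rw [norm_pow, norm_exp_neg_mul, ← Real.exp_nat_mul]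
  push_cast
  ring_nf

theorem one_sub_le_norm_reflectionProduct (hl : 0 < l.re) (hp : 0 < p) (hm : 0 < m)
    (hδ : 0 ≤ δ) {s₁ s₂ : ℝ} (hs₁ : s₁ = p / l.re ∨ s₁ = l.re / p)
    (hs₂ : s₂ = m / l.re ∨ s₂ = l.re / m) :
    1 - 2 * (s₁ + s₂ + l.re * δ) ≤ ‖reflectionProduct p m δ l‖ := by
  have h1 := one_sub_le_norm_reflection hl hp hs₁
  have h2 := one_sub_le_norm_reflection hl hm hs₂
  have h3 : 1 - 2 * (l.re * δ) ≤ ‖Complex.exp (-l * δ) ^ 2‖ := by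
    rw [norm_exp_sq_eq]
    linarith [Real.add_one_le_exp (-(2 * (l.re * δ)))]
  have h4 := (norm_reflection_lt_one hl hp).le
  have h5 := (norm_reflection_lt_one hl hm).le
  have h6 : ‖Complex.exp (-l * δ) ^ 2‖ ≤ 1 := by
    rw [norm_pow]
    exact pow_le_one₀ (norm_nonneg _) (norm_exp_le_one hl hδ)
  rw [reflectionProduct, norm_mul, norm_mul]
  set a := ‖((p : ℂ) - l) / (l + p)‖
  set b := ‖((m : ℂ) - l) / (l + m)‖
  set c := ‖Complex.exp (-l * δ) ^ 2‖
  have ha : 0 ≤ a := norm_nonneg _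
  have hb : 0 ≤ b := norm_nonneg _
  have h7 : a + b - 1 ≤ a * b := by nlinarith
  have h8 : a * b ≤ 1 := mul_le_one₀ h4 hb h5
  have h9 : a * b + c - 1 ≤ a * b * c := by nlinarith
  linarith

/-- With `x = Re λ` and `y = Im λ`, the squared modulus is `1 - 4px/((p + x)² + y²)`. The sector
condition costs only the factor `1 - ν`, and `1 + a ≤ e^a` turns the product of reflections into a
sum of exponents. -/
theorem norm_reflection_le_exp (hl : 0 < l.re) (hp : 0 < p) {ν : ℝ} (hν : 0 ≤ ν)
    (him : l.im ^ 2 ≤ ν * l.re ^ 2) :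
    ‖((p : ℂ) - l) / (l + p)‖ ≤
      Real.exp (-(2 * (1 - ν) * (p * l.re / (p + l.re) ^ 2))) := by
  have hpl : 0 < (p + l.re) ^ 2 := by positivity
  have hne := norm_pos_iff.2 (add_ofReal_ne_zero hl hp)
  have hx : 0 < p * l.re := mul_pos hp hl
  refine abs_le_of_sq_le_sq' ?_ (Real.exp_pos _).le |>.2
  rw [← Real.exp_nat_mul]
  have h1 : ‖((p : ℂ) - l) / (l + p)‖ ^ 2 ≤
      1 + -(4 * (1 - ν) * (p * l.re / (p + l.re) ^ 2)) := by
    rw [norm_div, div_pow, norm_sq_ofReal_sub, norm_sq_add_ofReal]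
    have h2 : 0 < (p + l.re) ^ 2 + l.im ^ 2 := by positivity
    have h3 : ((p - l.re) ^ 2 + l.im ^ 2) / ((p + l.re) ^ 2 + l.im ^ 2) =
        1 - 4 * (p * l.re) / ((p + l.re) ^ 2 + l.im ^ 2) := by
      field_simp
      ring
    have h4 : (1 - ν) * (p * l.re / (p + l.re) ^ 2) ≤
        p * l.re / ((p + l.re) ^ 2 + l.im ^ 2) := by
      rw [← mul_div_assoc, div_le_div_iff₀ hpl h2]
      have h5 : l.im ^ 2 ≤ ν * (p + l.re) ^ 2 := him.trans (by gcongr; linarith)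
      have h6 : (1 - ν) * ((p + l.re) ^ 2 + l.im ^ 2) ≤ (p + l.re) ^ 2 := by
        nlinarith [mul_nonneg hν (sq_nonneg l.im)]
      nlinarith
    rw [h3, mul_div_assoc]
    linarith
  refine h1.trans ?_
  have h2 := Real.add_one_le_exp (-(4 * (1 - ν) * (p * l.re / (p + l.re) ^ 2)))
  have h3 : ((2 : ℕ) : ℝ) * -(2 * (1 - ν) * (p * l.re / (p + l.re) ^ 2)) =
      -(4 * (1 - ν) * (p * l.re / (p + l.re) ^ 2)) := by push_cast; ring
  rw [h3]
  linarith

/-- The exponent governing the contraction at high frequencies. -/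
noncomputable def dampingExponent (p m δ x : ℝ) : ℝ :=
  p * x / (p + x) ^ 2 + m * x / (m + x) ^ 2 + x * δ

theorem norm_reflectionProduct_le_exp (hl : 0 < l.re) (hp : 0 < p) (hm : 0 < m) (hδ : 0 ≤ δ)
    {ν : ℝ} (hν : 0 ≤ ν) (him : l.im ^ 2 ≤ ν * l.re ^ 2) :
    ‖reflectionProduct p m δ l‖ ≤
      Real.exp (-(2 * (1 - ν) * dampingExponent p m δ l.re)) := by
  have h1 := norm_reflection_le_exp hl hp hν him
  have h2 := norm_reflection_le_exp hl hm hν him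
  have h3 : ‖Complex.exp (-l * δ) ^ 2‖ ≤ Real.exp (-(2 * (1 - ν) * (l.re * δ))) := by
    rw [norm_exp_sq_eq, Real.exp_le_exp]
    nlinarith [mul_nonneg hν (mul_nonneg hl.le hδ)]
  rw [reflectionProduct, norm_mul, norm_mul]
  calc _ ≤ Real.exp (-(2 * (1 - ν) * (p * l.re / (p + l.re) ^ 2))) *
        Real.exp (-(2 * (1 - ν) * (m * l.re / (m + l.re) ^ 2))) *
        Real.exp (-(2 * (1 - ν) * (l.re * δ))) := by gcongr
    _ = _ := by
      rw [← Real.exp_add, ← Real.exp_add, dampingExponent]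
      ring_nf

/-- Since `(1 + x + x²/2)(1 - x + x²/2) = 1 + x⁴/4 ≥ 1`, the lower quadratic bound for `e^x` can be
inverted. -/
theorem exp_neg_le_quadratic {x : ℝ} (hx : 0 ≤ x) : Real.exp (-x) ≤ 1 - x + x ^ 2 / 2 := by
  have h := Real.quadratic_le_exp_of_nonneg hx
  have h0 : 0 < 1 + x + x ^ 2 / 2 := by positivity
  rw [Real.exp_neg, inv_le_comm₀ (Real.exp_pos _) (by nlinarith [sq_nonneg (x - 1)])]
  refine le_trans ?_ h
  rw [inv_le_iff_one_le_mul₀ (by nlinarith [sq_nonneg (x - 1)])]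
  nlinarith [sq_nonneg (x ^ 2)]

theorem norm_reflectionProduct_le_of_le_dampingExponent (hl : 0 < l.re) (hp : 0 < p) (hm : 0 < m)
    (hδ : 0 ≤ δ) {ν φ : ℝ} (hν : 0 ≤ ν) (hν1 : ν ≤ 1) (him : l.im ^ 2 ≤ ν * l.re ^ 2)
    (hφ : 0 ≤ φ) (h : φ ≤ dampingExponent p m δ l.re) :
    ‖reflectionProduct p m δ l‖ ≤ 1 - 2 * (1 - ν) * φ + 2 * φ ^ 2 := by
  have h0 : 0 ≤ 1 - ν := by linarith
  refine (norm_reflectionProduct_le_exp hl hp hm hδ hν him).trans ?_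
  have h1 : Real.exp (-(2 * (1 - ν) * dampingExponent p m δ l.re)) ≤
      Real.exp (-(2 * (1 - ν) * φ)) := by gcongr
  refine h1.trans ((exp_neg_le_quadratic (by positivity)).trans ?_)
  have h2 : (1 - ν) ^ 2 ≤ 1 := pow_le_one₀ h0 (by linarith)
  nlinarith [sq_nonneg φ]

end Reflection

/-! ### Bounds for the convergence factor -/

section ConvergenceFactor

variable {J : ℕ} {L η ε kmin : ℝ}

theorem spectrum_iterationMatrix_symbol (J : ℕ) (hL : 0 < L) (hη : 0 ≤ η) (ε : ℝ) {δ k p m : ℝ}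
    (hδ : 0 ≤ δ) (hk : 0 < k) (hp : 0 < p) (hm : 0 < m) :
    spectrum ℂ (iterationMatrix J L δ (symbol η ε k) (fun _ => p) (fun _ => m)) =
      spectrum ℂ (robinNormalMatrix J L p m δ (symbol η ε k)) :=
  spectrum_iterationMatrix hL hδ (re_symbol_pos ε hη hk) hp hm

theorem norm_le_of_convergenceFactor_le (hL : 0 < L) (hη : 0 ≤ η) (hkmin : 0 < kmin)
    {δ kmax p m r : ℝ} (hδ : 0 ≤ δ) (hp : 0 < p) (hm : 0 < m) (hr : 0 ≤ r)
    (h : convergenceFactor J L δ η ε kmin kmax p m ≤ ENNReal.ofReal r) {k : ℝ}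
    (hk : k ∈ Set.Icc kmin kmax) {μ : ℂ}
    (hμ : μ ∈ spectrum ℂ (robinNormalMatrix J L p m δ (symbol η ε k))) : ‖μ‖ ≤ r := by
  rw [← spectrum_iterationMatrix_symbol J hL hη ε hδ (hkmin.trans_le hk.1) hp hm] at hμ
  have h1 := (ofReal_norm_le_spectralRadius hμ).trans ((le_iSup₂ (f := fun k _ => spectralRadius ℂ
    (iterationMatrix J L δ (symbol η ε k) (fun _ => p) (fun _ => m))) k hk).trans h)
  exact (ENNReal.ofReal_le_ofReal_iff hr).1 h1

theorem convergenceFactor_le_ofReal (hL : 0 < L) (hη : 0 ≤ η) (hkmin : 0 < kmin)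
    {δ kmax p m r : ℝ} (hδ : 0 ≤ δ) (hp : 0 < p) (hm : 0 < m)
    (h : ∀ k, kmin ≤ k → ∀ μ ∈ spectrum ℂ (robinNormalMatrix J L p m δ (symbol η ε k)), ‖μ‖ ≤ r) :
    convergenceFactor J L δ η ε kmin kmax p m ≤ ENNReal.ofReal r := by
  refine iSup₂_le fun k hk => spectralRadius_le_ofReal fun μ hμ => ?_
  rw [spectrum_iterationMatrix_symbol J hL hη ε hδ (hkmin.trans_le hk.1) hp hm] at hμ
  exact h k hk.1 μ hμ

/-- A lower bound of the convergence factor from the frequency at which `Re λ = x`. -/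
theorem exists_highFreq_test (hJ : 2 ≤ J) (hL : 0 < L) (hη : 0 ≤ η) (ε : ℝ) (hkmin : 0 < kmin) :
    ∃ C > 0, ∃ X > 0, ∀ δ kmax p m θ x s₁ s₂ : ℝ, 0 ≤ δ → 0 < p → 0 < m → θ ≤ 1 → X ≤ x →
      x ≤ kmax → (s₁ = p / x ∨ s₁ = x / p) → (s₂ = m / x ∨ s₂ = x / m) →
      convergenceFactor J L δ η ε kmin kmax p m ≤ ENNReal.ofReal (1 - θ) →
      θ - θ ^ 2 / 2 ≤ s₁ + s₂ + x * δ + C / x := by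
  obtain ⟨C, hC, hb⟩ := exists_highFreq_bounds hJ hL hkmin
  refine ⟨C / L, by positivity, max kmin (max (η + ε ^ 2 / 4 + kmin ^ 2) 1), by positivity, ?_⟩
  intro δ kmax p m θ x s₁ s₂ hδ hp hm hθ hX hx hs₁ hs₂ hρ
  have hX1 := (le_max_left _ _).trans hX
  have hX2 := ((le_max_left _ _).trans (le_max_right _ _)).trans hX
  have hX3 := ((le_max_right _ _).trans (le_max_right _ _)).trans hX
  have hx0 : 0 < x := by linarith
  obtain ⟨k, hk1, hk2, hkx⟩ := exists_re_symbol_eq hη hkmin hX1 hX2 hX3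
  have hk0 : 0 < k := hkmin.trans_le hk1
  have hl := re_symbol_pos ε hη hk0
  have h1 := (hb (symbol η ε k) p m δ (hk1.trans (le_re_symbol ε hη hk0)) hp hm hδ).2 (1 - θ)
    fun μ hμ => norm_le_of_convergenceFactor_le hL hη hkmin hδ hp hm (by linarith) hρ
      ⟨hk1, hk2.trans hx⟩ hμ
  have h2 := one_sub_le_norm_reflectionProduct hl hp hm hδ (s₁ := s₁) (s₂ := s₂)
    (by rwa [hkx]) (by rwa [hkx])
  -- The crude bound `e^{-xL} ≤ 1/(xL)` is enough: at the test frequencies `x` is at least of order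
  -- `t⁻²`, so `C/x` is negligible against `t`.
  have h3 : ‖Complex.exp (-symbol η ε k * L)‖ ≤ 1 / (x * L) := by
    rw [norm_exp_neg_mul, hkx, Real.exp_neg, ← one_div]
    have := Real.add_one_le_exp (x * L)
    gcongr
    linarith
  have h4 : ‖1 - reflectionProduct p m δ (symbol η ε k)‖ ≤ 2 := by
    refine (norm_sub_le _ _).trans ?_
    rw [norm_one]
    linarith [norm_reflectionProduct_le_one hl hp hm hδ]
  have h5 : C * (‖Complex.exp (-symbol η ε k * L)‖ *
      ‖1 - reflectionProduct p m δ (symbol η ε k)‖) ≤ 2 * (C / L / x) := by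
    calc _ ≤ C * (1 / (x * L) * 2) := by gcongr
      _ = _ := by field_simp
  rw [hkx] at h2
  linarith

/-- A lower bound of the convergence factor from the smallest frequency. -/
theorem exists_lowFreq_test (hJ : 2 ≤ J) (hL : 0 < L) (hη : 0 ≤ η) (ε : ℝ) (hkmin : 0 < kmin)
    {σ : ℝ} (hσ : σ = 1 ∨ σ = -1) {e : ℝ} (he : 0 < e) :
    ∃ r > 0, ∀ δ kmax p m θ : ℝ, 0 ≤ δ → 0 < p → 0 < m → θ ≤ 1 → kmin ≤ kmax →
      1 / p + 1 / m + δ < r →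
      convergenceFactor J L δ η ε kmin kmax p m ≤ ENNReal.ofReal (1 - θ) →
      θ - θ ^ 2 / 2 ≤
        (lowFreqConst (symbol η ε kmin) L (σ * Real.cos (Real.pi / J)) + e) *
          (1 / p + 1 / m + δ) := by
  obtain ⟨r, hr, h⟩ := exists_lowFreq_lower hJ hL (re_symbol_pos ε hη hkmin) hσ he
  refine ⟨r, hr, fun δ kmax p m θ hδ hp hm hθ hk hS hρ => ?_⟩
  obtain ⟨μ, hμ, h1⟩ := h p m δ hp hm hδ hS
  have h2 := norm_le_of_convergenceFactor_le hL hη hkmin hδ hp hm (by linarith) hρ ⟨le_rfl, hk⟩ hμ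
  have h3 : ‖μ‖ ^ 2 ≤ (1 - θ) ^ 2 := by gcongr
  linarith

theorem mul_exp_neg_mul_le {x L : ℝ} (hx : 0 < x) (hL : 0 < L) :
    x * Real.exp (-(x * L)) ≤ 2 / (L ^ 2 * x) := by
  have h := Real.quadratic_le_exp_of_nonneg (mul_pos hx hL).le
  rw [Real.exp_neg, ← div_eq_mul_inv, div_le_div_iff₀ (Real.exp_pos _) (by positivity)]
  nlinarith [mul_pos hx hL]

/-- An upper bound of the convergence factor. -/
theorem exists_convergenceFactor_le (hJ : 2 ≤ J) (hL : 0 < L) (hη : 0 ≤ η) (hε : 0 ≤ ε)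
    (hkmin : 0 < kmin) {K : ℝ}
    (hK : ∀ c, |c| ≤ Real.cos (Real.pi / J) → K ≤ lowFreqConst (symbol η ε kmin) L c) {ν : ℝ}
    (hν : 0 < ν) (hν1 : ν ≤ 1) :
    ∃ R₀ > 0, ∀ R ≥ R₀, ∃ C > 0, ∀ δ kmax p m φ θ : ℝ, 0 ≤ δ → 0 < p → 0 < m → 0 ≤ φ → θ ≤ 1 →
      4 * R * δ ≤ 1 → (∀ x ≥ R, φ ≤ dampingExponent p m δ x) →
      2 * θ ≤ 2 * K * (1 / p + 1 / m + δ) - C * (1 / p + 1 / m + δ) ^ 2 →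
      2 * θ ≤ 2 * (1 - ν) * φ - 2 * φ ^ 2 - ν * (1 / p + 1 / m + δ) →
      convergenceFactor J L δ η ε kmin kmax p m ≤ ENNReal.ofReal (1 - θ) := by
  obtain ⟨C₁, hC₁, hb⟩ := exists_highFreq_bounds hJ hL hkmin
  -- Beyond `ε²/ν` the symbol lies in the sector `(Im λ)² ≤ ν (Re λ)²`. Beyond `16 C₁/(ν L²)` the
  -- coupling error `C₁ |E| |1 - g|` is at most `ν S`.
  refine ⟨max 1 (max (ε ^ 2 / ν) (16 * C₁ / (ν * L ^ 2))), by positivity, fun R hR => ?_⟩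
  obtain ⟨C, hC, hlow⟩ := exists_lowFreq_upper hJ hL hkmin (2 * R)
  have hR1 := (le_max_left _ _).trans hR
  have hR2 := ((le_max_left _ _).trans (le_max_right _ _)).trans hR
  have hR3 := ((le_max_right _ _).trans (le_max_right _ _)).trans hR
  refine ⟨C, hC, ?_⟩
  intro δ kmax p m φ θ hδ hp hm hφ hθ hRδ hΦ h1 h2
  refine convergenceFactor_le_ofReal hL hη hkmin hδ hp hm fun k hk μ hμ => ?_
  have hk0 : 0 < k := hkmin.trans_le hk
  have hl := re_symbol_pos ε hη hk0
  have hκ := hk.trans (le_re_symbol ε hη hk0)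
  have hn := norm_symbol_le ε hη hk0
  suffices h : ‖μ‖ ^ 2 ≤ 1 - 2 * θ from
    (abs_le_of_sq_le_sq' (h.trans (by linarith [sq_nonneg θ])) (by linarith)).2
  -- Below the fixed threshold `R` the first-order expansion holds uniformly, since `|λ| ≤ 2 Re λ ≤
  -- 2R`, and monotonicity moves the constant to the lowest frequency. Above it the damping exponent
  -- takes over, so no intermediate regime is left.
  rcases le_total (symbol η ε k).re R with hx | hx
  · have h3 := hlow (symbol η ε k) p m δ K hκ (hn.trans (by linarith)) hp hm hδ (by linarith)
      (fun c hc => (hK c hc).trans (lowFreqConst_symbol_mono hη hL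
        (hc.trans (Real.cos_le_one _)) hkmin hk)) μ hμ
    linarith
  · have h3 := (hb (symbol η ε k) p m δ hκ hp hm hδ).1 μ hμ
    have him : (symbol η ε k).im ^ 2 ≤ ν * (symbol η ε k).re ^ 2 := by
      rw [← sq_abs, abs_im_symbol_eq hη hε hk0]
      set x := (symbol η ε k).re
      rw [div_le_iff₀ hν] at hR2
      have hx1 : 1 ≤ x := hR1.trans hx
      have a1 : ε ^ 2 ≤ x * ν := hR2.trans (by gcongr)
      rw [div_pow, div_le_iff₀ (by positivity)]
      have a2 : x * ν ≤ ν * x ^ 2 := by nlinarith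
      have a3 : ν * x ^ 2 ≤ ν * x ^ 2 * (2 * x) ^ 2 := by
        have : 1 ≤ (2 * x) ^ 2 := by nlinarith
        exact le_mul_of_one_le_right (by positivity) this
      linarith
    have h4 := norm_reflectionProduct_le_of_le_dampingExponent hl hp hm hδ hν.le hν1 him hφ
      (hΦ _ hx)
    have h5 := norm_one_sub_reflectionProduct_le hl hp hm hδ
    have h6 : C₁ * (‖Complex.exp (-symbol η ε k * L)‖ *
        ‖1 - reflectionProduct p m δ (symbol η ε k)‖) ≤ ν * (1 / p + 1 / m + δ) := by
      set S := 1 / p + 1 / m + δ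
      have hS : 0 ≤ S := by positivity
      rw [norm_exp_neg_mul]
      set x := (symbol η ε k).re
      have a1 : x * Real.exp (-(x * L)) ≤ 2 / (L ^ 2 * R) :=
        (mul_exp_neg_mul_le hl hL).trans (by gcongr)
      have a2 : C₁ * 8 * (2 / (L ^ 2 * R)) ≤ ν := by
        rw [div_le_iff₀ (by positivity)] at hR3
        rw [← mul_div_assoc, div_le_iff₀ (by positivity)]
        linarith
      calc _ ≤ C₁ * (Real.exp (-(x * L)) * (4 * (2 * x) * S)) := by
            gcongr
            exact h5.trans (by gcongr)
        _ = C₁ * 8 * (x * Real.exp (-(x * L))) * S := by ring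
        _ ≤ C₁ * 8 * (2 / (L ^ 2 * R)) * S := by gcongr
        _ ≤ ν * S := by gcongr
    linarith

/-- The sign of `Re (s / sinh (s L))` decides which of `± c` minimizes `lowFreqConst s L`. -/
theorem exists_sign_lowFreqConst {s : ℂ} (hL : 0 < L) (hs : 0 < s.re) {c₀ K : ℝ}
    (hK : K = if 0 ≤ (s / Complex.sinh (s * L)).re then lowFreqConst s L c₀
      else lowFreqConst s L (-c₀)) :
    (∃ σ : ℝ, (σ = 1 ∨ σ = -1) ∧ K = lowFreqConst s L (σ * c₀)) ∧
      ∀ c, |c| ≤ c₀ → K ≤ lowFreqConst s L c := by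
  have hz : 0 < (s * L).re := by
    rw [Complex.re_mul_ofReal]
    positivity
  -- The constant is affine in `c` with slope `-Re(s / sinh(sL))`, so the sign of that number
  -- selects the minimizing endpoint of `[-c₀, c₀]`.
  have key : ∀ c d : ℝ, lowFreqConst s L c =
      lowFreqConst s L d + (d - c) * (s / Complex.sinh (s * L)).re := fun c d => by
    rw [lowFreqConst_eq _ hz, lowFreqConst_eq _ hz, ← Complex.re_ofReal_mul, ← Complex.add_re]
    congr 1
    push_cast
    ring
  constructor
  · split_ifs at hK
    · exact ⟨1, Or.inl rfl, by rw [one_mul, hK]⟩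
    · exact ⟨-1, Or.inr rfl, by rw [neg_one_mul, hK]⟩
  · intro c hc
    have hc' := abs_le.1 hc
    split_ifs at hK with h
    · rw [hK, key c c₀]
      nlinarith
    · rw [hK, key c (-c₀)]
      nlinarith

end ConvergenceFactor

/-! ### Symmetry and semicontinuity of the convergence factor -/

section Symmetry

variable {J : ℕ} {L η ε kmin : ℝ}

theorem spectralRadius_submatrix_equiv {n : Type*} [Fintype n] [DecidableEq n] (e : n ≃ n)
    (M : Matrix n n ℂ) : spectralRadius ℂ (M.submatrix e e) = spectralRadius ℂ M := by
  have h := AlgEquiv.spectrum_eq (Matrix.reindexAlgEquiv ℂ ℂ e.symm) M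
  rw [Matrix.coe_reindexAlgEquiv, Matrix.reindex_apply, Equiv.symm_symm] at h
  rw [spectralRadius, spectralRadius, h]

/-- The reflection of the strip exchanges the roles of the two traces. -/
def reflectionEquiv (N : ℕ) : Fin N ⊕ Fin N ≃ Fin N ⊕ Fin N :=
  (Equiv.sumComm _ _).trans (Equiv.sumCongr Fin.revPerm Fin.revPerm)

/-- Reflecting the strip sends interface `i` to `J - 2 - i`, exchanges left and right traces, and
thereby exchanges the two parameters. The two Dirichlet ends are interchanged as well. -/
theorem iterationMatrix_swap (J : ℕ) (L δ : ℝ) (l : ℂ) (p m : ℝ) :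
    (iterationMatrix J L δ l (fun _ => m) (fun _ => p)).submatrix (reflectionEquiv (J - 1))
      (reflectionEquiv (J - 1)) = iterationMatrix J L δ l (fun _ => p) (fun _ => m) := by
  have hd : denom L δ l m p = denom L δ l p m := by
    simp only [denom]
    ring
  ext (i | i) (k | k) <;> have hi := i.2 <;> have hk := k.2 <;>
    simp only [Matrix.submatrix_apply, reflectionEquiv, Equiv.trans_apply, Equiv.sumComm_apply,
      Sum.swap_inl, Sum.swap_inr, Equiv.sumCongr_apply, Sum.map_inl, Sum.map_inr,
      Fin.revPerm_apply, iterationMatrix, Matrix.fromBlocks_apply₁₁, Matrix.fromBlocks_apply₁₂,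
      Matrix.fromBlocks_apply₂₁, Matrix.fromBlocks_apply₂₂, Matrix.of_apply, Fin.val_rev,
      Fin.rev_inj, alphaPlus, alphaMinus, betaPlus, betaMinus, betaPlusDirichlet,
      betaMinusDirichlet, hd]
  · have : (J - 1 - ((k : ℕ) + 1) + 1 = J - 1 - ((i : ℕ) + 1)) ↔ (k : ℕ) = i + 1 := by omega
    simp only [this]
  · have : (J - 1 - ((i : ℕ) + 1) = 0) ↔ (i : ℕ) + 2 = J := by omega
    simp only [this]
  · have : (J - 1 - ((i : ℕ) + 1) + 2 = J) ↔ (i : ℕ) = 0 := by omega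
    simp only [this]
  · have : (J - 1 - ((k : ℕ) + 1) = J - 1 - ((i : ℕ) + 1) + 1) ↔ (k : ℕ) + 1 = i := by omega
    simp only [this]

theorem convergenceFactor_swap (J : ℕ) (L δ η ε kmin kmax p m : ℝ) :
    convergenceFactor J L δ η ε kmin kmax m p = convergenceFactor J L δ η ε kmin kmax p m := by
  refine iSup_congr fun k => iSup_congr fun _ => ?_
  rw [← iterationMatrix_swap J L δ _ p m, spectralRadius_submatrix_equiv]

theorem denom_ne_zero {L δ : ℝ} {l : ℂ} {p m : ℝ} (hL : 0 < L) (hδ : 0 ≤ δ) (hl : 0 < l.re)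
    (hp : 0 < p) (hm : 0 < m) : denom L δ l p m ≠ 0 := by
  intro h
  have h1 := congrArg norm (sub_eq_zero.1 h)
  have e : Complex.exp (-l * (L + δ)) = Complex.exp (-l * (L + δ : ℝ)) := by push_cast; rfl
  rw [norm_mul, norm_mul, norm_mul, norm_mul, e, norm_exp_neg_mul, Complex.norm_exp] at h1
  have h2 := norm_sub_lt_norm_add hl hp
  have h3 := norm_sub_lt_norm_add hl hm
  rw [norm_sub_rev] at h2 h3
  have h4 : Real.exp (-(l.re * (L + δ))) ≤ Real.exp (l * (L + δ)).re := by
    have : (l * ((L : ℂ) + δ)).re = l.re * (L + δ) := by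
      rw [← Complex.ofReal_add, Complex.re_mul_ofReal]
    rw [this, Real.exp_le_exp]
    have : 0 < l.re * (L + δ) := by positivity
    linarith
  have h5 : ‖l - p‖ * ‖l - m‖ < ‖l + p‖ * ‖l + m‖ :=
    mul_lt_mul'' h2 h3 (norm_nonneg _) (norm_nonneg _)
  have h6 := Real.exp_pos (-(l.re * (L + δ)))
  have h7 : ‖l - p‖ * ‖l - m‖ * Real.exp (-(l.re * (L + δ))) <
      ‖l + p‖ * ‖l + m‖ * Real.exp (l * (L + δ)).re :=
    mul_lt_mul h5 h4 h6 (by positivity)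
  exact h7.ne h1.symm

theorem continuousOn_iterationMatrix (J : ℕ) {L δ : ℝ} {l : ℂ} (hL : 0 < L) (hδ : 0 ≤ δ)
    (hl : 0 < l.re) :
    ContinuousOn (fun q : ℝ × ℝ => iterationMatrix J L δ l (fun _ => q.1) (fun _ => q.2))
      (Set.Ioi 0 ×ˢ Set.Ioi 0) := by
  have hD : ∀ q ∈ (Set.Ioi (0 : ℝ) ×ˢ Set.Ioi (0 : ℝ)), denom L δ l q.1 q.2 ≠ 0 := fun q hq =>
    denom_ne_zero hL hδ hl hq.1 hq.2
  have hne : ∀ p : ℝ, 0 < p → (l + p) * Complex.exp (l * (L + δ))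
      + (l - p) * Complex.exp (-l * (L + δ)) ≠ 0 := fun p hp => by
    have := dirichlet_denom_ne_zero hl hp (add_pos_of_pos_of_nonneg hL hδ)
    push_cast at this
    exact this
  have hcD : Continuous fun q : ℝ × ℝ => denom L δ l q.1 q.2 := by
    unfold denom
    fun_prop
  refine continuousOn_pi.2 fun r => continuousOn_pi.2 fun c => ?_
  rcases r with i | i <;> rcases c with k | k <;>
    simp only [iterationMatrix, Matrix.fromBlocks_apply₁₁, Matrix.fromBlocks_apply₁₂,
      Matrix.fromBlocks_apply₂₁, Matrix.fromBlocks_apply₂₂, Matrix.of_apply] <;>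
    split_ifs <;> (try exact continuousOn_const)
  · exact ContinuousOn.div (by fun_prop) hcD.continuousOn hD
  · exact ContinuousOn.div (by fun_prop) (by fun_prop) fun q hq => hne _ hq.2
  · exact ContinuousOn.div (by fun_prop) hcD.continuousOn hD
  · exact ContinuousOn.div (by fun_prop) (by fun_prop) fun q hq => hne _ hq.1
  · exact ContinuousOn.div (by fun_prop) hcD.continuousOn hD
  · exact ContinuousOn.div (by fun_prop) hcD.continuousOn hD

theorem lowerSemicontinuousOn_convergenceFactor (hJ : 2 ≤ J) (hL : 0 < L) (hη : 0 ≤ η) (ε : ℝ)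
    (hkmin : 0 < kmin) {δ : ℝ} (hδ : 0 ≤ δ) (kmax : ℝ) :
    LowerSemicontinuousOn (fun q : ℝ × ℝ => convergenceFactor J L δ η ε kmin kmax q.1 q.2)
      (Set.Ioi 0 ×ˢ Set.Ioi 0) := by
  have : Nonempty (Fin (J - 1) ⊕ Fin (J - 1)) := ⟨Sum.inl ⟨0, by omega⟩⟩
  refine lowerSemicontinuousOn_biSup fun k hk => ?_
  exact (lowerSemicontinuous_spectralRadius.lowerSemicontinuousOn Set.univ).comp
    (continuousOn_iterationMatrix J hL hδ (re_symbol_pos ε hη (hkmin.trans_le hk.1)))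
    (Set.mapsTo_univ _ _)

/-- A lower semicontinuous function with a sublevel set inside a compact set attains its
minimum. -/
theorem exists_isMinOn_of_sublevel_subset {α β : Type*} [TopologicalSpace α] [LinearOrder β]
    {f : α → β} {Ω K : Set α} (hK : IsCompact K) (hf : LowerSemicontinuousOn f K) {x₀ : α}
    (hx₀ : x₀ ∈ K) (h : ∀ q ∈ Ω, f q ≤ f x₀ → q ∈ K) : ∃ a ∈ K, IsMinOn f Ω a := by
  obtain ⟨a, ha, hmin⟩ := hf.exists_isMinOn ⟨x₀, hx₀⟩ hK
  refine ⟨a, ha, fun q hq => ?_⟩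
  rcases le_total (f q) (f x₀) with hle | hle
  · exact hmin (h q hq hle)
  · exact (hmin hx₀).trans hle

end Symmetry

/-! ### The convergence factor of the asymptotically optimal parameters -/

section DampingBounds

variable {p m δ x : ℝ}

/-- The damping term is replaced by a Möbius function with the same first-order behaviour as `x/p`
tends to 0. Minimizing sums of such functions then amounts to exhibiting a perfect square. -/
theorem div_le_mul_div_sq (hp : 0 < p) (hx : 0 < x) (h : x ≤ p) :
    x / (3 * x + p) ≤ p * x / (p + x) ^ 2 := by
  rw [div_le_div_iff₀ (by positivity) (by positivity)]
  nlinarith [mul_pos hp hx, mul_nonneg (mul_pos hx hx).le (sub_nonneg.2 h)]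

theorem div_le_mul_div_sq' (hp : 0 < p) (hx : 0 < x) (h : p ≤ x) :
    p / (3 * p + x) ≤ p * x / (p + x) ^ 2 := by
  have := div_le_mul_div_sq hx hp h
  rwa [mul_comm x p, add_comm x p] at this

theorem le_mul_div_sq_of_le {R : ℝ} (hp : 0 < p) (hR : 0 < R) (hRx : R ≤ x) (hx : x ≤ p) :
    R / (3 * R + p) ≤ p * x / (p + x) ^ 2 := by
  have hx0 := hR.trans_le hRx
  refine le_trans ?_ (div_le_mul_div_sq hp hx0 hx)
  rw [div_le_div_iff₀ (by positivity) (by positivity)]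
  nlinarith

/-- Frequencies above `p`: the minorant `p/(3p + x) + xδ` exceeds `2w - 3w²` by a perfect square
over a positive denominator, with equality at `3p + x = p/w`. -/
theorem le_mul_div_sq_add_of_ge {w : ℝ} (hp : 0 < p) (hx : p ≤ x) (hw : p * δ = w ^ 2) :
    2 * w - 3 * w ^ 2 ≤ p * x / (p + x) ^ 2 + x * δ := by
  have hx0 := hp.trans_le hx
  have h1 := div_le_mul_div_sq' hp hx0 hx
  have h2 : 2 * w - 3 * w ^ 2 ≤ p / (3 * p + x) + x * δ := by
    have hδ : δ = w ^ 2 / p := by rw [← hw]; field_simp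
    have e : p / (3 * p + x) + x * δ - (2 * w - 3 * w ^ 2) =
        (p - (3 * p + x) * w) ^ 2 / (p * (3 * p + x)) := by
      rw [hδ]
      field_simp
      ring
    have : 0 ≤ (p - (3 * p + x) * w) ^ 2 / (p * (3 * p + x)) := by positivity
    linarith
  linarith

/-- Frequencies between the two parameters: the minimum sits at the geometric mean `x = r m`, and
the gap is `(r - 3)(x - r m)²` over a positive denominator. Hence the requirement `r ≥ 3`. -/
theorem le_mul_div_sq_add_mul_div_sq {r : ℝ} (hm : 0 < m) (hr : 3 ≤ r) (hp : p = r ^ 2 * m)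
    (hmx : m ≤ x) (hxp : x ≤ p) :
    2 / (3 + r) ≤ p * x / (p + x) ^ 2 + m * x / (m + x) ^ 2 := by
  have hx0 := hm.trans_le hmx
  have hp0 := hx0.trans_le hxp
  have h1 := div_le_mul_div_sq hp0 hx0 hxp
  have h2 := div_le_mul_div_sq' hm hx0 hmx
  have h3 : 2 / (3 + r) ≤ x / (3 * x + p) + m / (3 * m + x) := by
    rw [hp]
    have e : x / (3 * x + r ^ 2 * m) + m / (3 * m + x) - 2 / (3 + r) =
        (r - 3) * (x - r * m) ^ 2 / ((3 * x + r ^ 2 * m) * (3 * m + x) * (3 + r)) := by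
      have : 3 + r ≠ 0 := by linarith
      field_simp
      ring
    have : 0 ≤ (r - 3) * (x - r * m) ^ 2 / ((3 * x + r ^ 2 * m) * (3 * m + x) * (3 + r)) := by
      have : 0 ≤ r - 3 := by linarith
      positivity
    linarith
  linarith

/-- The ranges below `q⁴/t`, between the parameters, and above `q²/t³` all yield `2qt` to leading
order. In the first range `R ≥ 4q⁵` and `12qt ≤ 1` each account for half of the available `R t`. -/
theorem le_dampingExponent_twoSided {q t R : ℝ} (hq : 0 < q) (ht : 0 < t) (hqt : 12 * (q * t) ≤ 1)
    (hR : 4 * q ^ 5 ≤ R) (hx : R ≤ x) :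
    2 * q * t - 6 * q ^ 2 * t ^ 2 ≤ dampingExponent (q ^ 2 / t ^ 3) (q ^ 4 / t) (t ^ 5) x := by
  have hR0 : 0 < R := lt_of_lt_of_le (by positivity) hR
  have hx0 : 0 < x := hR0.trans_le hx
  have hp : 0 < q ^ 2 / t ^ 3 := by positivity
  have hm : 0 < q ^ 4 / t := by positivity
  have n1 : 0 ≤ q ^ 2 / t ^ 3 * x / (q ^ 2 / t ^ 3 + x) ^ 2 := by positivity
  have n2 : 0 ≤ q ^ 4 / t * x / (q ^ 4 / t + x) ^ 2 := by positivity
  have n3 : 0 ≤ x * t ^ 5 := by positivity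
  rw [dampingExponent]
  rcases le_total x (q ^ 4 / t) with h | h
  · have h1 := le_mul_div_sq_of_le hm hR0 hx h
    have h2 : 2 * q * t - 6 * q ^ 2 * t ^ 2 ≤ R / (3 * R + q ^ 4 / t) := by
      have e : R / (3 * R + q ^ 4 / t) = t * R / (3 * R * t + q ^ 4) := by field_simp
      rw [e, le_div_iff₀ (by positivity)]
      have a1 : 0 ≤ 6 * q ^ 2 * t ^ 2 * (3 * R * t + q ^ 4) := by positivity
      have a2 : 12 * (q * t) * (R * t) ≤ 1 * (R * t) := by gcongr
      have a3 : 4 * q ^ 5 * t ≤ R * t := by gcongr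
      nlinarith
    linarith
  · rcases le_total x (q ^ 2 / t ^ 3) with h' | h'
    · have h1 := le_mul_div_sq_add_mul_div_sq (r := 1 / (q * t)) hm
        (by rw [le_div_iff₀ (by positivity)]; linarith) (by field_simp) h h'
      have h2 : 2 * q * t - 6 * q ^ 2 * t ^ 2 ≤ 2 / (3 + 1 / (q * t)) := by
        have e : 2 / (3 + 1 / (q * t)) = 2 * q * t / (3 * (q * t) + 1) := by field_simp
        rw [e, le_div_iff₀ (by positivity)]
        have : 0 ≤ 18 * (q * t) ^ 3 := by positivity
        nlinarith
      linarith
    · have h1 := le_mul_div_sq_add_of_ge (w := q * t) (δ := t ^ 5) hp h' (by field_simp)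
      have : 0 ≤ q ^ 2 * t ^ 2 := by positivity
      nlinarith

/-- For `x ≥ p` the overlap term is shared equally between the two identical reflection terms, so
`le_mul_div_sq_add_of_ge` is used with overlap `t³/2` and the result doubled. -/
theorem le_dampingExponent_oneSided {q t R : ℝ} (hq : 0 < q) (ht : 0 < t) (hqt : 12 * (q * t) ≤ 1)
    (hR : 8 * q ^ 3 ≤ R) (hx : R ≤ x) :
    4 * q * t - 12 * q ^ 2 * t ^ 2 ≤
      dampingExponent (2 * q ^ 2 / t) (2 * q ^ 2 / t) (t ^ 3) x := by
  have hR0 : 0 < R := lt_of_lt_of_le (by positivity) hR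
  have hx0 : 0 < x := hR0.trans_le hx
  have hp : 0 < 2 * q ^ 2 / t := by positivity
  have n3 : 0 ≤ x * t ^ 3 := by positivity
  rw [dampingExponent]
  rcases le_total x (2 * q ^ 2 / t) with h | h
  · have h1 := le_mul_div_sq_of_le hp hR0 hx h
    have h2 : 2 * q * t - 6 * q ^ 2 * t ^ 2 ≤ R / (3 * R + 2 * q ^ 2 / t) := by
      have e : R / (3 * R + 2 * q ^ 2 / t) = t * R / (3 * R * t + 2 * q ^ 2) := by field_simp
      rw [e, le_div_iff₀ (by positivity)]
      have a1 : 0 ≤ 6 * q ^ 2 * t ^ 2 * (3 * R * t + 2 * q ^ 2) := by positivity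
      have a2 : 12 * (q * t) * (R * t) ≤ 1 * (R * t) := by gcongr
      have a3 : 8 * q ^ 3 * t ≤ R * t := by gcongr
      nlinarith
    linarith
  · have h1 := le_mul_div_sq_add_of_ge (w := q * t) (δ := t ^ 3 / 2) hp h (by field_simp)
    have : 0 ≤ q ^ 2 * t ^ 2 := by positivity
    nlinarith

end DampingBounds

theorem eventually_lt_of_continuous {f : ℝ → ℝ} {a : ℝ} (hf : Continuous f) (h : a < f 0) :
    ∀ᶠ t in 𝓝[>] (0 : ℝ), a < f t :=
  (hf.continuousWithinAt.tendsto).eventually_const_lt h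

theorem tendsto_pow_nhdsGT_zero {n : ℕ} (hn : n ≠ 0) :
    Tendsto (fun t : ℝ => t ^ n) (𝓝[>] 0) (𝓝[>] 0) := by
  refine tendsto_nhdsWithin_iff.2 ⟨?_, ?_⟩
  · have := (continuous_pow n).tendsto (0 : ℝ)
    rw [zero_pow hn] at this
    exact this.mono_left nhdsWithin_le_nhds
  · filter_upwards [self_mem_nhdsWithin] with t ht using pow_pos (Set.mem_Ioi.1 ht) n

/-- The bounds of a family of convergence factors from which the asymptotics follow. -/
structure RateBounds (ρ : ℝ → ℝ → ℝ → ℝ≥0∞) (K : ℝ) : Prop where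
  highFreq : ∃ C > 0, ∃ X > 0, ∃ c > 0, ∀ᶠ δ in 𝓝[>] (0 : ℝ), ∀ p m θ x s₁ s₂ : ℝ, 0 < p → 0 < m →
    θ ≤ 1 → X ≤ x → x ≤ c / δ → (s₁ = p / x ∨ s₁ = x / p) → (s₂ = m / x ∨ s₂ = x / m) →
    ρ δ p m ≤ ENNReal.ofReal (1 - θ) → θ - θ ^ 2 / 2 ≤ s₁ + s₂ + x * δ + C / x
  lowFreq : ∀ e > 0, ∃ r > 0, ∀ᶠ δ in 𝓝[>] (0 : ℝ), ∀ p m θ : ℝ, 0 < p → 0 < m → θ ≤ 1 →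
    1 / p + 1 / m + δ < r → ρ δ p m ≤ ENNReal.ofReal (1 - θ) →
    θ - θ ^ 2 / 2 ≤ (K + e) * (1 / p + 1 / m + δ)
  upper : ∀ ν > 0, ν ≤ 1 → ∃ R₀ > 0, ∀ R ≥ R₀, ∃ C > 0, ∀ δ p m φ θ : ℝ, 0 ≤ δ → 0 < p → 0 < m →
    0 ≤ φ → θ ≤ 1 → 4 * R * δ ≤ 1 → (∀ x ≥ R, φ ≤ dampingExponent p m δ x) →
    2 * θ ≤ 2 * K * (1 / p + 1 / m + δ) - C * (1 / p + 1 / m + δ) ^ 2 →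
    2 * θ ≤ 2 * (1 - ν) * φ - 2 * φ ^ 2 - ν * (1 / p + 1 / m + δ) →
    ρ δ p m ≤ ENNReal.ofReal (1 - θ)

theorem rateBounds_convergenceFactor {J : ℕ} {L η ε kmin K : ℝ} (hJ : 2 ≤ J) (hL : 0 < L)
    (hη : 0 ≤ η) (hε : 0 ≤ ε) (hkmin : 0 < kmin) {kmax : ℝ → ℝ}
    (hkmax : ∃ c > 0, ∀ᶠ δ in 𝓝[>] (0 : ℝ), c / δ ≤ kmax δ)
    (hK : K = if 0 ≤ (symbol η ε kmin / Complex.sinh (symbol η ε kmin * L)).re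
      then lowFreqConst (symbol η ε kmin) L (Real.cos (Real.pi / J))
      else lowFreqConst (symbol η ε kmin) L (-Real.cos (Real.pi / J))) :
    RateBounds (fun δ p m => convergenceFactor J L δ η ε kmin (kmax δ) p m) K := by
  obtain ⟨c, hc, hkmax⟩ := hkmax
  obtain ⟨⟨σ, hσ, hKσ⟩, hKle⟩ := exists_sign_lowFreqConst hL (re_symbol_pos ε hη hkmin) hK
  refine ⟨?_, fun e he => ?_, fun ν hν hν1 => ?_⟩
  · obtain ⟨C, hC, X, hX, h⟩ := exists_highFreq_test hJ hL hη ε hkmin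
    refine ⟨C, hC, X, hX, c, hc, ?_⟩
    filter_upwards [hkmax, self_mem_nhdsWithin] with δ hδ hδ0
    intro p m θ x s₁ s₂ hp hm hθ hXx hx
    exact h δ (kmax δ) p m θ x s₁ s₂ (le_of_lt hδ0) hp hm hθ hXx (hx.trans hδ)
  · obtain ⟨r, hr, h⟩ := exists_lowFreq_test hJ hL hη ε hkmin hσ he
    refine ⟨r, hr, ?_⟩
    have h0 : ∀ᶠ δ in 𝓝[>] (0 : ℝ), 0 < c - kmin * δ :=
      eventually_lt_of_continuous (by fun_prop) (by simpa using hc)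
    filter_upwards [hkmax, self_mem_nhdsWithin, h0] with δ hδ hδ0 hδ1
    intro p m θ hp hm hθ hS hρ
    rw [hKσ]
    refine h δ (kmax δ) p m θ (le_of_lt hδ0) hp hm hθ (le_trans ?_ hδ) hS hρ
    rw [le_div_iff₀ hδ0]
    linarith
  · obtain ⟨R₀, hR₀, h⟩ := exists_convergenceFactor_le hJ hL hη hε hkmin hKle hν hν1
    refine ⟨R₀, hR₀, fun R hR => ?_⟩
    obtain ⟨C, hC, h'⟩ := h R hR
    exact ⟨C, hC, fun δ => h' δ (kmax δ)⟩

namespace RateBounds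

variable {ρ : ℝ → ℝ → ℝ → ℝ≥0∞} {K q : ℝ}

/-- Here `S = t/q⁴ + O(t³)` and the damping exponent is at least `2qt - O(t²)`. Divided by `t`, the
low-frequency condition tends to `2κ < 2K/q⁴ = 4q` and the high-frequency one to `2κ < 4q` minus a
term that vanishes with `ν`. -/
theorem twoSided_upper (h : RateBounds ρ K) (hq : 0 < q) (hK : K = 2 * q ^ 5) {κ : ℝ}
    (hκ : κ < 2 * q) :
    ∀ᶠ t in 𝓝[>] (0 : ℝ),
      ρ (t ^ 5) (q ^ 2 / t ^ 3) (q ^ 4 / t) ≤ ENNReal.ofReal (1 - κ * t) := by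
  -- The slack `κ < 2q` pays for `ν`: the inequality is the limit as `t → 0` of the high-frequency
  -- condition divided by `t`.
  obtain ⟨ν, hν, hν1, hνκ⟩ : ∃ ν > 0, ν ≤ 1 ∧ 2 * κ < 2 * (1 - ν) * (2 * q) - ν / q ^ 4 := by
    have h1 : ∀ᶠ ν in 𝓝[>] (0 : ℝ), 2 * κ < 2 * (1 - ν) * (2 * q) - ν / q ^ 4 :=
      eventually_lt_of_continuous (f := fun ν => 2 * (1 - ν) * (2 * q) - ν / q ^ 4)
        (by fun_prop) (by simp; linarith)
    have h2 : ∀ᶠ ν in 𝓝[>] (0 : ℝ), 0 < 1 - ν :=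
      eventually_lt_of_continuous (by fun_prop) (by simp)
    obtain ⟨ν, a, b, c⟩ := (h1.and (h2.and self_mem_nhdsWithin)).exists
    exact ⟨ν, c, by linarith, a⟩
  obtain ⟨R₀, hR₀, hR⟩ := h.upper ν hν hν1
  obtain ⟨C, hC, hu⟩ := hR (max R₀ (4 * q ^ 5)) (le_max_left _ _)
  set R := max R₀ (4 * q ^ 5)
  have e1 : ∀ᶠ t in 𝓝[>] (0 : ℝ), 0 < 1 - 12 * (q * t) :=
    eventually_lt_of_continuous (by fun_prop) (by simp)
  have e2 : ∀ᶠ t in 𝓝[>] (0 : ℝ), 0 < 1 - 4 * R * t ^ 5 :=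
    eventually_lt_of_continuous (by fun_prop) (by simp)
  have e3 : ∀ᶠ t in 𝓝[>] (0 : ℝ), 0 < 1 - κ * t :=
    eventually_lt_of_continuous (by fun_prop) (by simp)
  have e4 : ∀ᶠ t in 𝓝[>] (0 : ℝ), 2 * κ < 2 * K * (t ^ 2 / q ^ 2 + 1 / q ^ 4 + t ^ 4) -
      C * (t ^ 2 / q ^ 2 + 1 / q ^ 4 + t ^ 4) ^ 2 * t := by
    refine eventually_lt_of_continuous (f := fun t => 2 * K * (t ^ 2 / q ^ 2 + 1 / q ^ 4 + t ^ 4) -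
      C * (t ^ 2 / q ^ 2 + 1 / q ^ 4 + t ^ 4) ^ 2 * t) (by fun_prop) ?_
    have : 2 * K * (1 / q ^ 4) = 4 * q := by rw [hK]; field_simp; norm_num
    simp only [ne_eq, OfNat.ofNat_ne_zero, not_false_eq_true, zero_pow, zero_div, zero_add,
      add_zero, mul_zero, sub_zero]
    linarith
  have e5 : ∀ᶠ t in 𝓝[>] (0 : ℝ), 2 * κ < 2 * (1 - ν) * (2 * q - 6 * q ^ 2 * t) -
      2 * (2 * q - 6 * q ^ 2 * t) ^ 2 * t - ν * (t ^ 2 / q ^ 2 + 1 / q ^ 4 + t ^ 4) := by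
    refine eventually_lt_of_continuous (f := fun t => 2 * (1 - ν) * (2 * q - 6 * q ^ 2 * t) -
      2 * (2 * q - 6 * q ^ 2 * t) ^ 2 * t - ν * (t ^ 2 / q ^ 2 + 1 / q ^ 4 + t ^ 4))
      (by fun_prop) ?_
    simp only [ne_eq, OfNat.ofNat_ne_zero, not_false_eq_true, zero_pow, zero_div, zero_add,
      add_zero, mul_zero, sub_zero, mul_one_div]
    linarith
  filter_upwards [e1, e2, e3, e4, e5, self_mem_nhdsWithin] with t e1 e2 e3 e4 e5 ht
  have ht : 0 < t := ht
  have hS : 1 / (q ^ 2 / t ^ 3) + 1 / (q ^ 4 / t) + t ^ 5 =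
      (t ^ 2 / q ^ 2 + 1 / q ^ 4 + t ^ 4) * t := by field_simp
  refine hu (t ^ 5) _ _ (2 * q * t - 6 * q ^ 2 * t ^ 2) _ (by positivity) (by positivity)
    (by positivity) ?_ ?_ (by linarith)
    (fun x hx => le_dampingExponent_twoSided hq ht (by linarith) (le_max_right _ _) hx) ?_ ?_
  · nlinarith [mul_pos hq ht]
  · linarith
  · rw [hS]
    nlinarith
  · rw [hS]
    nlinarith

/-- Here `S = t/q² + O(t³)` and the damping exponent is at least `4qt - O(t²)`, so both conditions
divided by `t` become strict inequalities as `t → 0`, since `2K/q² = 8q`. -/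
theorem oneSided_upper (h : RateBounds ρ K) (hq : 0 < q) (hK : K = 4 * q ^ 3) {κ : ℝ}
    (hκ : κ < 4 * q) :
    ∀ᶠ t in 𝓝[>] (0 : ℝ),
      ρ (t ^ 3) (2 * q ^ 2 / t) (2 * q ^ 2 / t) ≤ ENNReal.ofReal (1 - κ * t) := by
  obtain ⟨ν, hν, hν1, hνκ⟩ : ∃ ν > 0, ν ≤ 1 ∧ 2 * κ < 2 * (1 - ν) * (4 * q) - ν / q ^ 2 := by
    have h1 : ∀ᶠ ν in 𝓝[>] (0 : ℝ), 2 * κ < 2 * (1 - ν) * (4 * q) - ν / q ^ 2 :=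
      eventually_lt_of_continuous (f := fun ν => 2 * (1 - ν) * (4 * q) - ν / q ^ 2)
        (by fun_prop) (by simp; linarith)
    have h2 : ∀ᶠ ν in 𝓝[>] (0 : ℝ), 0 < 1 - ν :=
      eventually_lt_of_continuous (by fun_prop) (by simp)
    obtain ⟨ν, a, b, c⟩ := (h1.and (h2.and self_mem_nhdsWithin)).exists
    exact ⟨ν, c, by linarith, a⟩
  obtain ⟨R₀, hR₀, hR⟩ := h.upper ν hν hν1
  obtain ⟨C, hC, hu⟩ := hR (max R₀ (8 * q ^ 3)) (le_max_left _ _)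
  set R := max R₀ (8 * q ^ 3)
  have e1 : ∀ᶠ t in 𝓝[>] (0 : ℝ), 0 < 1 - 12 * (q * t) :=
    eventually_lt_of_continuous (by fun_prop) (by simp)
  have e2 : ∀ᶠ t in 𝓝[>] (0 : ℝ), 0 < 1 - 4 * R * t ^ 3 :=
    eventually_lt_of_continuous (by fun_prop) (by simp)
  have e3 : ∀ᶠ t in 𝓝[>] (0 : ℝ), 0 < 1 - κ * t :=
    eventually_lt_of_continuous (by fun_prop) (by simp)
  have e4 : ∀ᶠ t in 𝓝[>] (0 : ℝ), 2 * κ < 2 * K * (1 / q ^ 2 + t ^ 2) -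
      C * (1 / q ^ 2 + t ^ 2) ^ 2 * t := by
    refine eventually_lt_of_continuous (f := fun t => 2 * K * (1 / q ^ 2 + t ^ 2) -
      C * (1 / q ^ 2 + t ^ 2) ^ 2 * t) (by fun_prop) ?_
    have : 2 * K * (1 / q ^ 2) = 8 * q := by rw [hK]; field_simp; norm_num
    simp only [ne_eq, OfNat.ofNat_ne_zero, not_false_eq_true, zero_pow, add_zero, mul_zero,
      sub_zero]
    linarith
  have e5 : ∀ᶠ t in 𝓝[>] (0 : ℝ), 2 * κ < 2 * (1 - ν) * (4 * q - 12 * q ^ 2 * t) -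
      2 * (4 * q - 12 * q ^ 2 * t) ^ 2 * t - ν * (1 / q ^ 2 + t ^ 2) := by
    refine eventually_lt_of_continuous (f := fun t => 2 * (1 - ν) * (4 * q - 12 * q ^ 2 * t) -
      2 * (4 * q - 12 * q ^ 2 * t) ^ 2 * t - ν * (1 / q ^ 2 + t ^ 2)) (by fun_prop) ?_
    simp only [ne_eq, OfNat.ofNat_ne_zero, not_false_eq_true, zero_pow, add_zero, mul_zero,
      sub_zero, mul_one_div]
    linarith
  filter_upwards [e1, e2, e3, e4, e5, self_mem_nhdsWithin] with t e1 e2 e3 e4 e5 ht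
  have ht : 0 < t := ht
  have hS : 1 / (2 * q ^ 2 / t) + 1 / (2 * q ^ 2 / t) + t ^ 3 = (1 / q ^ 2 + t ^ 2) * t := by
    field_simp
    ring
  refine hu (t ^ 3) _ _ (4 * q * t - 12 * q ^ 2 * t ^ 2) _ (by positivity) (by positivity)
    (by positivity) ?_ (by linarith) (by linarith)
    (fun x hx => le_dampingExponent_oneSided hq ht (by linarith) (le_max_right _ _) hx) ?_ ?_
  · nlinarith [mul_pos hq ht]
  · rw [hS]
    nlinarith
  · rw [hS]
    nlinarith

end RateBounds

/-! ### Asymptotics of nearly optimal parameters -/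

theorem tendsto_of_eventually_bounds {α : Type*} {l : Filter α} {f : α → ℝ} {a : ℝ}
    (h1 : ∀ e > 0, ∀ᶠ t in l, a - e ≤ f t) (h2 : ∀ e > 0, ∀ᶠ t in l, f t ≤ a + e) :
    Tendsto f l (𝓝 a) := by
  refine tendsto_order.2 ⟨fun b hb => ?_, fun b hb => ?_⟩
  · filter_upwards [h1 ((a - b) / 2) (by linarith)] with t ht
    linarith
  · filter_upwards [h2 ((b - a) / 2) (by linarith)] with t ht
    linarith

/-- The a priori bound excludes the value `∞`, which `toReal` would send to 0. -/
theorem le_ofReal_of_toReal_le {x : ℝ≥0∞} {r b : ℝ} (hx : x ≤ ENNReal.ofReal b)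
    (h : x.toReal ≤ r) : x ≤ ENNReal.ofReal r :=
  (ENNReal.le_ofReal_iff_toReal_le (hx.trans_lt ENNReal.ofReal_lt_top).ne
    (ENNReal.toReal_nonneg.trans h)).2 h

namespace RateBounds

variable {ρ : ℝ → ℝ → ℝ → ℝ≥0∞} {K q κ : ℝ} {p m : ℝ → ℝ}

/-- The high frequency test at `x = a / t ^ i` for the overlap `t ^ n`. -/
theorem highFreq_test (h : RateBounds ρ K) {n i : ℕ} (hi : 0 < i) (hin : i < n) {a : ℝ}
    (ha : 0 < a) : ∃ C > 0, ∀ κ : ℝ, ∀ᶠ t in 𝓝[>] (0 : ℝ), ∀ p m s₁ s₂ : ℝ, 0 < p → 0 < m →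
      (s₁ = p / (a / t ^ i) ∨ s₁ = a / t ^ i / p) → (s₂ = m / (a / t ^ i) ∨ s₂ = a / t ^ i / m) →
      ρ (t ^ n) p m ≤ ENNReal.ofReal (1 - κ * t) →
      κ * t - (κ * t) ^ 2 / 2 ≤ s₁ + s₂ + a / t ^ i * t ^ n + C * t ^ i := by
  obtain ⟨C, hC, X, hX, c, hc, hb⟩ := h.highFreq
  refine ⟨C / a, by positivity, fun κ => ?_⟩
  have e1 : ∀ᶠ t in 𝓝[>] (0 : ℝ), 0 < 1 - κ * t :=
    eventually_lt_of_continuous (by fun_prop) (by simp)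
  have e2 : ∀ᶠ t in 𝓝[>] (0 : ℝ), 0 < a - X * t ^ i :=
    eventually_lt_of_continuous (by fun_prop) (by simpa [hi.ne'] using ha)
  have e3 : ∀ᶠ t in 𝓝[>] (0 : ℝ), 0 < c - a * t ^ (n - i) :=
    eventually_lt_of_continuous (by fun_prop) (by
      rw [zero_pow (by omega)]
      simpa using hc)
  filter_upwards [(tendsto_pow_nhdsGT_zero (by omega : n ≠ 0)).eventually hb, e1, e2, e3,
    self_mem_nhdsWithin] with t hb e1 e2 e3 ht
  have ht : 0 < t := ht
  intro p m s₁ s₂ hp hm hs₁ hs₂ hρ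
  refine (hb p m (κ * t) (a / t ^ i) s₁ s₂ hp hm (by linarith) ?_ ?_ hs₁ hs₂ hρ).trans (le_of_eq ?_)
  · rw [le_div_iff₀ (by positivity)]
    linarith
  · rw [div_le_div_iff₀ (by positivity) (by positivity)]
    have : t ^ n = t ^ (n - i) * t ^ i := by rw [← pow_add]; congr 1; omega
    rw [this, ← mul_assoc]
    gcongr
    linarith
  · congr 1
    field_simp

theorem lowFreq_test (h : RateBounds ρ K) {n : ℕ} (hn : n ≠ 0) {e : ℝ} (he : 0 < e) :
    ∃ r > 0, ∀ κ : ℝ, ∀ᶠ t in 𝓝[>] (0 : ℝ), ∀ p m : ℝ, 0 < p → 0 < m →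
      1 / p + 1 / m + t ^ n < r → ρ (t ^ n) p m ≤ ENNReal.ofReal (1 - κ * t) →
      κ * t - (κ * t) ^ 2 / 2 ≤ (K + e) * (1 / p + 1 / m + t ^ n) := by
  obtain ⟨r, hr, hb⟩ := h.lowFreq e he
  refine ⟨r, hr, fun κ => ?_⟩
  have e1 : ∀ᶠ t in 𝓝[>] (0 : ℝ), 0 < 1 - κ * t :=
    eventually_lt_of_continuous (by fun_prop) (by simp)
  filter_upwards [(tendsto_pow_nhdsGT_zero hn).eventually hb, e1] with t hb e1
  intro p m hp hm hr hρ
  exact hb p m (κ * t) hp hm (by linarith) hr hρ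

/-! #### One-sided conditions -/

/-- Test at `x = 2q/t²`, the minimizer of `2p/x + xδ` for the model `p`. It yields `p t/q + 2q ≥ 4q`
in the limit. -/
theorem oneSided_lower (h : RateBounds ρ K) (hq : 0 < q)
    (hp : ∀ᶠ t in 𝓝[>] (0 : ℝ), 0 < p t)
    (hρ : ∀ κ < 4 * q, ∀ᶠ t in 𝓝[>] (0 : ℝ),
      ρ (t ^ 3) (p t) (p t) ≤ ENNReal.ofReal (1 - κ * t)) {e : ℝ} (he : 0 < e) :
    ∀ᶠ t in 𝓝[>] (0 : ℝ), 2 * q ^ 2 - e ≤ p t * t := by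
  obtain ⟨C, hC, hb⟩ := h.highFreq_test (n := 3) (i := 2) (by norm_num) (by norm_num)
    (a := 2 * q) (by positivity)
  have hκ : 4 * q - e / (2 * q) < 4 * q := sub_lt_self _ (by positivity)
  set κ := 4 * q - e / (2 * q) with hκ_def
  have e1 : ∀ᶠ t in 𝓝[>] (0 : ℝ), 2 * q - e / q < κ - κ ^ 2 * t / 2 - 2 * q - C * t :=
    eventually_lt_of_continuous (by fun_prop) (by
      have h1 : 0 < e / q := by positivity
      have h2 : e / (2 * q) = e / q / 2 := by field_simp
      linarith)
  filter_upwards [hb κ, hρ κ hκ, hp, e1, self_mem_nhdsWithin] with t hb hρ hp e1 ht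
  have ht : 0 < t := ht
  have h1 := hb (p t) (p t) _ _ hp hp (Or.inl rfl) (Or.inl rfl) hρ
  have h2 : p t / (2 * q / t ^ 2) + p t / (2 * q / t ^ 2) + 2 * q / t ^ 2 * t ^ 3 + C * t ^ 2 =
      (p t * t / q + 2 * q + C * t) * t := by
    field_simp
    ring
  have h3 : κ * t - (κ * t) ^ 2 / 2 = (κ - κ ^ 2 * t / 2) * t := by ring
  rw [h2, h3] at h1
  have h4 := le_of_mul_le_mul_right h1 ht
  have h5 : 2 * q - e / q ≤ p t * t / q := by linarith
  rw [le_div_iff₀ hq] at h5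
  have h6 : (2 * q - e / q) * q = 2 * q ^ 2 - e := by field_simp
  linarith

/-- If `p` were larger, the lowest frequency would converge too slowly: the rate `2K/p` would fall
below `4qt`. The error `q e` in `K` leaves a strict gap because `2(4q³ + q e) < 4q(2q² + e)`. -/
theorem oneSided_upper_param (h : RateBounds ρ K) (hq : 0 < q) (hK : K = 4 * q ^ 3)
    (hp : ∀ᶠ t in 𝓝[>] (0 : ℝ), 0 < p t)
    (hρ : ∀ κ < 4 * q, ∀ᶠ t in 𝓝[>] (0 : ℝ),
      ρ (t ^ 3) (p t) (p t) ≤ ENNReal.ofReal (1 - κ * t)) {e : ℝ} (he : 0 < e) :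
    ∀ᶠ t in 𝓝[>] (0 : ℝ), p t * t ≤ 2 * q ^ 2 + e := by
  obtain ⟨r, hr, hb⟩ := h.lowFreq_test (n := 3) (by norm_num) (e := q * e) (by positivity)
  set Y := 2 * q ^ 2 + e with hY
  have hY0 : 0 < Y := by positivity
  obtain ⟨κ, hκ, hκ'⟩ : ∃ κ < 4 * q, (K + q * e) * (2 / Y) < κ := by
    have : (K + q * e) * (2 / Y) < 4 * q := by
      rw [← mul_div_assoc, div_lt_iff₀ hY0, hK]
      nlinarith
    obtain ⟨κ, a, b⟩ := exists_between this
    exact ⟨κ, b, a⟩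
  have e1 : ∀ᶠ t in 𝓝[>] (0 : ℝ),
      0 < κ - κ ^ 2 * t / 2 - (K + q * e) * (2 / Y + t ^ 2) :=
    eventually_lt_of_continuous (by fun_prop) (by simpa using hκ')
  have e2 : ∀ᶠ t in 𝓝[>] (0 : ℝ), 0 < r - (2 / Y + t ^ 2) * t :=
    eventually_lt_of_continuous (by fun_prop) (by simpa using hr)
  filter_upwards [hb κ, hρ κ hκ, hp, e1, e2, self_mem_nhdsWithin] with t hb hρ hp e1 e2 ht
  have ht : 0 < t := ht
  by_contra! hlt
  have h0 : 1 / p t ≤ 1 / Y * t := by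
    rw [div_mul_eq_mul_div, one_mul, div_le_div_iff₀ hp hY0]
    linarith
  have hS : 1 / p t + 1 / p t + t ^ 3 ≤ (2 / Y + t ^ 2) * t := by
    have : (2 / Y + t ^ 2) * t = 1 / Y * t + 1 / Y * t + t ^ 3 := by ring
    linarith
  have h1 := hb _ _ hp hp (by linarith) hρ
  have hK0 : 0 ≤ K + q * e := by rw [hK]; positivity
  have h2 : κ * t - (κ * t) ^ 2 / 2 ≤ (K + q * e) * ((2 / Y + t ^ 2) * t) :=
    h1.trans (by gcongr)
  have h3 : 0 < (κ - κ ^ 2 * t / 2 - (K + q * e) * (2 / Y + t ^ 2)) * t := by positivity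
  linarith

/-- Once `p t → 2q²` is known, the lowest-frequency test evaluates to the rate `2K/(2q²) = 4q`, so
no larger rate is possible. -/
theorem oneSided_rate (h : RateBounds ρ K) (hq : 0 < q) (hK : K = 4 * q ^ 3)
    (hp : ∀ᶠ t in 𝓝[>] (0 : ℝ), 0 < p t)
    (hpt : Tendsto (fun t => p t * t) (𝓝[>] 0) (𝓝 (2 * q ^ 2))) {κ : ℝ} (hκ : 4 * q < κ) :
    ∀ᶠ t in 𝓝[>] (0 : ℝ), ¬ρ (t ^ 3) (p t) (p t) ≤ ENNReal.ofReal (1 - κ * t) := by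
  obtain ⟨e, hκe, he⟩ : ∃ e, (K + e) * (2 / (2 * q ^ 2)) < κ ∧ 0 < e := by
    have : ∀ᶠ e in 𝓝[>] (0 : ℝ), 0 < κ - (K + e) * (2 / (2 * q ^ 2)) :=
      eventually_lt_of_continuous (by fun_prop) (by
        have : K * (2 / (2 * q ^ 2)) = 4 * q := by rw [hK]; field_simp
        rw [add_zero, this]
        linarith)
    obtain ⟨e, h1, h2⟩ := (this.and self_mem_nhdsWithin).exists
    exact ⟨e, by linarith, h2⟩
  obtain ⟨r, hr, hb⟩ := h.lowFreq_test (n := 3) (by norm_num) he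
  have hid : Tendsto (fun t : ℝ => t) (𝓝[>] 0) (𝓝 0) := tendsto_id.mono_left nhdsWithin_le_nhds
  have hS : Tendsto (fun t => 2 / (p t * t) + t ^ 2) (𝓝[>] 0) (𝓝 (2 / (2 * q ^ 2) + 0 ^ 2)) :=
    (tendsto_const_nhds.div hpt (by positivity)).add (hid.pow 2)
  have e1 : ∀ᶠ t in 𝓝[>] (0 : ℝ), (K + e) * (2 / (p t * t) + t ^ 2) < κ - κ ^ 2 * t / 2 := by
    have h1 := hS.const_mul (K + e)
    have h2 : Tendsto (fun t : ℝ => κ - κ ^ 2 * t / 2) (𝓝[>] 0) (𝓝 (κ - κ ^ 2 * 0 / 2)) :=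
      tendsto_const_nhds.sub ((hid.const_mul _).div_const _)
    exact h1.eventually_lt h2 (by simpa using hκe)
  have e2 : ∀ᶠ t in 𝓝[>] (0 : ℝ), (2 / (p t * t) + t ^ 2) * t < r :=
    (hS.mul hid).eventually_lt_const (by simpa using hr)
  filter_upwards [hb κ, hp, e1, e2, self_mem_nhdsWithin] with t hb hp e1 e2 ht hρ
  have ht : 0 < t := ht
  have h0 : 1 / p t + 1 / p t + t ^ 3 = (2 / (p t * t) + t ^ 2) * t := by
    field_simp
    ring
  have h1 := hb _ _ hp hp (by rwa [h0]) hρ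
  rw [h0] at h1
  have h2 : 0 < (κ - κ ^ 2 * t / 2 - (K + e) * (2 / (p t * t) + t ^ 2)) * t :=
    mul_pos (by linarith) ht
  linarith

/-- The parameters which are at least as good as the model ones, one-sided case. -/
theorem oneSided_tendsto (h : RateBounds ρ K) (hq : 0 < q) (hK : K = 4 * q ^ 3)
    (hp : ∀ᶠ t in 𝓝[>] (0 : ℝ), 0 < p t ∧
      ρ (t ^ 3) (p t) (p t) ≤ ρ (t ^ 3) (2 * q ^ 2 / t) (2 * q ^ 2 / t)) :
    Tendsto (fun t => p t * t) (𝓝[>] 0) (𝓝 (2 * q ^ 2)) ∧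
      Tendsto (fun t => (1 - (ρ (t ^ 3) (p t) (p t)).toReal) / t) (𝓝[>] 0) (𝓝 (4 * q)) := by
  have hp0 := hp.mono fun t ht => ht.1
  have hρ : ∀ κ < 4 * q, ∀ᶠ t in 𝓝[>] (0 : ℝ),
      ρ (t ^ 3) (p t) (p t) ≤ ENNReal.ofReal (1 - κ * t) := fun κ hκ => by
    filter_upwards [hp, h.oneSided_upper hq hK hκ] with t h1 h2 using h1.2.trans h2
  have hpt := tendsto_of_eventually_bounds (fun e he => h.oneSided_lower hq hp0 hρ he)
    (fun e he => h.oneSided_upper_param hq hK hp0 hρ he)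
  refine ⟨hpt, tendsto_of_eventually_bounds (fun e he => ?_) (fun e he => ?_)⟩
  · have e3 : ∀ᶠ t in 𝓝[>] (0 : ℝ), 0 < 1 - (4 * q - e) * t :=
      eventually_lt_of_continuous (by fun_prop) (by simp)
    filter_upwards [hρ (4 * q - e) (by linarith), e3, self_mem_nhdsWithin] with t h1 h2 ht
    rw [le_div_iff₀ ht]
    have := ENNReal.toReal_le_of_le_ofReal (by linarith) h1
    linarith
  · filter_upwards [h.oneSided_rate hq hK hp0 hpt (κ := 4 * q + e) (by linarith),
      hρ 0 (by linarith), self_mem_nhdsWithin] with t h1 h2 ht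
    rw [div_le_iff₀ ht]
    by_contra! h3
    exact h1 (le_ofReal_of_toReal_le h2 (by linarith))

end RateBounds

namespace RateBounds

/-! #### Two-sided conditions -/

variable {ρ : ℝ → ℝ → ℝ → ℝ≥0∞} {K q κ : ℝ} {p m : ℝ → ℝ}

/-- A preliminary bound whose only use is to make `1/p` of order `t³` and thus negligible in the
lowest-frequency test. Off the optimal point, at `x = q/(2t⁴)`, the crude estimate `m ≤ p` is good
enough. -/
theorem twoSided_rough_lower (h : RateBounds ρ K) (hq : 0 < q)
    (hpm : ∀ᶠ t in 𝓝[>] (0 : ℝ), 0 < m t ∧ m t ≤ p t)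
    (hρ : ∀ κ < 2 * q, ∀ᶠ t in 𝓝[>] (0 : ℝ),
      ρ (t ^ 5) (p t) (m t) ≤ ENNReal.ofReal (1 - κ * t)) :
    ∀ᶠ t in 𝓝[>] (0 : ℝ), q ^ 2 / 4 ≤ p t * t ^ 3 := by
  obtain ⟨C, hC, hb⟩ := h.highFreq_test (n := 5) (i := 4) (by norm_num) (by norm_num)
    (a := q / 2) (by positivity)
  have hκ : 7 * q / 4 < 2 * q := by linarith
  set κ := 7 * q / 4 with hκ_def
  have e1 : ∀ᶠ t in 𝓝[>] (0 : ℝ), q < κ - κ ^ 2 * t / 2 - q / 2 - C * t ^ 3 :=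
    eventually_lt_of_continuous (by fun_prop) (by linarith)
  filter_upwards [hb κ, hρ κ hκ, hpm, e1, self_mem_nhdsWithin] with t hb hρ hpm e1 ht
  have ht : 0 < t := ht
  have hp : 0 < p t := hpm.1.trans_le hpm.2
  have h1 := hb (p t) (m t) _ _ hp hpm.1 (Or.inl rfl) (Or.inl rfl) hρ
  have h0 : m t / (q / 2 / t ^ 4) ≤ p t / (q / 2 / t ^ 4) := by
    have := hpm.2
    gcongr
  have h2 : p t / (q / 2 / t ^ 4) + p t / (q / 2 / t ^ 4) + q / 2 / t ^ 4 * t ^ 5 + C * t ^ 4 =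
      (4 * (p t * t ^ 3) / q + q / 2 + C * t ^ 3) * t := by
    field_simp
    ring
  have h3 : κ * t - (κ * t) ^ 2 / 2 = (κ - κ ^ 2 * t / 2) * t := by ring
  have h4 : (κ - κ ^ 2 * t / 2) * t ≤ (4 * (p t * t ^ 3) / q + q / 2 + C * t ^ 3) * t := by
    rw [← h2, ← h3]
    linarith
  have h5 := le_of_mul_le_mul_right h4 ht
  have h6 : q ≤ 4 * (p t * t ^ 3) / q := by linarith
  rw [le_div_iff₀ hq] at h6
  linarith

/-- With `1/p` negligible, the lowest frequency gives the rate `K/m`, so a larger `m` would fall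
short of `2qt`. -/
theorem twoSided_upper_min (h : RateBounds ρ K) (hq : 0 < q) (hK : K = 2 * q ^ 5)
    (hpm : ∀ᶠ t in 𝓝[>] (0 : ℝ), 0 < m t ∧ m t ≤ p t)
    (hρ : ∀ κ < 2 * q, ∀ᶠ t in 𝓝[>] (0 : ℝ),
      ρ (t ^ 5) (p t) (m t) ≤ ENNReal.ofReal (1 - κ * t)) {e : ℝ} (he : 0 < e) :
    ∀ᶠ t in 𝓝[>] (0 : ℝ), m t * t ≤ q ^ 4 + e := by
  obtain ⟨r, hr, hb⟩ := h.lowFreq_test (n := 5) (by norm_num) (e := q * e) (by positivity)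
  set Z := q ^ 4 + e with hZ
  have hZ0 : 0 < Z := by positivity
  obtain ⟨κ, hκ, hκ'⟩ : ∃ κ < 2 * q, (K + q * e) * (1 / Z) < κ := by
    have : (K + q * e) * (1 / Z) < 2 * q := by
      rw [mul_one_div, div_lt_iff₀ hZ0, hK]
      nlinarith [mul_pos hq he]
    obtain ⟨κ, a, b⟩ := exists_between this
    exact ⟨κ, b, a⟩
  have e1 : ∀ᶠ t in 𝓝[>] (0 : ℝ),
      0 < κ - κ ^ 2 * t / 2 - (K + q * e) * (1 / Z + 4 / q ^ 2 * t ^ 2 + t ^ 4) :=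
    eventually_lt_of_continuous (by fun_prop) (by simpa using hκ')
  have e2 : ∀ᶠ t in 𝓝[>] (0 : ℝ), 0 < r - (1 / Z + 4 / q ^ 2 * t ^ 2 + t ^ 4) * t :=
    eventually_lt_of_continuous (by fun_prop) (by simpa using hr)
  filter_upwards [hb κ, hρ κ hκ, hpm, h.twoSided_rough_lower hq hpm hρ, e1, e2,
    self_mem_nhdsWithin] with t hb hρ hpm hlow e1 e2 ht
  have ht : 0 < t := ht
  have hp : 0 < p t := hpm.1.trans_le hpm.2
  by_contra! hlt
  have h0 : 1 / m t ≤ 1 / Z * t := by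
    rw [div_mul_eq_mul_div, one_mul, div_le_div_iff₀ hpm.1 hZ0]
    linarith
  have h0' : 1 / p t ≤ 4 / q ^ 2 * t ^ 3 := by
    rw [div_mul_eq_mul_div, div_le_div_iff₀ hp (by positivity)]
    linarith
  have hS : 1 / p t + 1 / m t + t ^ 5 ≤ (1 / Z + 4 / q ^ 2 * t ^ 2 + t ^ 4) * t := by
    have : (1 / Z + 4 / q ^ 2 * t ^ 2 + t ^ 4) * t =
      4 / q ^ 2 * t ^ 3 + 1 / Z * t + t ^ 5 := by ring
    linarith
  have h1 := hb _ _ hp hpm.1 (by linarith) hρ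
  have hK0 : 0 ≤ K + q * e := by rw [hK]; positivity
  have h2 : κ * t - (κ * t) ^ 2 / 2 ≤
      (K + q * e) * ((1 / Z + 4 / q ^ 2 * t ^ 2 + t ^ 4) * t) := h1.trans (by gcongr)
  have h3 : 0 < (κ - κ ^ 2 * t / 2 -
      (K + q * e) * (1 / Z + 4 / q ^ 2 * t ^ 2 + t ^ 4)) * t := by positivity
  linarith

/-- Test at `x = q/t⁴`, the minimizer of `p/x + xδ` for the model `p`. The bound on `m` makes `m/x`
negligible, and `p t³/q + q ≥ 2q` remains in the limit. -/
theorem twoSided_lower_max (h : RateBounds ρ K) (hq : 0 < q) (hK : K = 2 * q ^ 5)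
    (hpm : ∀ᶠ t in 𝓝[>] (0 : ℝ), 0 < m t ∧ m t ≤ p t)
    (hρ : ∀ κ < 2 * q, ∀ᶠ t in 𝓝[>] (0 : ℝ),
      ρ (t ^ 5) (p t) (m t) ≤ ENNReal.ofReal (1 - κ * t)) {e : ℝ} (he : 0 < e) :
    ∀ᶠ t in 𝓝[>] (0 : ℝ), q ^ 2 - e ≤ p t * t ^ 3 := by
  obtain ⟨C, hC, hb⟩ := h.highFreq_test (n := 5) (i := 4) (by norm_num) (by norm_num) hq
  have heq : 0 < e / q := by positivity
  have hκ : 2 * q - e / q / 2 < 2 * q := by linarith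
  set κ := 2 * q - e / q / 2 with hκ_def
  have e1 : ∀ᶠ t in 𝓝[>] (0 : ℝ),
      q - e / q < κ - κ ^ 2 * t / 2 - q - (q ^ 4 + 1) * t ^ 2 / q - C * t ^ 3 :=
    eventually_lt_of_continuous (by fun_prop) (by
      simp only [ne_eq, OfNat.ofNat_ne_zero, not_false_eq_true, zero_pow, mul_zero, zero_div]
      linarith)
  filter_upwards [hb κ, hρ κ hκ, hpm, h.twoSided_upper_min hq hK hpm hρ one_pos, e1,
    self_mem_nhdsWithin] with t hb hρ hpm hz e1 ht
  have ht : 0 < t := ht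
  have hp : 0 < p t := hpm.1.trans_le hpm.2
  have h1 := hb (p t) (m t) _ _ hp hpm.1 (Or.inl rfl) (Or.inl rfl) hρ
  have h2 : p t / (q / t ^ 4) + m t / (q / t ^ 4) + q / t ^ 4 * t ^ 5 + C * t ^ 4 =
      (p t * t ^ 3 / q + m t * t * t ^ 2 / q + q + C * t ^ 3) * t := by
    field_simp
  have h3 : κ * t - (κ * t) ^ 2 / 2 = (κ - κ ^ 2 * t / 2) * t := by ring
  rw [h2, h3] at h1
  have h4 := le_of_mul_le_mul_right h1 ht
  have h0 : m t * t * t ^ 2 / q ≤ (q ^ 4 + 1) * t ^ 2 / q := by gcongr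
  have h5 : q - e / q ≤ p t * t ^ 3 / q := by linarith
  rw [le_div_iff₀ hq] at h5
  have h6 : (q - e / q) * q = q ^ 2 - e := by field_simp
  linarith

/-- The high frequency test at `x = q ^ 3 / t ^ 2`, between the two parameters. -/
theorem twoSided_middle (h : RateBounds ρ K) (hq : 0 < q)
    (hpm : ∀ᶠ t in 𝓝[>] (0 : ℝ), 0 < m t ∧ m t ≤ p t)
    (hρ : ∀ κ < 2 * q, ∀ᶠ t in 𝓝[>] (0 : ℝ),
      ρ (t ^ 5) (p t) (m t) ≤ ENNReal.ofReal (1 - κ * t)) (hκ : κ < 2 * q) :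
    ∀ᶠ t in 𝓝[>] (0 : ℝ), κ < q ^ 3 / (p t * t ^ 3) + m t * t / q ^ 3 := by
  obtain ⟨C, hC, hb⟩ := h.highFreq_test (n := 5) (i := 2) (by norm_num) (by norm_num)
    (a := q ^ 3) (by positivity)
  obtain ⟨κ', hκ', hκ''⟩ := exists_between hκ
  have e1 : ∀ᶠ t in 𝓝[>] (0 : ℝ), κ < κ' - κ' ^ 2 * t / 2 - q ^ 3 * t ^ 2 - C * t :=
    eventually_lt_of_continuous (by fun_prop) (by simpa using hκ')
  filter_upwards [hb κ', hρ κ' hκ'', hpm, e1, self_mem_nhdsWithin] with t hb hρ hpm e1 ht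
  have ht : 0 < t := ht
  have hp : 0 < p t := hpm.1.trans_le hpm.2
  have h1 := hb (p t) (m t) _ _ hp hpm.1 (Or.inr rfl) (Or.inl rfl) hρ
  have h2 : q ^ 3 / t ^ 2 / p t + m t / (q ^ 3 / t ^ 2) + q ^ 3 / t ^ 2 * t ^ 5 + C * t ^ 2 =
      (q ^ 3 / (p t * t ^ 3) + m t * t / q ^ 3 + q ^ 3 * t ^ 2 + C * t) * t := by
    field_simp
  have h3 : κ' * t - (κ' * t) ^ 2 / 2 = (κ' - κ' ^ 2 * t / 2) * t := by ring
  rw [h2, h3] at h1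
  have h4 := le_of_mul_le_mul_right h1 ht
  linarith

/-- The middle test bounds `q³/(p t³) + m t/q³` below by `2q` in the limit. With `m t ≤ q⁴` the
first term must be at least `q`. -/
theorem twoSided_upper_max (h : RateBounds ρ K) (hq : 0 < q) (hK : K = 2 * q ^ 5)
    (hpm : ∀ᶠ t in 𝓝[>] (0 : ℝ), 0 < m t ∧ m t ≤ p t)
    (hρ : ∀ κ < 2 * q, ∀ᶠ t in 𝓝[>] (0 : ℝ),
      ρ (t ^ 5) (p t) (m t) ≤ ENNReal.ofReal (1 - κ * t)) {e : ℝ} (he : 0 < e) :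
    ∀ᶠ t in 𝓝[>] (0 : ℝ), p t * t ^ 3 ≤ q ^ 2 + e := by
  have hgap : 0 < q - q ^ 3 / (q ^ 2 + e) := by
    rw [sub_pos, div_lt_iff₀ (by positivity)]
    nlinarith [mul_pos hq he]
  set g := q - q ^ 3 / (q ^ 2 + e) with hg
  filter_upwards [h.twoSided_middle hq hpm hρ (κ := 2 * q - g / 2) (by linarith),
    h.twoSided_upper_min hq hK hpm hρ (e := q ^ 3 * (g / 2)) (by positivity)] with t h1 h2
  by_contra! h3
  have h4 : q ^ 3 / (p t * t ^ 3) ≤ q ^ 3 / (q ^ 2 + e) := by gcongr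
  have h5 : m t * t / q ^ 3 ≤ (q ^ 4 + q ^ 3 * (g / 2)) / q ^ 3 := by gcongr
  have h6 : (q ^ 4 + q ^ 3 * (g / 2)) / q ^ 3 = q + g / 2 := by field_simp
  linarith

/-- The same middle test read the other way: `p t³ ≥ q²` in the limit leaves at least `q` for `m
t/q³`. -/
theorem twoSided_lower_min (h : RateBounds ρ K) (hq : 0 < q) (hK : K = 2 * q ^ 5)
    (hpm : ∀ᶠ t in 𝓝[>] (0 : ℝ), 0 < m t ∧ m t ≤ p t)
    (hρ : ∀ κ < 2 * q, ∀ᶠ t in 𝓝[>] (0 : ℝ),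
      ρ (t ^ 5) (p t) (m t) ≤ ENNReal.ofReal (1 - κ * t)) {e : ℝ} (he : 0 < e) :
    ∀ᶠ t in 𝓝[>] (0 : ℝ), q ^ 4 - e ≤ m t * t := by
  set g := e / q ^ 3 with hg
  have hg0 : 0 < g := by positivity
  have hgap : 0 < q ^ 2 - q ^ 3 / (q + g / 2) := by
    rw [sub_pos, div_lt_iff₀ (by positivity)]
    nlinarith [mul_pos (pow_pos hq 2) hg0]
  filter_upwards [h.twoSided_middle hq hpm hρ (κ := 2 * q - g / 2) (by linarith),
    h.twoSided_lower_max hq hK hpm hρ hgap] with t h1 h2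
  rw [sub_sub_cancel] at h2
  have h4 : q ^ 3 / (p t * t ^ 3) ≤ q + g / 2 := by
    have h0 : 0 < q ^ 3 / (q + g / 2) := by positivity
    rw [div_le_iff₀ (h0.trans_le h2)]
    rw [div_le_iff₀ (by positivity)] at h2
    linarith
  have h5 : q - g ≤ m t * t / q ^ 3 := by linarith
  rw [le_div_iff₀ (by positivity)] at h5
  have h6 : (q - g) * q ^ 3 = q ^ 4 - e := by
    rw [hg]
    field_simp
  linarith

/-- With the limits of both parameters known, the lowest-frequency test gives exactly `K/q⁴ = 2q`,
since `1/p` and `δ` are of lower order than `1/m`. -/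
theorem twoSided_rate (h : RateBounds ρ K) (hq : 0 < q) (hK : K = 2 * q ^ 5)
    (hpm : ∀ᶠ t in 𝓝[>] (0 : ℝ), 0 < m t ∧ m t ≤ p t)
    (hpt : Tendsto (fun t => p t * t ^ 3) (𝓝[>] 0) (𝓝 (q ^ 2)))
    (hmt : Tendsto (fun t => m t * t) (𝓝[>] 0) (𝓝 (q ^ 4))) {κ : ℝ} (hκ : 2 * q < κ) :
    ∀ᶠ t in 𝓝[>] (0 : ℝ), ¬ρ (t ^ 5) (p t) (m t) ≤ ENNReal.ofReal (1 - κ * t) := by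
  obtain ⟨e, hκe, he⟩ : ∃ e, (K + e) * (1 / q ^ 4) < κ ∧ 0 < e := by
    have : ∀ᶠ e in 𝓝[>] (0 : ℝ), 0 < κ - (K + e) * (1 / q ^ 4) :=
      eventually_lt_of_continuous (by fun_prop) (by
        have : K * (1 / q ^ 4) = 2 * q := by rw [hK]; field_simp
        rw [add_zero, this]
        linarith)
    obtain ⟨e, h1, h2⟩ := (this.and self_mem_nhdsWithin).exists
    exact ⟨e, by linarith, h2⟩
  obtain ⟨r, hr, hb⟩ := h.lowFreq_test (n := 5) (by norm_num) he
  have hid : Tendsto (fun t : ℝ => t) (𝓝[>] 0) (𝓝 0) := tendsto_id.mono_left nhdsWithin_le_nhds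
  have hS : Tendsto (fun t => 1 / (m t * t) + 1 / (p t * t ^ 3) * t ^ 2 + t ^ 4) (𝓝[>] 0)
      (𝓝 (1 / q ^ 4 + 1 / q ^ 2 * 0 ^ 2 + 0 ^ 4)) :=
    ((tendsto_const_nhds.div hmt (by positivity)).add
      ((tendsto_const_nhds.div hpt (by positivity)).mul (hid.pow 2))).add (hid.pow 4)
  have e1 : ∀ᶠ t in 𝓝[>] (0 : ℝ),
      (K + e) * (1 / (m t * t) + 1 / (p t * t ^ 3) * t ^ 2 + t ^ 4) < κ - κ ^ 2 * t / 2 := by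
    have h1 := hS.const_mul (K + e)
    have h2 : Tendsto (fun t : ℝ => κ - κ ^ 2 * t / 2) (𝓝[>] 0) (𝓝 (κ - κ ^ 2 * 0 / 2)) :=
      tendsto_const_nhds.sub ((hid.const_mul _).div_const _)
    exact h1.eventually_lt h2 (by simpa using hκe)
  have e2 : ∀ᶠ t in 𝓝[>] (0 : ℝ),
      (1 / (m t * t) + 1 / (p t * t ^ 3) * t ^ 2 + t ^ 4) * t < r :=
    (hS.mul hid).eventually_lt_const (by simpa using hr)
  filter_upwards [hb κ, hpm, e1, e2, self_mem_nhdsWithin] with t hb hpm e1 e2 ht hρ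
  have ht : 0 < t := ht
  have hm := hpm.1
  have hp : 0 < p t := hm.trans_le hpm.2
  have h0 : 1 / p t + 1 / m t + t ^ 5 =
      (1 / (m t * t) + 1 / (p t * t ^ 3) * t ^ 2 + t ^ 4) * t := by
    field_simp
    ring
  have h1 := hb _ _ hp hm (by rwa [h0]) hρ
  rw [h0] at h1
  have h2 : 0 < (κ - κ ^ 2 * t / 2 -
      (K + e) * (1 / (m t * t) + 1 / (p t * t ^ 3) * t ^ 2 + t ^ 4)) * t :=
    mul_pos (by linarith) ht
  linarith

/-- The parameters which are at least as good as the model ones, two-sided case. -/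
theorem twoSided_tendsto (h : RateBounds ρ K) (hq : 0 < q) (hK : K = 2 * q ^ 5)
    (hpm : ∀ᶠ t in 𝓝[>] (0 : ℝ), (0 < m t ∧ m t ≤ p t) ∧
      ρ (t ^ 5) (p t) (m t) ≤ ρ (t ^ 5) (q ^ 2 / t ^ 3) (q ^ 4 / t)) :
    Tendsto (fun t => p t * t ^ 3) (𝓝[>] 0) (𝓝 (q ^ 2)) ∧
      Tendsto (fun t => m t * t) (𝓝[>] 0) (𝓝 (q ^ 4)) ∧
      Tendsto (fun t => (1 - (ρ (t ^ 5) (p t) (m t)).toReal) / t) (𝓝[>] 0) (𝓝 (2 * q)) := by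
  have hpm0 := hpm.mono fun t ht => ht.1
  have hρ : ∀ κ < 2 * q, ∀ᶠ t in 𝓝[>] (0 : ℝ),
      ρ (t ^ 5) (p t) (m t) ≤ ENNReal.ofReal (1 - κ * t) := fun κ hκ => by
    filter_upwards [hpm, h.twoSided_upper hq hK hκ] with t h1 h2 using h1.2.trans h2
  have hpt := tendsto_of_eventually_bounds
    (fun e he => h.twoSided_lower_max hq hK hpm0 hρ he)
    (fun e he => h.twoSided_upper_max hq hK hpm0 hρ he)
  have hmt := tendsto_of_eventually_bounds
    (fun e he => h.twoSided_lower_min hq hK hpm0 hρ he)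
    (fun e he => h.twoSided_upper_min hq hK hpm0 hρ he)
  refine ⟨hpt, hmt, tendsto_of_eventually_bounds (fun e he => ?_) (fun e he => ?_)⟩
  · have e3 : ∀ᶠ t in 𝓝[>] (0 : ℝ), 0 < 1 - (2 * q - e) * t :=
      eventually_lt_of_continuous (by fun_prop) (by simp)
    filter_upwards [hρ (2 * q - e) (by linarith), e3, self_mem_nhdsWithin] with t h1 h2 ht
    rw [le_div_iff₀ ht]
    have := ENNReal.toReal_le_of_le_ofReal (by linarith) h1
    linarith
  · filter_upwards [h.twoSided_rate hq hK hpm0 hpt hmt (κ := 2 * q + e) (by linarith),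
      hρ 0 (by linarith), self_mem_nhdsWithin] with t h1 h2 ht
    rw [div_le_iff₀ ht]
    by_contra! h3
    exact h1 (le_ofReal_of_toReal_le h2 (by linarith))

end RateBounds

/-! ### Existence of optimal parameters -/

/-- For each `t` the chosen `f t` is a counterexample to the implication whenever one exists. Thus a
statement about all families becomes uniform in the parameter, as needed to enclose whole sublevel
sets. -/
theorem eventually_forall_of_forall_function {α β : Type*} [Nonempty β] {l : Filter α}
    {P Q : α → β → Prop} (hne : ∀ᶠ t in l, ∃ b, P t b)
    (h : ∀ f : α → β, (∀ᶠ t in l, P t (f t)) → ∀ᶠ t in l, Q t (f t)) :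
    ∀ᶠ t in l, ∀ b, P t b → Q t b := by
  have hex : ∀ t, ∃ b, (∃ b, P t b) → P t b ∧ (Q t b → ∀ b, P t b → Q t b) := fun t => by
    by_cases hall : ∀ b, P t b → Q t b
    · by_cases hP : ∃ b, P t b
      · obtain ⟨b, hb⟩ := hP
        exact ⟨b, fun _ => ⟨hb, fun _ => hall⟩⟩
      · exact ⟨Classical.arbitrary β, fun hP' => (hP hP').elim⟩
    · push Not at hall
      obtain ⟨b, hb, hQ⟩ := hall
      exact ⟨b, fun _ => ⟨hb, fun hQ' => (hQ hQ').elim⟩⟩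
  choose f hf using hex
  filter_upwards [hne, h f (hne.mono fun t ht => (hf t ht).1)] with t ht hQ
  exact (hf t ht).2 hQ

namespace RateBounds

variable {ρ : ℝ → ℝ → ℝ → ℝ≥0∞} {K q : ℝ}

/-- Every `p` at least as good as the model one eventually has `p t` between `q²` and `3q²`, since
such families converge to `2q²`. A lower semicontinuous function attains its minimum on that compact
interval. -/
theorem oneSided_exists_isMinOn (h : RateBounds ρ K) (hq : 0 < q) (hK : K = 4 * q ^ 3)
    (hlsc : ∀ δ > 0, LowerSemicontinuousOn (fun p => ρ δ p p) (Set.Ioi 0)) :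
    ∀ᶠ t in 𝓝[>] (0 : ℝ), ∃ p, 0 < p ∧ IsMinOn (fun r => ρ (t ^ 3) r r) (Set.Ioi 0) p := by
  have hbox := eventually_forall_of_forall_function (l := 𝓝[>] (0 : ℝ))
    (P := fun t p => 0 < p ∧ ρ (t ^ 3) p p ≤ ρ (t ^ 3) (2 * q ^ 2 / t) (2 * q ^ 2 / t))
    (Q := fun t p => p * t ∈ Set.Ioo (q ^ 2) (3 * q ^ 2))
    (by
      filter_upwards [self_mem_nhdsWithin] with t ht
      have ht : 0 < t := ht
      exact ⟨2 * q ^ 2 / t, by positivity, le_rfl⟩)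
    (fun f hf => by
      have hq2 := pow_pos hq 2
      exact (h.oneSided_tendsto hq hK hf).1.eventually
        (Ioo_mem_nhds (by linarith) (by linarith)))
  filter_upwards [hbox, self_mem_nhdsWithin] with t hbox ht
  have ht : 0 < t := ht
  have hsub : Set.Icc (q ^ 2 / t) (3 * q ^ 2 / t) ⊆ Set.Ioi 0 := fun x hx =>
    lt_of_lt_of_le (by positivity) hx.1
  have hmem : ∀ p, p * t ∈ Set.Ioo (q ^ 2) (3 * q ^ 2) →
      p ∈ Set.Icc (q ^ 2 / t) (3 * q ^ 2 / t) := fun p hp =>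
    ⟨(div_le_iff₀ ht).2 hp.1.le, (le_div_iff₀ ht).2 hp.2.le⟩
  obtain ⟨a, ha, hmin⟩ := exists_isMinOn_of_sublevel_subset isCompact_Icc
    ((hlsc (t ^ 3) (by positivity)).mono hsub) (Ω := Set.Ioi 0) (x₀ := 2 * q ^ 2 / t)
    (hmem _ (hbox _ ⟨by positivity, le_rfl⟩)) (fun p hp hle => hmem _ (hbox _ ⟨hp, hle⟩))
  exact ⟨a, hsub ha, hmin⟩

/-- The minimum is first attained among the pairs with `m ≤ p`, where competitive pairs lie in a
box. For small `t` that box is strictly off the diagonal, and the swap symmetry extends minimality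
to the whole quadrant. -/
theorem twoSided_exists_isMinOn (h : RateBounds ρ K) (hq : 0 < q) (hK : K = 2 * q ^ 5)
    (hlsc : ∀ δ > 0, LowerSemicontinuousOn (fun p : ℝ × ℝ => ρ δ p.1 p.2)
      (Set.Ioi 0 ×ˢ Set.Ioi 0)) (hswap : ∀ δ p m, ρ δ m p = ρ δ p m) :
    ∀ᶠ t in 𝓝[>] (0 : ℝ), ∃ p : ℝ × ℝ, 0 < p.2 ∧ p.2 < p.1 ∧
      IsMinOn (fun r : ℝ × ℝ => ρ (t ^ 5) r.1 r.2) (Set.Ioi 0 ×ˢ Set.Ioi 0) p := by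
  have e1 : ∀ᶠ t in 𝓝[>] (0 : ℝ), 0 < q ^ 2 / 2 - 2 * q ^ 4 * t ^ 2 :=
    eventually_lt_of_continuous (by fun_prop) (by simp; positivity)
  have hbox := eventually_forall_of_forall_function (l := 𝓝[>] (0 : ℝ))
    (P := fun t (p : ℝ × ℝ) => (0 < p.2 ∧ p.2 ≤ p.1) ∧
      ρ (t ^ 5) p.1 p.2 ≤ ρ (t ^ 5) (q ^ 2 / t ^ 3) (q ^ 4 / t))
    (Q := fun t p => p.1 * t ^ 3 ∈ Set.Ioo (q ^ 2 / 2) (2 * q ^ 2) ∧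
      p.2 * t ∈ Set.Ioo (q ^ 4 / 2) (2 * q ^ 4))
    (by
      filter_upwards [e1, self_mem_nhdsWithin] with t e1 ht
      have ht : 0 < t := ht
      refine ⟨(q ^ 2 / t ^ 3, q ^ 4 / t), ⟨by positivity, ?_⟩, le_rfl⟩
      rw [div_le_div_iff₀ ht (by positivity)]
      nlinarith [pow_pos hq 2, mul_pos (pow_pos hq 4) (pow_pos ht 2)])
    (fun f hf => by
      obtain ⟨h1, h2, -⟩ := h.twoSided_tendsto hq hK hf
      have hq2 := pow_pos hq 2
      have hq4 := pow_pos hq 4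
      exact (h1.eventually (Ioo_mem_nhds (by linarith) (by linarith))).and
        (h2.eventually (Ioo_mem_nhds (by linarith) (by linarith))))
  filter_upwards [hbox, e1, self_mem_nhdsWithin] with t hbox e1 ht
  have ht : 0 < t := ht
  set B := Set.Icc (q ^ 2 / 2 / t ^ 3) (2 * q ^ 2 / t ^ 3) ×ˢ
    Set.Icc (q ^ 4 / 2 / t) (2 * q ^ 4 / t) with hB
  have hsub : B ⊆ Set.Ioi 0 ×ˢ Set.Ioi 0 := fun x hx =>
    ⟨lt_of_lt_of_le (by positivity) hx.1.1, lt_of_lt_of_le (by positivity) hx.2.1⟩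
  have hmem : ∀ p : ℝ × ℝ, (0 < p.2 ∧ p.2 ≤ p.1) ∧
      ρ (t ^ 5) p.1 p.2 ≤ ρ (t ^ 5) (q ^ 2 / t ^ 3) (q ^ 4 / t) → p ∈ B := fun p hp => by
    obtain ⟨h1, h2⟩ := hbox p hp
    have ht3 : 0 < t ^ 3 := by positivity
    exact ⟨⟨(div_le_iff₀ ht3).2 h1.1.le, (le_div_iff₀ ht3).2 h1.2.le⟩,
      ⟨(div_le_iff₀ ht).2 h2.1.le, (le_div_iff₀ ht).2 h2.2.le⟩⟩
  have hlt : 2 * q ^ 4 / t < q ^ 2 / 2 / t ^ 3 := by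
    rw [div_lt_div_iff₀ ht (by positivity)]
    nlinarith
  have hle : q ^ 4 / t ≤ q ^ 2 / t ^ 3 := by
    rw [div_le_div_iff₀ ht (by positivity)]
    nlinarith [pow_pos hq 2, mul_pos (pow_pos hq 4) (pow_pos ht 2)]
  have hmodel : (q ^ 2 / t ^ 3, q ^ 4 / t) ∈ B := hmem _ ⟨⟨by positivity, hle⟩, le_rfl⟩
  obtain ⟨a, ha, hmin⟩ := exists_isMinOn_of_sublevel_subset (isCompact_Icc.prod isCompact_Icc)
    ((hlsc (t ^ 5) (by positivity)).mono hsub) (Ω := {p : ℝ × ℝ | 0 < p.2 ∧ p.2 ≤ p.1})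
    hmodel (fun p hp hle => hmem p ⟨hp, hle⟩)
  refine ⟨a, (hsub ha).2, ha.2.2.trans_lt (hlt.trans_le ha.1.1), ?_⟩
  rintro ⟨x, y⟩ ⟨hx, hy⟩
  rcases le_total y x with hle | hle
  · exact hmin (a := (x, y)) ⟨hy, hle⟩
  · have := hmin (a := (y, x)) ⟨hx, hle⟩
    have h2 : ρ (t ^ 5) a.1 a.2 ≤ ρ (t ^ 5) y x := this
    rw [hswap _ x y] at h2
    exact h2

end RateBounds

/-! ### Change of the small parameter -/

theorem tendsto_root_nhdsGT_zero {a : ℝ} (ha : 0 < a) :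
    Tendsto (fun δ : ℝ => δ ^ a) (𝓝[>] 0) (𝓝[>] 0) := by
  refine tendsto_nhdsWithin_iff.2 ⟨?_, ?_⟩
  · have := (Real.continuousAt_rpow_const 0 a (Or.inr ha.le)).tendsto
    rw [Real.zero_rpow ha.ne'] at this
    exact this.mono_left nhdsWithin_le_nhds
  · filter_upwards [self_mem_nhdsWithin] with t ht using Real.rpow_pos_of_pos ht a

theorem eventually_of_eventually_pow {n : ℕ} (hn : n ≠ 0) {P : ℝ → Prop}
    (h : ∀ᶠ t in 𝓝[>] (0 : ℝ), P (t ^ n)) : ∀ᶠ δ in 𝓝[>] (0 : ℝ), P δ := by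
  have hn' : 0 < (n : ℝ)⁻¹ := by positivity
  filter_upwards [(tendsto_root_nhdsGT_zero hn').eventually h, self_mem_nhdsWithin] with δ h1 hδ
  rwa [Real.rpow_inv_natCast_pow (le_of_lt hδ) hn] at h1

/-- Undoes the substitution `δ = t^n`: a limit in `t` becomes an equivalence in `δ` through `t =
δ^{1/n}`. -/
theorem isEquivalent_const_mul_rpow {f : ℝ → ℝ} {g : ℝ → ℝ} {A a : ℝ} {n : ℕ} (hn : n ≠ 0)
    (hA : A ≠ 0) (hg : Tendsto g (𝓝[>] 0) (𝓝 A))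
    (hfg : ∀ᶠ t in 𝓝[>] (0 : ℝ), f (t ^ n) = g t * t ^ (n * a)) :
    f ~[𝓝[>] 0] fun δ => A * δ ^ a := by
  have hn' : 0 < (n : ℝ)⁻¹ := by positivity
  have hroot := tendsto_root_nhdsGT_zero hn'
  have h1 : f =ᶠ[𝓝[>] 0] fun δ => g (δ ^ (n : ℝ)⁻¹) * δ ^ a := by
    filter_upwards [hroot.eventually hfg, self_mem_nhdsWithin] with δ h1 hδ
    have hδ : 0 < δ := hδ
    rw [Real.rpow_inv_natCast_pow hδ.le hn, ← Real.rpow_mul hδ.le] at h1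
    rw [h1, inv_mul_cancel_left₀ (by exact_mod_cast hn)]
  have h2 : (fun δ => g (δ ^ (n : ℝ)⁻¹)) ~[𝓝[>] 0] fun _ => A :=
    (isEquivalent_const_iff_tendsto hA).2 (hg.comp hroot)
  exact (h2.mul IsEquivalent.refl).congr_left h1.symm

/-! ### The constants of the theorem -/

theorem exists_pos_mul_pow_eq {K a : ℝ} {n : ℕ} (hK : 0 < K) (ha : 0 < a) (hn : n ≠ 0) :
    ∃ q, 0 < q ∧ K = a * q ^ n :=
  ⟨(K / a) ^ (n : ℝ)⁻¹, by positivity, by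
    rw [Real.rpow_inv_natCast_pow (by positivity) hn]
    field_simp⟩

theorem oneSided_constants {K q : ℝ} (hq : 0 < q) (hK : K = 4 * q ^ 3) :
    (K ^ 2 / 2) ^ (1 / 3 : ℝ) = 2 * q ^ 2 ∧
      (2 : ℝ) ^ (4 / 3 : ℝ) * K ^ (1 / 3 : ℝ) = 4 * q := by
  constructor
  · have e : K ^ 2 / 2 = (2 * q ^ 2) ^ 3 := by
      rw [hK]
      ring
    rw [e, ← Real.rpow_natCast, ← Real.rpow_mul (by positivity)]
    norm_num
  · have e : K = 2 ^ (2 : ℝ) * q ^ (3 : ℝ) := by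
      rw [hK, Real.rpow_ofNat, Real.rpow_ofNat]
      norm_num
    rw [e, Real.mul_rpow (by positivity) (by positivity), ← Real.rpow_mul hq.le,
      ← Real.rpow_mul two_pos.le, ← mul_assoc, ← Real.rpow_add two_pos]
    norm_num

theorem twoSided_constants {K q : ℝ} (hq : 0 < q) (hK : K = 2 * q ^ 5) :
    (K / 2) ^ (2 / 5 : ℝ) = q ^ 2 ∧ (K / 2) ^ (4 / 5 : ℝ) = q ^ 4 ∧
      (2 : ℝ) ^ (4 / 5 : ℝ) * K ^ (1 / 5 : ℝ) = 2 * q := by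
  have e : K / 2 = q ^ (5 : ℝ) := by
    rw [hK, Real.rpow_ofNat]
    ring
  refine ⟨?_, ?_, ?_⟩
  · rw [e, ← Real.rpow_mul hq.le]
    norm_num
  · rw [e, ← Real.rpow_mul hq.le]
    norm_num
  · have e' : K = 2 ^ (1 : ℝ) * q ^ (5 : ℝ) := by
      rw [← e, Real.rpow_one]
      ring
    rw [e', Real.mul_rpow (by positivity) (by positivity), ← Real.rpow_mul hq.le,
      ← Real.rpow_mul two_pos.le, ← mul_assoc, ← Real.rpow_add two_pos]
    norm_num

end StripOSM

/-! ### Assembly of the theorem. -/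

theorem mainTheorem1
    (J : ℕ) (hJ : 2 ≤ J)
    (L Lhat η ε : ℝ) (hL : 0 < L) (hLhat : 0 < Lhat) (hη : 0 ≤ η) (hε : 0 ≤ ε)
    -- the frequency range is `[π / Lhat, M δ * π / Lhat]`, with `M δ` at least of order `1 / δ`
    (M : ℝ → ℝ) (hM : ∃ c > 0, ∀ᶠ δ in 𝓝[>] (0 : ℝ), c / δ ≤ M δ)
    (ρ : ℝ → ℝ → ℝ → ℝ≥0∞)
    (hρ : ∀ δ pPlus pMinus : ℝ, ρ δ pPlus pMinus =
      StripOSM.convergenceFactor J L δ η ε (Real.pi / Lhat) (M δ * Real.pi / Lhat) pPlus pMinus)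
    (s : ℂ) (hs : s = StripOSM.symbol η ε (Real.pi / Lhat))
    (K : ℝ)
    (hK : K = if 0 ≤ (s / Complex.sinh (s * L)).re
      then StripOSM.lowFreqConst s L (Real.cos (Real.pi / J))
      else StripOSM.lowFreqConst s L (-Real.cos (Real.pi / J))) :
    0 < K ∧
    -- one-sided conditions, `p⁺ = p⁻ = p`: optimal parameters exist,
    (∀ᶠ δ in 𝓝[>] (0 : ℝ), ∃ p : ℝ, 0 < p ∧ IsMinOn (fun q => ρ δ q q) (Set.Ioi 0) p) ∧
    -- and every choice of them has the claimed asymptotics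
    (∀ p : ℝ → ℝ,
      (∀ᶠ δ in 𝓝[>] (0 : ℝ), 0 < p δ ∧ IsMinOn (fun q => ρ δ q q) (Set.Ioi 0) (p δ)) →
      p ~[𝓝[>] 0] (fun δ => (K ^ 2 / 2) ^ (1 / 3 : ℝ) * δ ^ (-1 / 3 : ℝ)) ∧
      (fun δ => 1 - (ρ δ (p δ) (p δ)).toReal) ~[𝓝[>] 0]
        (fun δ => (2 : ℝ) ^ (4 / 3 : ℝ) * K ^ (1 / 3 : ℝ) * δ ^ (1 / 3 : ℝ))) ∧
    -- two-sided conditions: the roles of the two parameters can be switched,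
    (∀ δ pPlus pMinus : ℝ, 0 < δ → 0 < pPlus → 0 < pMinus →
      ρ δ pMinus pPlus = ρ δ pPlus pMinus) ∧
    -- optimal pairs of parameters exist,
    (∀ᶠ δ in 𝓝[>] (0 : ℝ), ∃ p : ℝ × ℝ, 0 < p.2 ∧ p.2 < p.1 ∧
      IsMinOn (fun q : ℝ × ℝ => ρ δ q.1 q.2) (Set.Ioi 0 ×ˢ Set.Ioi 0) p) ∧
    -- and every choice of them has, up to the order of the pair, the claimed asymptotics
    (∀ p : ℝ → ℝ × ℝ,
      (∀ᶠ δ in 𝓝[>] (0 : ℝ), p δ ∈ Set.Ioi (0 : ℝ) ×ˢ Set.Ioi (0 : ℝ) ∧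
        IsMinOn (fun q : ℝ × ℝ => ρ δ q.1 q.2) (Set.Ioi 0 ×ˢ Set.Ioi 0) (p δ)) →
      (fun δ => max (p δ).1 (p δ).2) ~[𝓝[>] 0]
        (fun δ => (K / 2) ^ (2 / 5 : ℝ) * δ ^ (-3 / 5 : ℝ)) ∧
      (fun δ => min (p δ).1 (p δ).2) ~[𝓝[>] 0]
        (fun δ => (K / 2) ^ (4 / 5 : ℝ) * δ ^ (-1 / 5 : ℝ)) ∧
      (fun δ => 1 - (ρ δ (p δ).1 (p δ).2).toReal) ~[𝓝[>] 0]
        (fun δ => (2 : ℝ) ^ (4 / 5 : ℝ) * K ^ (1 / 5 : ℝ) * δ ^ (1 / 5 : ℝ))) := by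
  have hkmin : 0 < Real.pi / Lhat := by positivity
  have hsre : 0 < s.re := hs ▸ StripOSM.re_symbol_pos ε hη hkmin
  have hsim : |s.im| < s.re := hs ▸ StripOSM.abs_im_symbol_lt ε hη hkmin
  have hcos : |Real.cos (Real.pi / J)| ≤ 1 := Real.abs_cos_le_one _
  have hK0 : 0 < K := by
    rw [hK]
    split_ifs
    · exact StripOSM.lowFreqConst_pos hL hsre hsim hcos
    · exact StripOSM.lowFreqConst_pos hL hsre hsim (by rwa [abs_neg])
  have hρ' : ρ = fun δ p m => StripOSM.convergenceFactor J L δ η ε (Real.pi / Lhat)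
      (M δ * Real.pi / Lhat) p m := by
    funext δ p m
    exact hρ δ p m
  have hkmax : ∃ c > 0, ∀ᶠ δ in 𝓝[>] (0 : ℝ), c / δ ≤ M δ * Real.pi / Lhat := by
    obtain ⟨c, hc, h⟩ := hM
    refine ⟨c * (Real.pi / Lhat), by positivity, h.mono fun δ hδ => ?_⟩
    rw [mul_div_right_comm, mul_div_assoc]
    gcongr
  have hb : StripOSM.RateBounds ρ K := by
    rw [hρ']
    exact StripOSM.rateBounds_convergenceFactor hJ hL hη hε hkmin hkmax (by rw [hK, hs])
  have hswap : ∀ δ p m, ρ δ m p = ρ δ p m := fun δ p m => by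
    rw [hρ, hρ, StripOSM.convergenceFactor_swap]
  have hlsc : ∀ δ > 0, LowerSemicontinuousOn (fun p : ℝ × ℝ => ρ δ p.1 p.2)
      (Set.Ioi 0 ×ˢ Set.Ioi 0) := fun δ hδ => by
    rw [hρ']
    exact StripOSM.lowerSemicontinuousOn_convergenceFactor hJ hL hη ε hkmin (le_of_lt hδ) _
  refine ⟨hK0, ?_, ?_, fun δ p m _ _ _ => hswap δ p m, ?_, ?_⟩
  -- The parametrizations `K = 4q³`, `δ = t³` here, and `K = 2q⁵`, `δ = t⁵` below, remove all
  -- fractional powers from the balancing argument.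
  · obtain ⟨q, hq, hKq⟩ := StripOSM.exists_pos_mul_pow_eq (n := 3) hK0 four_pos (by norm_num)
    refine StripOSM.eventually_of_eventually_pow (n := 3) (by norm_num)
      (hb.oneSided_exists_isMinOn hq hKq fun δ hδ => ?_)
    exact (hlsc δ hδ).comp (g := fun p : ℝ => (p, p)) (by fun_prop) fun p hp => ⟨hp, hp⟩
  · obtain ⟨q, hq, hKq⟩ := StripOSM.exists_pos_mul_pow_eq (n := 3) hK0 four_pos (by norm_num)
    intro p hp
    have h3 := (StripOSM.tendsto_pow_nhdsGT_zero (n := 3) (by norm_num)).eventually hp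
    obtain ⟨h1, h2⟩ := hb.oneSided_tendsto (p := fun t => p (t ^ 3)) hq hKq (by
      filter_upwards [h3, self_mem_nhdsWithin] with t ⟨ha, hmin⟩ ht
      have ht : 0 < t := ht
      exact ⟨ha, hmin (a := 2 * q ^ 2 / t) (Set.mem_Ioi.2 (by positivity))⟩)
    obtain ⟨c1, c2⟩ := StripOSM.oneSided_constants hq hKq
    rw [c1, c2]
    constructor
    · refine StripOSM.isEquivalent_const_mul_rpow (n := 3) (by norm_num) (by positivity) h1 ?_
      filter_upwards [self_mem_nhdsWithin] with t ht
      rw [show ((3 : ℕ) : ℝ) * (-1 / 3) = -1 by norm_num, Real.rpow_neg_one, mul_assoc,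
        mul_inv_cancel₀ (ne_of_gt ht), mul_one]
    · refine StripOSM.isEquivalent_const_mul_rpow (n := 3) (by norm_num) (by positivity) h2 ?_
      filter_upwards [self_mem_nhdsWithin] with t ht
      rw [show ((3 : ℕ) : ℝ) * (1 / 3) = 1 by norm_num, Real.rpow_one,
        div_mul_cancel₀ _ (ne_of_gt ht)]
  · obtain ⟨q, hq, hKq⟩ := StripOSM.exists_pos_mul_pow_eq (n := 5) hK0 two_pos (by norm_num)
    exact StripOSM.eventually_of_eventually_pow (n := 5) (by norm_num)
      (hb.twoSided_exists_isMinOn hq hKq hlsc hswap)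
  · obtain ⟨q, hq, hKq⟩ := StripOSM.exists_pos_mul_pow_eq (n := 5) hK0 two_pos (by norm_num)
    intro p hp
    have h5 := (StripOSM.tendsto_pow_nhdsGT_zero (n := 5) (by norm_num)).eventually hp
    have hmm : ∀ δ x y, ρ δ (max x y) (min x y) = ρ δ x y := fun δ x y => by
      rcases le_total x y with h | h
      · rw [max_eq_right h, min_eq_left h, hswap]
      · rw [max_eq_left h, min_eq_right h]
    -- Ordering the pair by `max` and `min` does not change the convergence factor, by the swap
    -- symmetry, so the asymptotics for ordered pairs apply to arbitrary minimizers.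
    obtain ⟨h1, h2, h3⟩ := hb.twoSided_tendsto (p := fun t => max (p (t ^ 5)).1 (p (t ^ 5)).2)
      (m := fun t => min (p (t ^ 5)).1 (p (t ^ 5)).2) hq hKq (by
        filter_upwards [h5, self_mem_nhdsWithin] with t ⟨ha, hmin⟩ ht
        have ht : 0 < t := ht
        refine ⟨⟨lt_min ha.1 ha.2, min_le_max⟩, ?_⟩
        rw [hmm]
        exact hmin (a := (q ^ 2 / t ^ 3, q ^ 4 / t))
          ⟨Set.mem_Ioi.2 (by positivity), Set.mem_Ioi.2 (by positivity)⟩)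
    obtain ⟨c1, c2, c3⟩ := StripOSM.twoSided_constants hq hKq
    rw [c1, c2, c3]
    refine ⟨?_, ?_, ?_⟩
    · refine StripOSM.isEquivalent_const_mul_rpow (n := 5) (by norm_num) (by positivity) h1 ?_
      filter_upwards [self_mem_nhdsWithin] with t ht
      have ht : 0 < t := ht
      rw [show ((5 : ℕ) : ℝ) * (-3 / 5) = -((3 : ℕ) : ℝ) by norm_num, Real.rpow_neg ht.le,
        Real.rpow_natCast, mul_assoc, mul_inv_cancel₀ (by positivity), mul_one]
    · refine StripOSM.isEquivalent_const_mul_rpow (n := 5) (by norm_num) (by positivity) h2 ?_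
      filter_upwards [self_mem_nhdsWithin] with t ht
      rw [show ((5 : ℕ) : ℝ) * (-1 / 5) = -1 by norm_num, Real.rpow_neg_one, mul_assoc,
        mul_inv_cancel₀ (ne_of_gt ht), mul_one]
    · refine StripOSM.isEquivalent_const_mul_rpow (n := 5) (by norm_num) (by positivity) h3 ?_
      filter_upwards [self_mem_nhdsWithin] with t ht
      rw [show ((5 : ℕ) : ℝ) * (1 / 5) = 1 by norm_num, Real.rpow_one,
        div_mul_cancel₀ _ (ne_of_gt ht), hmm]
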